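/- Let $\mathcal T$ be a tiling of the plane by squares with sides parallel to the axes (closed squares covering the plane, with disjoint interiors, only finitely many meeting any compact set). A point is \emph{singular} if it lies in exactly four squares. A \emph{choice of faces} selects at each singular point whether the horizontal direction passes through it (and the vertical one is broken there) or the vertical direction passes through it (and the horizontal one is broken there). For such a choice, a \emph{horizontal face} is a class of the equivalence relation on horizontal edges of squares generated by relating two edges that share a point at which the horizontal direction is not broken; \emph{vertical faces} are defined likewise. $\mathcal T$ is \emph{edge finite} for the choice if every horizontal and vertical face contains finitely many edges; it is edge finite if this holds for every choice, and \emph{regular} if it is edge finite and has no singular point (so that there is only one choice). A \emph{plane map} is a connected graph drawn in the plane (edges are simple polygonal arcs between distinct vertices, meeting only in vertices; multiple edges allowed) such that all faces, i.e. components of the complement, are bounded and only finitely many vertices and edges meet any compact set. A directed edge is a pair $(v,e)$ of a vertex $v$ and an edge $e$ containing $v$, directed away from $v$. A vector $w$ on the directed edges is \emph{harmonic} if its sums over the directed edges starting at any given vertex, over the two directed edges of any given edge, and over the directed edges having any given face on the right, all vanish; $w_e$ is the common absolute value of $w$ on the two directions of $e$. An isomorphism of plane maps consists of bijections of vertices,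 edges and faces respecting incidence, the sides of directed edges and the cyclic order of edges around vertices. Let a choice of faces for which $\mathcal T$ is edge finite be given (any choice, if $\mathcal T$ is edge finite). Then there are a plane map $\mathcal M$ and a harmonic vector $w$ on $\mathcal M$ such that: (i) The squares of $\mathcal T$ correspond bijectively to the edges of $\mathcal M$, and $w_e$ is the size of the square corresponding to $e$. (ii) The vertices of $\mathcal M$ correspond bijectively to the horizontal faces of $\mathcal T$ and the faces of $\mathcal M$ to the vertical faces of $\mathcal T$: the edge of a square $C$ joins the horizontal faces containing the upper and the lower edge of $C$; directed downwards it has the vertical face containing the left edge of $C$ on its right and $w$ equals the size of $C$; directed upwards it has the vertical face containing the right edge of $C$ on its right and $w$ equals minus the size. By these properties $(\mathcal M,w)$ is determined uniquely up to isomorphism, the isomorphism being compatible with the correspondences. (iii) $\mathcal M$ and $w$ can be taken invariant under all translations that preserve $\mathcal T$ and the choice of faces; in particular, if $\mathcal T$ and the choice are periodic (invariant under translations in two non-parallel directions), then so are $\mathcal M$ and $w$. (iv) If $\mathcal T$ is regular, then $(\mathcal M, w)$ is determined uniquely up to isomorphism by $\mathcal T$ alone. In that case the tiling obtained by rotating $\mathcal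 T$ by $90$ degrees is again regular, and its plane map is the dual $\mathcal M^*$ of $\mathcal M$. -/

import Mathlib

open Complex Set Filter Topology

noncomputable section

/-! ### Squares and square tilings of the plane, the plane being identified with `ℂ` -/

/-- A square with sides parallel to the axes, given by its lower left corner and its size. -/
@[ext] structure Square where
  corner : ℂ
  side : ℝ
  side_pos : 0 < side

namespace Square

/-- The closed square as a subset of the plane. -/
def region (q : Square) : Set ℂ :=
  Icc q.corner.re (q.corner.re + q.side) ×ℂ Icc q.corner.im (q.corner.im + q.side)

/-- Upper horizontal edge. -/
def top (q : Square) : Set ℂ :=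
  Icc q.corner.re (q.corner.re + q.side) ×ℂ {q.corner.im + q.side}

/-- Lower horizontal edge. -/
def bottom (q : Square) : Set ℂ :=
  Icc q.corner.re (q.corner.re + q.side) ×ℂ {q.corner.im}

/-- Left vertical edge. -/
def left (q : Square) : Set ℂ :=
  {q.corner.re} ×ℂ Icc q.corner.im (q.corner.im + q.side)

/-- Right vertical edge. -/
def right (q : Square) : Set ℂ :=
  {q.corner.re + q.side} ×ℂ Icc q.corner.im (q.corner.im + q.side)

/-- The square translated by `t`. -/
def translate (t : ℂ) (q : Square) : Square := ⟨q.corner + t, q.side, q.side_pos⟩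

/-- The square rotated counterclockwise by 90 degrees around the origin. -/
def rotate (q : Square) : Square := ⟨I * q.corner - q.side, q.side, q.side_pos⟩

theorem region_rotate (q : Square) : q.rotate.region = (fun z : ℂ => I * z) '' q.region := by
  ext z
  simp only [region, rotate, mem_image, mem_reProdIm, mem_Icc]
  constructor
  · rintro ⟨⟨h1, h2⟩, h3, h4⟩
    refine ⟨-I * z, ?_, by rw [← mul_assoc]; simp⟩
    simp at h1 h2 h3 h4 ⊢
    refine ⟨⟨?_, ?_⟩, ?_, ?_⟩ <;> linarith
  · rintro ⟨y, ⟨⟨h1, h2⟩, h3, h4⟩, rfl⟩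
    simp
    refine ⟨⟨?_, ?_⟩, ?_, ?_⟩ <;> linarith

end Square

/-- A tiling of the plane by axis-parallel squares: closed squares with pairwise disjoint
interiors that cover the plane, only finitely many of them meeting any compact set. -/
structure SquareTiling where
  squares : Set Square
  cover : ∀ p : ℂ, ∃ q ∈ squares, p ∈ q.region
  disjoint : ∀ q ∈ squares, ∀ q' ∈ squares, q ≠ q' →
    Disjoint (interior q.region) (interior q'.region)
  locallyFinite : ∀ K : Set ℂ, IsCompact K → {q ∈ squares | (q.region ∩ K).Nonempty}.Finite

namespace SquareTiling

/-- The tiling rotated counterclockwise by 90 degrees around the origin. -/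
def rotate (T : SquareTiling) : SquareTiling where
  squares := Square.rotate '' T.squares
  cover p := by
    obtain ⟨q, hq, hp⟩ := T.cover (-I * p)
    refine ⟨q.rotate, mem_image_of_mem _ hq, ?_⟩
    rw [Square.region_rotate]
    exact ⟨-I * p, hp, by simp [← mul_assoc]⟩
  disjoint := by
    rintro _ ⟨q, hq, rfl⟩ _ ⟨q', hq', rfl⟩ hne
    have h := T.disjoint q hq q' hq' (fun h => hne (by rw [h]))
    have key : ∀ s : Square,
        interior s.rotate.region = (fun z : ℂ => I * z) '' interior s.region := fun s => by
      rw [Square.region_rotate]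
      exact ((Homeomorph.mulLeft₀ I I_ne_zero).image_interior s.region).symm
    rw [key, key]
    exact (disjoint_image_iff (mul_right_injective₀ I_ne_zero)).2 h
  locallyFinite K hK := by
    have hK' : IsCompact ((fun z : ℂ => -I * z) '' K) := hK.image (by fun_prop)
    refine ((T.locallyFinite _ hK').image Square.rotate).subset ?_
    rintro _ ⟨⟨q, hq, rfl⟩, z, hz, hzK⟩
    refine ⟨q, ⟨hq, -I * z, ?_, mem_image_of_mem _ hzK⟩, rfl⟩
    rw [Square.region_rotate] at hz
    obtain ⟨y, hy, rfl⟩ := hz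
    simpa [← mul_assoc] using hy

/-- The singular vertices: the points contained in exactly four squares. -/
def singular (T : SquareTiling) : Set ℂ :=
  {p | {q ∈ T.squares | p ∈ q.region}.ncard = 4}

/-- A choice of horizontal and vertical faces: at each singular vertex either the horizontal face
passes through the vertex and the vertical faces are broken there (the vertices in `horiz`), or
the vertical face passes through and the horizontal faces are broken there (all others). -/
structure FaceChoice (T : SquareTiling) where
  horiz : Set ℂ
  horiz_subset : horiz ⊆ T.singular

variable {T : SquareTiling}

/-- Horizontal edges: the top edge `(q, true)` and the bottom edge `(q, false)` of each square. -/
def hEdge (T : SquareTiling) : T.squares × Bool → Set ℂ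
  | (q, true) => q.1.top
  | (q, false) => q.1.bottom

/-- Vertical edges: the left edge `(q, true)` and the right edge `(q, false)` of each square. -/
def vEdge (T : SquareTiling) : T.squares × Bool → Set ℂ
  | (q, true) => q.1.left
  | (q, false) => q.1.right

/-- Two horizontal edges that meet (hence lie on one line) are linked, unless they meet only at a
singular vertex where the horizontal faces are broken. -/
def HLink (c : T.FaceChoice) (a b : T.squares × Bool) : Prop :=
  ∃ p ∈ T.hEdge a ∩ T.hEdge b, p ∉ T.singular \ c.horiz

/-- Two vertical edges that meet (hence lie on one line) are linked, unless they meet only at a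
singular vertex where the vertical faces are broken. -/
def VLink (c : T.FaceChoice) (a b : T.squares × Bool) : Prop :=
  ∃ p ∈ T.vEdge a ∩ T.vEdge b, p ∉ c.horiz

/-- The horizontal faces: the classes of the equivalence relation on the horizontal edges that is
generated by linking. -/
def HFace (c : T.FaceChoice) : Type := Quot (HLink c)

/-- The vertical faces: the classes of the equivalence relation on the vertical edges that is
generated by linking. -/
def VFace (c : T.FaceChoice) : Type := Quot (VLink c)

/-- The horizontal face that contains the top edge of `q`. -/
def topFace (c : T.FaceChoice) (q : T.squares) : HFace c := Quot.mk _ (q, true)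

/-- The horizontal face that contains the bottom edge of `q`. -/
def bottomFace (c : T.FaceChoice) (q : T.squares) : HFace c := Quot.mk _ (q, false)

/-- The vertical face that contains the left edge of `q`. -/
def leftFace (c : T.FaceChoice) (q : T.squares) : VFace c := Quot.mk _ (q, true)

/-- The vertical face that contains the right edge of `q`. -/
def rightFace (c : T.FaceChoice) (q : T.squares) : VFace c := Quot.mk _ (q, false)

/-- For the choice `c`, every horizontal and every vertical face has finitely many edges. -/
def EdgeFiniteFor (c : T.FaceChoice) : Prop :=
  (∀ h : HFace c, {a : T.squares × Bool | (Quot.mk _ a : HFace c) = h}.Finite) ∧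
  (∀ f : VFace c, {a : T.squares × Bool | (Quot.mk _ a : VFace c) = f}.Finite)

/-- All horizontal and vertical faces have finitely many edges, whatever the choice at the singular
vertices. (The two constant choices give the maximal horizontal and vertical segments.) -/
def EdgeFinite (T : SquareTiling) : Prop := ∀ c : T.FaceChoice, EdgeFiniteFor c

/-- Edge finite and without singular vertices. -/
def Regular (T : SquareTiling) : Prop := T.EdgeFinite ∧ T.singular = ∅

/-- The translation by `t` preserves the tiling and the choice of faces. -/
def IsPeriod (c : T.FaceChoice) (t : ℂ) : Prop :=
  Square.translate t '' T.squares = T.squares ∧ (fun z => z + t) '' c.horiz = c.horiz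

end SquareTiling

/-- Two translations in non-parallel directions have the property `P`. -/
def TwoPeriods (P : ℂ → Prop) : Prop :=
  ∃ t₁ t₂ : ℂ, LinearIndependent ℝ ![t₁, t₂] ∧ P t₁ ∧ P t₂

/-! ### Plane graphs and plane maps -/

/-- The polygonal line with the given list of nodes, as a subset of the plane. -/
def polyLine (l : List ℂ) : Set ℂ := {x | ∃ p q, [p, q] <:+: l ∧ x ∈ segment ℝ p q}

/-- The list of nodes describes a simple (not closed) polygonal arc with at least one piece. -/
def IsPolyArc : List ℂ → Prop
  | [] => False
  | [_] => False
  | [a, b] => a ≠ b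
  | a :: b :: c :: l =>
      a ≠ b ∧ segment ℝ a b ∩ polyLine (b :: c :: l) = {b} ∧ IsPolyArc (b :: c :: l)

/-- The direction in which a polygonal line leaves its first node. -/
def initialDir : List ℂ → ℂ
  | p :: q :: _ => q - p
  | _ => 0

/-- The directions `u`, `v`, `w` are distinct and follow each other in this order in a
counterclockwise turn. -/
def Ccw (u v w : ℂ) : Prop :=
  (arg u < arg v ∧ arg v < arg w) ∨ (arg v < arg w ∧ arg w < arg u) ∨
    (arg w < arg u ∧ arg u < arg v)

/-- A graph (multiple edges allowed) drawn in the plane: each edge is drawn as a simple polygonal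
arc joining two distinct vertices and containing no other vertex, and two different edges meet in
vertices only. -/
structure PlaneGraph where
  V : Type
  E : Type
  pos : V → ℂ
  path : E → List ℂ
  pos_injective : Function.Injective pos
  isPolyArc : ∀ e, IsPolyArc (path e)
  ends : ∀ e, ∃ u v : V, (path e).head? = some (pos u) ∧ (path e).getLast? = some (pos v) ∧
    ∀ x : V, pos x ∈ polyLine (path e) → x = u ∨ x = v
  inter : ∀ e e', e ≠ e' → polyLine (path e) ∩ polyLine (path e') ⊆ range pos

namespace PlaneGraph

/-- The edge `e` as a subset of the plane. -/
def arc (M : PlaneGraph) (e : M.E) : Set ℂ := polyLine (M.path e)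

/-- The vertex `v` lies on the edge `e`. -/
def Inc (M : PlaneGraph) (v : M.V) (e : M.E) : Prop := M.pos v ∈ M.arc e

/-- Directed edges: pairs of a vertex and an edge that contains it. -/
def Dart (M : PlaneGraph) : Type := {d : M.V × M.E // M.Inc d.1 d.2}

/-- The union of all vertices and edges. -/
def support (M : PlaneGraph) : Set ℂ := range M.pos ∪ ⋃ e, M.arc e

/-- The faces: the connected components of the plane minus vertices and edges. -/
def Face (M : PlaneGraph) : Type :=
  {f : Set ℂ // ∃ x ∈ M.supportᶜ, f = connectedComponentIn M.supportᶜ x}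

open Classical in
/-- The nodes of the edge `e`, listed starting from its end `v`. -/
def pathFrom (M : PlaneGraph) (v : M.V) (e : M.E) : List ℂ :=
  if (M.path e).head? = some (M.pos v) then M.path e else (M.path e).reverse

/-- The face `f` is on the right of the directed edge `(v, e)`: from an inner point of a straight
piece of `e`, traversed from `p` to `q` when `e` is run through from `v`, a small step to the right
leads into `f`. -/
def RightOf (M : PlaneGraph) (v : M.V) (e : M.E) (f : M.Face) : Prop :=
  M.Inc v e ∧ ∃ p q, [p, q] <:+: M.pathFrom v e ∧ ∃ x ∈ openSegment ℝ p q,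
    ∀ᶠ ε : ℝ in 𝓝[>] 0, x - ε * (I * (q - p)) ∈ f.1

/-- The face `f` is on the left of the directed edge `(v, e)`, that is, on the right of the
reversed directed edge. -/
def LeftOf (M : PlaneGraph) (v : M.V) (e : M.E) (f : M.Face) : Prop :=
  M.Inc v e ∧ ∃ v', v' ≠ v ∧ M.RightOf v' e f

/-- Among the edges at `v`, the edge `e'` is the one that follows `e` counterclockwise. -/
def NextAt (M : PlaneGraph) (v : M.V) (e e' : M.E) : Prop :=
  M.Inc v e ∧ M.Inc v e' ∧ (e' = e → ∀ d, M.Inc v d → d = e) ∧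
    ∀ d, M.Inc v d → ¬ Ccw (initialDir (M.pathFrom v e)) (initialDir (M.pathFrom v d))
      (initialDir (M.pathFrom v e'))

/-- A plane map: a connected plane graph all of whose faces are bounded and such that only
finitely many vertices and edges meet any compact set. -/
structure IsPlaneMap (M : PlaneGraph) : Prop where
  nonempty : Nonempty M.V
  connected : ∀ u v : M.V, Relation.ReflTransGen (fun a b => ∃ e, M.Inc a e ∧ M.Inc b e) u v
  bounded : ∀ f : M.Face, Bornology.IsBounded f.1
  finite_verts : ∀ K : Set ℂ, IsCompact K → {v | M.pos v ∈ K}.Finite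
  finite_edges : ∀ K : Set ℂ, IsCompact K → {e | (M.arc e ∩ K).Nonempty}.Finite

/-- Harmonic vectors. For a plane map all three sums are finite. -/
structure IsHarmonic (M : PlaneGraph) (w : M.Dart → ℝ) : Prop where
  vert : ∀ v : M.V, ∑ᶠ (d : M.Dart) (_ : d.1.1 = v), w d = 0
  edge : ∀ e : M.E, ∑ᶠ (d : M.Dart) (_ : d.1.2 = e), w d = 0
  face : ∀ f : M.Face, ∑ᶠ (d : M.Dart) (_ : M.RightOf d.1.1 d.1.2 f), w d = 0

/-- The translation by `t` preserves the drawing of `M` and the vector `w`. -/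
def IsPeriod (M : PlaneGraph) (w : M.Dart → ℝ) (t : ℂ) : Prop :=
  ∃ (σ : M.V ≃ M.V) (τ : M.E ≃ M.E),
    (∀ v, M.pos (σ v) = M.pos v + t) ∧
    (∀ e, M.arc (τ e) = (fun z => z + t) '' M.arc e) ∧
    (∀ d d' : M.Dart, d'.1 = (σ d.1.1, τ d.1.2) → w d' = w d)

/-- An (orientation preserving) isomorphism of plane maps: bijections between the vertices, the
edges and the faces that respect incidence, the sides of directed edges, and the cyclic order of
the edges around each vertex. -/
structure Iso (M M' : PlaneGraph) where
  vert : M.V ≃ M'.V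
  edge : M.E ≃ M'.E
  face : M.Face ≃ M'.Face
  inc : ∀ v e, M.Inc v e ↔ M'.Inc (vert v) (edge e)
  right : ∀ v e f, M.RightOf v e f ↔ M'.RightOf (vert v) (edge e) (face f)
  next : ∀ v e e', M.NextAt v e e' ↔ M'.NextAt (vert v) (edge e) (edge e')

/-- `M'` is (isomorphic to) the dual map of `M`: its vertices, edges, faces correspond to the
faces, edges, vertices of `M`; an edge of `M'` joins the faces of `M` on the two sides of the
corresponding edge; the directed edge of `M'` that crosses a directed edge of `M` from its right to
its left has the head of the latter on its right; and the counterclockwise order of the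
edges of `M'` around a vertex is the order in which the boundary of the corresponding face of `M`
is run through with that face on the left (coming in along `e` to `v`, going out along `e'`). -/
structure DualIso (M M' : PlaneGraph) where
  vert : M'.V ≃ M.Face
  edge : M'.E ≃ M.E
  face : M'.Face ≃ M.V
  inc : ∀ f e, M'.Inc f e ↔ ∃ v, M.RightOf v (edge e) (vert f)
  right : ∀ f e v, M'.RightOf f e v ↔ M.LeftOf (face v) (edge e) (vert f)
  next : ∀ f e e', M'.NextAt f e e' ↔ ∃ v, M.RightOf v (edge e) (vert f) ∧
    M.LeftOf v (edge e') (vert f) ∧ M.NextAt v (edge e') (edge e)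

end PlaneGraph

/-- The correspondence between a square tiling with a choice `c` of faces and a plane graph `M`
with a vector `w` on its directed edges: vertices correspond to horizontal faces, edges to squares,
faces to vertical faces. The edge of a square `q` joins the horizontal faces above and below `q`;
when it is run through downwards, the vertical face at the left edge of `q` is on its right, and
when it is run through upwards, the one at the right edge of `q` is; and `w` is
the size of `q` downwards and minus the size of `q` upwards. -/
structure Corresponds {T : SquareTiling} (c : T.FaceChoice) (M : PlaneGraph)
    (w : M.Dart → ℝ) where
  vert : M.V ≃ SquareTiling.HFace c
  edge : M.E ≃ T.squares
  face : M.Face ≃ SquareTiling.VFace c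
  inc : ∀ v e, M.Inc v e ↔
    vert v = SquareTiling.topFace c (edge e) ∨ vert v = SquareTiling.bottomFace c (edge e)
  right : ∀ v e f, M.RightOf v e f ↔
    (vert v = SquareTiling.topFace c (edge e) ∧ face f = SquareTiling.leftFace c (edge e)) ∨
    (vert v = SquareTiling.bottomFace c (edge e) ∧ face f = SquareTiling.rightFace c (edge e))
  weight_top : ∀ d : M.Dart, vert d.1.1 = SquareTiling.topFace c (edge d.1.2) →
    w d = (edge d.1.2).1.side
  weight_bottom : ∀ d : M.Dart, vert d.1.1 = SquareTiling.bottomFace c (edge d.1.2) →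
    w d = -(edge d.1.2).1.side

end

/-! Existence is obtained by deforming the tiling itself. In each square take the vertical middle
line, and in each horizontal face the middle part ("core") that is left after short pieces at both
ends are removed. Together they form the `skeleton`. A map `squash` of the plane moves points only
horizontally and contracts each core to the midpoint of its face; away from the cores it is
injective. It carries the skeleton to the drawing: cores become vertices, and middle lines become
polygonal arcs with three pieces, one for each square.

Edge finiteness enters twice. A horizontal face with finitely many edges is a bounded segment, and
its adjacent squares have a positive minimal size. A quarter of this size, `gap`, separates the
neighbourhoods (`box`) in which `squash` acts, so that `squash` is continuous, proper and
surjective. A vertical face with finitely many edges makes the corresponding face of the drawing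
bounded.

The complement of the skeleton splits into one cell for each vertical face, made of the halves of
squares next to that face. Cells are pairwise disjoint (`vFace_eq_of_mem`), connected
(`isPreconnected_cell`) and open. Since `squash` is closed and injective on them, their images are
exactly the components of the complement of the drawing (`connectedComponentIn_eq`). Both properties
of cells use that at a singular point exactly one of the two directions is broken.

The vector is harmonic because the squares above a horizontal face and those below it both have the
length of the face as total size (`finsum_side`). For vertical faces the same is read off from the
tiling rotated by 90 degrees.

Uniqueness: incidence and sides of edges are prescribed by the correspondence, so only the cyclic
order at a vertex has to be recovered. The sector between consecutive edges lies in a single face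
(`exists_sector_face`), and a vertex together with the face on the right determines the directed
edge (`edge_unique`). Hence `e'` follows `e` exactly if some face is left of `e` and right of `e'`
(`nextAt_iff`). Duality follows from the same criterion, since rotation exchanges horizontal and
vertical faces. Periodicity holds because the drawing is built from the tiling and the choice alone.
-/

noncomputable section

/-! ### Coordinates of squares -/

namespace Square

/-- Abscissa of the left edge. -/
def x0 (q : Square) : ℝ := q.corner.re

/-- Abscissa of the right edge. -/
def x1 (q : Square) : ℝ := q.corner.re + q.side

/-- Ordinate of the lower edge. -/
def y0 (q : Square) : ℝ := q.corner.im

/-- Ordinate of the upper edge. -/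
def y1 (q : Square) : ℝ := q.corner.im + q.side

variable (q : Square)

theorem x1_eq : q.x1 = q.x0 + q.side := rfl

theorem y1_eq : q.y1 = q.y0 + q.side := rfl

theorem x0_lt_x1 : q.x0 < q.x1 := by have := q.side_pos; rw [x1_eq]; linarith

theorem y0_lt_y1 : q.y0 < q.y1 := by have := q.side_pos; rw [y1_eq]; linarith

variable {q} {p : ℂ}

theorem mem_region : p ∈ q.region ↔ (q.x0 ≤ p.re ∧ p.re ≤ q.x1) ∧ q.y0 ≤ p.im ∧ p.im ≤ q.y1 :=
  Iff.rfl

theorem mem_top : p ∈ q.top ↔ (q.x0 ≤ p.re ∧ p.re ≤ q.x1) ∧ p.im = q.y1 := Iff.rfl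

theorem mem_bottom : p ∈ q.bottom ↔ (q.x0 ≤ p.re ∧ p.re ≤ q.x1) ∧ p.im = q.y0 := Iff.rfl

theorem mem_left : p ∈ q.left ↔ p.re = q.x0 ∧ q.y0 ≤ p.im ∧ p.im ≤ q.y1 := Iff.rfl

theorem mem_right : p ∈ q.right ↔ p.re = q.x1 ∧ q.y0 ≤ p.im ∧ p.im ≤ q.y1 := Iff.rfl

theorem mem_interior_region :
    p ∈ interior q.region ↔ (q.x0 < p.re ∧ p.re < q.x1) ∧ q.y0 < p.im ∧ p.im < q.y1 := by
  rw [region, interior_reProdIm, interior_Icc, interior_Icc]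
  rfl

theorem isCompact_region (q : Square) : IsCompact q.region :=
  isCompact_Icc.reProdIm isCompact_Icc

theorem ext_coord {q q' : Square} (hx : q.x0 = q'.x0) (hy : q.y0 = q'.y0)
    (hs : q.side = q'.side) : q = q' :=
  Square.ext (Complex.ext hx hy) hs

end Square

/-! ### Germs: the squares in the four quadrants at a point -/

/-- The interval `[l, r]` contains the points next to `x` on the right (`s = true`) or on the left
(`s = false`). -/
def HalfIn (s : Bool) (l r x : ℝ) : Prop :=
  cond s (l ≤ x ∧ x < r) (l < x ∧ x ≤ r)

theorem halfIn_true {l r x : ℝ} : HalfIn true l r x ↔ l ≤ x ∧ x < r := Iff.rfl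

theorem halfIn_false {l r x : ℝ} : HalfIn false l r x ↔ l < x ∧ x ≤ r := Iff.rfl

theorem HalfIn.mem {s : Bool} {l r x : ℝ} (h : HalfIn s l r x) : l ≤ x ∧ x ≤ r := by
  cases s
  · exact ⟨h.1.le, h.2⟩
  · exact ⟨h.1, h.2.le⟩

theorem halfIn_of_lt (s : Bool) {l r x : ℝ} (h₁ : l < x) (h₂ : x < r) : HalfIn s l r x := by
  cases s
  · exact ⟨h₁, h₂.le⟩
  · exact ⟨h₁.le, h₂⟩

theorem exists_halfIn {l r x : ℝ} (h : l < r) (h₁ : l ≤ x) (h₂ : x ≤ r) :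
    ∃ s, HalfIn s l r x := by
  rcases h₁.eq_or_lt with rfl | h₁
  · exact ⟨true, le_rfl, h⟩
  · exact ⟨false, h₁, h₂⟩

/-- The unit with the sign given by a Boolean. -/
def boolSign (s : Bool) : ℝ := cond s 1 (-1)

theorem HalfIn.eventually {s : Bool} {l r x : ℝ} (h : HalfIn s l r x) :
    ∀ᶠ ε : ℝ in 𝓝[>] 0, l < x + boolSign s * ε ∧ x + boolSign s * ε < r := by
  have h0 : ∀ᶠ ε : ℝ in 𝓝[>] 0, 0 < ε := eventually_mem_nhdsWithin
  have h1 : ∀ a : ℝ, 0 < a → ∀ᶠ ε : ℝ in 𝓝[>] 0, ε < a := fun a ha =>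
    mem_nhdsWithin_of_mem_nhds (Iio_mem_nhds ha)
  cases s
  · filter_upwards [h0, h1 (x - l) (by linarith [h.1])] with ε h2 h3
    simp only [boolSign, cond_false]
    constructor <;> linarith [h.2]
  · filter_upwards [h0, h1 (r - x) (by linarith [h.2])] with ε h2 h3
    simp only [boolSign, cond_true]
    constructor <;> linarith [h.1]

theorem eventually_notMem_of_not_halfIn {s : Bool} {l r x : ℝ} (h : ¬ HalfIn s l r x) :
    ∀ᶠ ε : ℝ in 𝓝[>] 0, ¬ (l ≤ x + boolSign s * ε ∧ x + boolSign s * ε ≤ r) := by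
  have h0 : ∀ᶠ ε : ℝ in 𝓝[>] 0, 0 < ε := eventually_mem_nhdsWithin
  have h1 : ∀ a : ℝ, 0 < a → ∀ᶠ ε : ℝ in 𝓝[>] 0, ε < a := fun a ha =>
    mem_nhdsWithin_of_mem_nhds (Iio_mem_nhds ha)
  cases s
  · simp only [boolSign, cond_false]
    rcases le_or_gt x l with hx | hx
    · filter_upwards [h0] with ε h2 h3
      linarith [h3.1]
    · have hr : r < x := by
        by_contra hr
        exact h ⟨hx, not_lt.1 hr⟩
      filter_upwards [h1 (x - r) (by linarith)] with ε h2 h3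
      linarith [h3.2]
  · simp only [boolSign, cond_true]
    rcases le_or_gt r x with hx | hx
    · filter_upwards [h0] with ε h2 h3
      linarith [h3.2]
    · have hr : x < l := by
        by_contra hr
        exact h ⟨not_lt.1 hr, hx⟩
      filter_upwards [h1 (l - x) (by linarith)] with ε h2 h3
      linarith [h3.1]

/-- The square contains the points next to `p` in the open quadrant at `p` that lies east or west
according to `s` and north or south according to `t`. -/
def Square.Germ (q : Square) (s t : Bool) (p : ℂ) : Prop :=
  HalfIn s q.x0 q.x1 p.re ∧ HalfIn t q.y0 q.y1 p.im

theorem Square.Germ.mem_region {q : Square} {s t : Bool} {p : ℂ} (h : q.Germ s t p) :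
    p ∈ q.region := Square.mem_region.2 ⟨h.1.mem, h.2.mem⟩

theorem Square.exists_germ {q : Square} {p : ℂ} (h : p ∈ q.region) : ∃ s t, q.Germ s t p := by
  rw [Square.mem_region] at h
  obtain ⟨s, hs⟩ := exists_halfIn q.x0_lt_x1 h.1.1 h.1.2
  obtain ⟨t, ht⟩ := exists_halfIn q.y0_lt_y1 h.2.1 h.2.2
  exact ⟨s, t, hs, ht⟩

namespace SquareTiling

/-- A square without this germ misses the diagonal points near `p` in the quadrant. Only finitely
many squares come near `p`, so if all of them lacked the germ, one such point would be left
uncovered. -/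
theorem exists_germ (T : SquareTiling) (p : ℂ) (s t : Bool) :
    ∃ q : T.squares, q.1.Germ s t p := by
  by_contra! hcon
  set z : ℝ → ℂ := fun ε => ⟨p.re + boolSign s * ε, p.im + boolSign t * ε⟩ with hz
  have hfin := T.locallyFinite (Icc (p.re - 1) (p.re + 1) ×ℂ Icc (p.im - 1) (p.im + 1))
    (isCompact_Icc.reProdIm isCompact_Icc)
  have h1 : ∀ q ∈ {q ∈ T.squares |
      (q.region ∩ Icc (p.re - 1) (p.re + 1) ×ℂ Icc (p.im - 1) (p.im + 1)).Nonempty},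
      ∀ᶠ ε : ℝ in 𝓝[>] 0, z ε ∉ q.region := by
    rintro q ⟨hq, -⟩
    have h := hcon ⟨q, hq⟩
    rw [Square.Germ, not_and_or] at h
    rcases h with h | h
    · filter_upwards [eventually_notMem_of_not_halfIn h] with ε h2 h3
      exact h2 (Square.mem_region.1 h3).1
    · filter_upwards [eventually_notMem_of_not_halfIn h] with ε h2 h3
      exact h2 (Square.mem_region.1 h3).2
  have h0 : ∀ᶠ ε : ℝ in 𝓝[>] 0, 0 < ε := eventually_mem_nhdsWithin
  have h2 : ∀ᶠ ε : ℝ in 𝓝[>] 0, ε < 1 := mem_nhdsWithin_of_mem_nhds (Iio_mem_nhds one_pos)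
  obtain ⟨ε, h3, h4, h5⟩ := (((eventually_all_finite hfin).2 h1).and (h0.and h2)).exists
  obtain ⟨q, hq, hqz⟩ := T.cover (z ε)
  refine h3 q ⟨hq, z ε, hqz, ?_⟩ hqz
  have hb : ∀ b : Bool, -1 ≤ boolSign b * ε ∧ boolSign b * ε ≤ 1 := by
    intro b
    cases b <;> simp only [boolSign, cond_false, cond_true] <;> constructor <;> linarith
  rw [mem_reProdIm]
  refine ⟨⟨?_, ?_⟩, ?_, ?_⟩ <;> simp only [hz] <;> linarith [(hb s).1, (hb s).2, (hb t).1, (hb t).2]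

variable {T : SquareTiling}

/-- Two squares with the same germ share interior points near `p`. -/
theorem eq_of_germ {q q' : T.squares} {p : ℂ} {s t : Bool} (h : q.1.Germ s t p)
    (h' : q'.1.Germ s t p) : q = q' := by
  by_contra hne
  obtain ⟨ε, h1, h2, h3, h4⟩ := (h.1.eventually.and
    (h.2.eventually.and (h'.1.eventually.and h'.2.eventually))).exists
  refine Set.disjoint_left.1 (T.disjoint q.1 q.2 q'.1 q'.2 (fun e => hne (Subtype.ext e)))
    (?_ : (⟨p.re + boolSign s * ε, p.im + boolSign t * ε⟩ : ℂ) ∈ _) ?_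
  · exact Square.mem_interior_region.2 ⟨h1, h2⟩
  · exact Square.mem_interior_region.2 ⟨h3, h4⟩

/-- The square of the tiling that contains the points next to `p` in a given quadrant. -/
def germ (T : SquareTiling) (p : ℂ) (s t : Bool) : T.squares := (T.exists_germ p s t).choose

theorem germ_spec (T : SquareTiling) (p : ℂ) (s t : Bool) : (T.germ p s t).1.Germ s t p :=
  (T.exists_germ p s t).choose_spec

theorem eq_germ {q : T.squares} {p : ℂ} {s t : Bool} (h : q.1.Germ s t p) : q = T.germ p s t :=
  eq_of_germ h (T.germ_spec p s t)

theorem exists_eq_germ {q : T.squares} {p : ℂ} (h : p ∈ q.1.region) :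
    ∃ s t, q = T.germ p s t := by
  obtain ⟨s, t, hst⟩ := Square.exists_germ h
  exact ⟨s, t, eq_germ hst⟩

theorem germ_region (T : SquareTiling) (p : ℂ) (s t : Bool) : p ∈ (T.germ p s t).1.region :=
  (T.germ_spec p s t).mem_region

/-- Different squares to the east and to the west of `p` meet in the vertical line through `p`. -/
theorem germ_east_west {p : ℂ} {t : Bool} (h : T.germ p true t ≠ T.germ p false t) :
    (T.germ p true t).1.x0 = p.re ∧ (T.germ p false t).1.x1 = p.re := by
  have h1 := T.germ_spec p true t
  have h2 := T.germ_spec p false t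
  constructor
  · refine h1.1.1.antisymm (not_lt.1 fun h3 => h (eq_germ ⟨⟨h3, h1.1.2.le⟩, h1.2⟩))
  · exact (not_lt.1 fun h3 =>
      h (eq_germ (s := true) ⟨⟨h2.1.1.le, h3⟩, h2.2⟩).symm).antisymm h2.1.2

/-- Different squares to the north and to the south of `p` meet in the horizontal line through
`p`. -/
theorem germ_north_south {p : ℂ} {s : Bool} (h : T.germ p s true ≠ T.germ p s false) :
    (T.germ p s true).1.y0 = p.im ∧ (T.germ p s false).1.y1 = p.im := by
  have h1 := T.germ_spec p s true
  have h2 := T.germ_spec p s false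
  constructor
  · refine h1.2.1.antisymm (not_lt.1 fun h3 => h (eq_germ ⟨h1.1, h3, h1.2.2.le⟩))
  · exact (not_lt.1 fun h3 =>
      h (eq_germ (t := true) ⟨h2.1, h2.2.1.le, h3⟩).symm).antisymm h2.2.2

/-- The squares containing `p` are exactly the four germs, so there are four of them precisely when
the germs are pairwise distinct. -/
theorem mem_singular_iff {p : ℂ} :
    p ∈ T.singular ↔ Function.Injective (fun st : Bool × Bool => T.germ p st.1 st.2) := by
  have h1 : {q ∈ T.squares | p ∈ q.region} =
      Set.range (fun st : Bool × Bool => (T.germ p st.1 st.2).1) := by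
    ext q
    constructor
    · rintro ⟨hq, hp⟩
      obtain ⟨s, t, hst⟩ := exists_eq_germ (q := ⟨q, hq⟩) hp
      exact ⟨(s, t), (congrArg Subtype.val hst).symm⟩
    · rintro ⟨st, rfl⟩
      exact ⟨(T.germ p st.1 st.2).2, T.germ_region p _ _⟩
  have h2 : (Set.range (fun st : Bool × Bool => (T.germ p st.1 st.2).1)).ncard = 4 ↔
      Function.Injective (fun st : Bool × Bool => (T.germ p st.1 st.2).1) := by
    rw [← Set.image_univ]
    have h3 := Set.ncard_image_iff (f := fun st : Bool × Bool => (T.germ p st.1 st.2).1)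
      (s := Set.univ) (Set.toFinite _)
    rw [Set.injOn_univ, Set.ncard_univ] at h3
    simpa using h3
  rw [singular, mem_ofPred_eq, h1, h2]
  exact ⟨fun h a b hab => h (congrArg Subtype.val hab), fun h a b hab => h (Subtype.ext hab)⟩

/-- A singular vertex is a corner of each of the squares that contain it. -/
theorem corner_of_singular {p : ℂ} (hp : p ∈ T.singular) {q : T.squares} (hq : p ∈ q.1.region) :
    (p.re = q.1.x0 ∨ p.re = q.1.x1) ∧ (p.im = q.1.y0 ∨ p.im = q.1.y1) := by
  rw [mem_singular_iff] at hp
  obtain ⟨s, t, rfl⟩ := exists_eq_germ hq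
  constructor
  · have h : T.germ p true t ≠ T.germ p false t := fun e => by
      have := hp (a₁ := (true, t)) (a₂ := (false, t)) e
      simp at this
    have h1 := germ_east_west h
    cases s
    · exact Or.inr h1.2.symm
    · exact Or.inl h1.1.symm
  · have h : T.germ p s true ≠ T.germ p s false := fun e => by
      have := hp (a₁ := (s, true)) (a₂ := (s, false)) e
      simp at this
    have h1 := germ_north_south h
    cases t
    · exact Or.inr h1.2.symm
    · exact Or.inl h1.1.symm

/-- A point at which the squares differ both horizontally and vertically is singular. -/
theorem mem_singular_of_ne {p : ℂ} (h1 : T.germ p true true ≠ T.germ p false true)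
    (h2 : T.germ p true false ≠ T.germ p false false)
    (h3 : T.germ p true true ≠ T.germ p true false)
    (h4 : T.germ p false true ≠ T.germ p false false) : p ∈ T.singular := by
  have e1 := germ_east_west h1
  have e2 := germ_east_west h2
  have k1 := (T.germ_spec p false true).1.1
  have k2 := (T.germ_spec p false false).1.1
  -- Diagonally opposite germs differ as well: the eastern square begins at the abscissa of `p`, the
  -- western one strictly before it.
  have h5 : T.germ p true true ≠ T.germ p false false := fun e => by
    rw [← e] at k2; linarith [e1.1]
  have h6 : T.germ p true false ≠ T.germ p false true := fun e => by
    rw [← e] at k1; linarith [e2.1]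
  rw [mem_singular_iff]
  rintro ⟨s, t⟩ ⟨s', t'⟩ h
  cases s <;> cases t <;> cases s' <;> cases t' <;> simp_all [eq_comm]

/-! ### Horizontal edges and faces -/

/-- The ordinate of a horizontal edge. -/
def hy (a : T.squares × Bool) : ℝ := cond a.2 a.1.1.y1 a.1.1.y0

theorem mem_hEdge {a : T.squares × Bool} {p : ℂ} :
    p ∈ T.hEdge a ↔ (a.1.1.x0 ≤ p.re ∧ p.re ≤ a.1.1.x1) ∧ p.im = hy a := by
  obtain ⟨q, b⟩ := a
  cases b <;> rfl

theorem hEdge_subset (a : T.squares × Bool) : T.hEdge a ⊆ a.1.1.region := by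
  intro p hp
  rw [mem_hEdge] at hp
  have := a.1.1.y0_lt_y1
  rw [Square.mem_region]
  refine ⟨hp.1, ?_⟩
  rw [hp.2, hy]
  cases a.2
  · exact ⟨le_rfl, this.le⟩
  · exact ⟨this.le, le_rfl⟩

/-- The abscissa of a vertical edge. -/
def vx (a : T.squares × Bool) : ℝ := cond a.2 a.1.1.x0 a.1.1.x1

theorem mem_vEdge {a : T.squares × Bool} {p : ℂ} :
    p ∈ T.vEdge a ↔ p.re = vx a ∧ a.1.1.y0 ≤ p.im ∧ p.im ≤ a.1.1.y1 := by
  obtain ⟨q, b⟩ := a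
  cases b <;> rfl

variable {c : T.FaceChoice}

/-- A property of horizontal edges that is preserved by linking depends on the face only. -/
theorem iff_of_hFace_eq {P : T.squares × Bool → Prop}
    (hP : ∀ a b, HLink c a b → (P a ↔ P b)) {a b : T.squares × Bool}
    (hab : (Quot.mk _ a : HFace c) = Quot.mk _ b) : P a ↔ P b :=
  iff_of_eq (congrArg (Quot.lift P fun a b h => propext (hP a b h)) hab)

/-- The ordinate of a horizontal face. -/
def HFace.y (h : HFace c) : ℝ :=
  Quot.lift hy (fun _ _ ⟨_, hp, _⟩ => (mem_hEdge.1 hp.1).2.symm.trans (mem_hEdge.1 hp.2).2) h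

@[simp] theorem y_topFace (q : T.squares) : (topFace c q).y = q.1.y1 := rfl

@[simp] theorem y_bottomFace (q : T.squares) : (bottomFace c q).y = q.1.y0 := rfl

theorem topFace_ne_bottomFace (q : T.squares) : topFace c q ≠ bottomFace c q := fun h => by
  have h1 := congrArg HFace.y h
  simp only [y_topFace, y_bottomFace] at h1
  linarith [q.1.y0_lt_y1]

/-- The abscissa of a vertical face. -/
def VFace.x (f : VFace c) : ℝ :=
  Quot.lift vx (fun _ _ ⟨_, hp, _⟩ => (mem_vEdge.1 hp.1).1.symm.trans (mem_vEdge.1 hp.2).1) f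

@[simp] theorem x_leftFace (q : T.squares) : (leftFace c q).x = q.1.x0 := rfl

@[simp] theorem x_rightFace (q : T.squares) : (rightFace c q).x = q.1.x1 := rfl

/-- Squares on the two sides of a horizontal line belong to the same horizontal face. -/
theorem bottomFace_eq_topFace {p : ℂ} {s : Bool} (h : T.germ p s true ≠ T.germ p s false) :
    bottomFace c (T.germ p s true) = topFace c (T.germ p s false) := by
  have h1 := T.germ_spec p s true
  have h2 := T.germ_spec p s false
  have h3 := germ_north_south h
  -- A slight move along the line leads into the relative interior of both edges. Such a point is
  -- not a corner, hence not singular, and it links the edges.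
  obtain ⟨ε, h4, h5⟩ := (h1.1.eventually.and h2.1.eventually).exists
  refine Quot.sound ⟨⟨p.re + boolSign s * ε, p.im⟩, ⟨?_, ?_⟩, ?_⟩
  · exact Square.mem_bottom.2 ⟨⟨h4.1.le, h4.2.le⟩, h3.1.symm⟩
  · exact Square.mem_top.2 ⟨⟨h5.1.le, h5.2.le⟩, h3.2.symm⟩
  · rintro ⟨hs, -⟩
    have h6 := (corner_of_singular hs (q := T.germ p s true)
      (Square.mem_region.2 ⟨⟨h4.1.le, h4.2.le⟩, h1.2.mem⟩)).1
    rcases h6 with h6 | h6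
    · exact h4.1.ne' h6
    · exact h4.2.ne h6

/-- Squares on the two sides of a vertical line belong to the same vertical face. -/
theorem leftFace_eq_rightFace {p : ℂ} {t : Bool} (h : T.germ p true t ≠ T.germ p false t) :
    leftFace c (T.germ p true t) = rightFace c (T.germ p false t) := by
  have h1 := T.germ_spec p true t
  have h2 := T.germ_spec p false t
  have h3 := germ_east_west h
  obtain ⟨ε, h4, h5⟩ := (h1.2.eventually.and h2.2.eventually).exists
  refine Quot.sound ⟨⟨p.re, p.im + boolSign t * ε⟩, ⟨?_, ?_⟩, ?_⟩
  · exact Square.mem_left.2 ⟨h3.1.symm, ⟨h4.1.le, h4.2.le⟩⟩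
  · exact Square.mem_right.2 ⟨h3.2.symm, ⟨h5.1.le, h5.2.le⟩⟩
  · intro hs
    have h6 := (corner_of_singular (c.horiz_subset hs) (q := T.germ p true t)
      (Square.mem_region.2 ⟨h1.1.mem, ⟨h4.1.le, h4.2.le⟩⟩)).2
    rcases h6 with h6 | h6
    · exact h4.1.ne' h6
    · exact h4.2.ne h6

/-- Horizontal faces do not extend across a point where they are broken. -/
theorem hFace_broken {p : ℂ} (hp : p ∈ T.singular \ c.horiz) {a b : T.squares × Bool}
    (hab : (Quot.mk _ a : HFace c) = Quot.mk _ b) (ha : hy a = p.im) (ha' : a.1.1.x1 ≤ p.re) :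
    b.1.1.x1 ≤ p.re := by
  -- The position left of `p` on the line of `p` is inherited by linked edges: a link at `p` itself
  -- is excluded, and an edge reaching across `p` would contain the singular point `p` without
  -- having a corner there.
  have key : ∀ a b, HLink c a b → (hy a = p.im ∧ a.1.1.x1 ≤ p.re) →
      (hy b = p.im ∧ b.1.1.x1 ≤ p.re) := by
    rintro a b ⟨z, ⟨hza, hzb⟩, hz⟩ ⟨h1, h2⟩
    rw [mem_hEdge] at hza
    have hzb' := mem_hEdge.1 hzb
    have him : z.im = p.im := hza.2.trans h1
    refine ⟨hzb'.2.symm.trans him, not_lt.1 fun h3 => ?_⟩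
    have h4 : z.re ≠ p.re := fun h4 => hz (by rwa [Complex.ext h4 him])
    have h5 : z.re < p.re := lt_of_le_of_ne (hza.1.2.trans h2) h4
    have h6 : p ∈ T.hEdge b := mem_hEdge.2 ⟨⟨hzb'.1.1.trans h5.le, h3.le⟩, him.symm.trans hzb'.2⟩
    rcases (corner_of_singular hp.1 (hEdge_subset b h6)).1 with h7 | h7
    · linarith [hzb'.1.1]
    · linarith
  have symm : ∀ a b, HLink c a b → HLink c b a := fun a b ⟨z, hz, hz'⟩ => ⟨z, hz.symm, hz'⟩
  exact ((iff_of_hFace_eq (fun a b h => ⟨key a b h, key b a (symm a b h)⟩) hab).1 ⟨ha, ha'⟩).2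

/-- Vertical faces do not extend across a point where they are broken. -/
theorem vFace_broken {p : ℂ} (hp : p ∈ c.horiz) {a b : T.squares × Bool}
    (hab : (Quot.mk _ a : VFace c) = Quot.mk _ b) (ha : vx a = p.re) (ha' : a.1.1.y1 ≤ p.im) :
    b.1.1.y1 ≤ p.im := by
  have key : ∀ a b, VLink c a b → (vx a = p.re ∧ a.1.1.y1 ≤ p.im) →
      (vx b = p.re ∧ b.1.1.y1 ≤ p.im) := by
    rintro a b ⟨z, ⟨hza, hzb⟩, hz⟩ ⟨h1, h2⟩
    rw [mem_vEdge] at hza hzb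
    have hre : z.re = p.re := hza.1.trans h1
    refine ⟨hzb.1.symm.trans hre, not_lt.1 fun h3 => ?_⟩
    have h4 : z.im ≠ p.im := fun h4 => hz (by rwa [Complex.ext hre h4])
    have h5 : z.im < p.im := lt_of_le_of_ne (hza.2.2.trans h2) h4
    have h6 : p ∈ b.1.1.region := by
      rw [Square.mem_region]
      refine ⟨?_, hzb.2.1.trans h5.le, h3.le⟩
      rw [← hre, hzb.1, vx]
      have := b.1.1.x0_lt_x1
      cases b.2
      · exact ⟨this.le, le_rfl⟩
      · exact ⟨le_rfl, this.le⟩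
    rcases (corner_of_singular (c.horiz_subset hp) h6).2 with h7 | h7
    · linarith [hzb.2.1]
    · linarith
  have symm : ∀ a b, VLink c a b → VLink c b a := fun a b ⟨z, hz, hz'⟩ => ⟨z, hz.symm, hz'⟩
  have := congrArg (Quot.lift (fun a => vx a = p.re ∧ a.1.1.y1 ≤ p.im)
    fun a b h => propext ⟨key a b h, key b a (symm a b h)⟩) hab
  exact ((iff_of_eq this).1 ⟨ha, ha'⟩).2

end SquareTiling

/-! ### Extent of horizontal faces, their ends and neighbouring squares -/

namespace SquareTiling

variable {T : SquareTiling} {c : T.FaceChoice}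

/-- The horizontal face of a horizontal edge. -/
def hFace (c : T.FaceChoice) (a : T.squares × Bool) : HFace c := Quot.mk _ a

/-- The vertical face of a vertical edge. -/
def vFace (c : T.FaceChoice) (a : T.squares × Bool) : VFace c := Quot.mk _ a

theorem hFace_true (q : T.squares) : hFace c (q, true) = topFace c q := rfl

theorem hFace_false (q : T.squares) : hFace c (q, false) = bottomFace c q := rfl

theorem exists_hFace (h : HFace c) : ∃ a, hFace c a = h := Quot.exists_rep h

theorem exists_vFace (f : VFace c) : ∃ a, vFace c a = f := Quot.exists_rep f

theorem y_hFace (a : T.squares × Bool) : (hFace c a).y = hy a := rfl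

/-- The edges that make up a horizontal face. -/
def HFace.edges (h : HFace c) : Set (T.squares × Bool) := {a | hFace c a = h}

/-- The left end of a horizontal face. -/
def HFace.lo (h : HFace c) : ℝ := sInf ((fun a => a.1.1.x0) '' h.edges)

/-- The right end of a horizontal face. -/
def HFace.hi (h : HFace c) : ℝ := sSup ((fun a => a.1.1.x1) '' h.edges)

/-- A quarter of the size of the smallest square at a horizontal face. -/
def HFace.gap (h : HFace c) : ℝ := sInf ((fun a => a.1.1.side) '' h.edges) / 4

theorem HFace.edges_nonempty (h : HFace c) : h.edges.Nonempty := exists_hFace h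

theorem EdgeFiniteFor.finite_edges (hc : EdgeFiniteFor c) (h : HFace c) : h.edges.Finite := hc.1 h

theorem EdgeFiniteFor.lo_le (hc : EdgeFiniteFor c) (a : T.squares × Bool) :
    (hFace c a).lo ≤ a.1.1.x0 :=
  csInf_le ((hc.finite_edges _).image _).bddBelow (mem_image_of_mem _ rfl)

theorem EdgeFiniteFor.le_hi (hc : EdgeFiniteFor c) (a : T.squares × Bool) : a.1.1.x1 ≤
    (hFace c a).hi :=
  le_csSup ((hc.finite_edges _).image _).bddAbove (mem_image_of_mem _ rfl)

/-- The factor 4 provides the room used later: strips of height `gap` along the top and the bottom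
of a square stay apart, and its middle line keeps distance at least `2 * gap` from the ends of both
faces. -/
theorem EdgeFiniteFor.gap_le (hc : EdgeFiniteFor c) (a : T.squares × Bool) : 4 *
    (hFace c a).gap ≤ a.1.1.side := by
  have h : sInf ((fun a => a.1.1.side) '' (hFace c a).edges) ≤ a.1.1.side :=
    csInf_le ((hc.finite_edges _).image _).bddBelow (mem_image_of_mem _ rfl)
  rw [HFace.gap]
  linarith

theorem EdgeFiniteFor.exists_lo (hc : EdgeFiniteFor c) (h : HFace c) :
    ∃ a, hFace c a = h ∧ a.1.1.x0 = h.lo :=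
  (h.edges_nonempty.image _).csInf_mem ((hc.finite_edges h).image _)

theorem EdgeFiniteFor.exists_hi (hc : EdgeFiniteFor c) (h : HFace c) :
    ∃ a, hFace c a = h ∧ a.1.1.x1 = h.hi :=
  (h.edges_nonempty.image _).csSup_mem ((hc.finite_edges h).image _)

theorem EdgeFiniteFor.gap_pos (hc : EdgeFiniteFor c) (h : HFace c) : 0 < h.gap := by
  obtain ⟨a, -, ha⟩ := (h.edges_nonempty.image (fun a => a.1.1.side)).csInf_mem
    ((hc.finite_edges h).image _)
  have := a.1.1.side_pos
  simp only at ha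
  rw [HFace.gap, ← ha]
  linarith

theorem EdgeFiniteFor.lo_add_gap_le (hc : EdgeFiniteFor c) (h : HFace c) :
    h.lo + 4 * h.gap ≤ h.hi := by
  obtain ⟨a, rfl⟩ := exists_hFace h
  linarith [hc.lo_le a, hc.le_hi a, hc.gap_le a, a.1.1.x1_eq]

theorem EdgeFiniteFor.lo_lt_hi (hc : EdgeFiniteFor c) (h : HFace c) : h.lo < h.hi := by
  linarith [hc.lo_add_gap_le h, hc.gap_pos h]

/-- A horizontal face is covered by its edges. -/
theorem EdgeFiniteFor.exists_edge (hc : EdgeFiniteFor c) {h : HFace c} {s : Bool} {x : ℝ}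
    (hx : HalfIn s h.lo h.hi x) :
    ∃ a, hFace c a = h ∧ HalfIn s a.1.1.x0 a.1.1.x1 x := by
  by_contra! hcon
  obtain ⟨a, ha, ha'⟩ := hc.exists_lo h
  obtain ⟨b, hb, hb'⟩ := hc.exists_hi h
  cases s
  · rw [halfIn_false] at hx
    simp only [halfIn_false, not_and_or, not_lt, not_le] at hcon
    -- If no edge of `h` covers `x`, linked edges lie on the same side of `x` because they share a
    -- point. Then all edges of `h` would be on the side of the leftmost one, although the rightmost
    -- one reaches `x`.
    have key : ∀ a b, HLink c a b → ((hFace c a = h ∧ a.1.1.x1 < x) ↔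
        (hFace c b = h ∧ b.1.1.x1 < x)) := by
      intro a b hab
      have hf : hFace c a = hFace c b := Quot.sound hab
      rw [hf]
      refine and_congr_right fun he => ?_
      obtain ⟨p, ⟨hpa, hpb⟩, -⟩ := hab
      rw [mem_hEdge] at hpa hpb
      have h1 := hcon a (hf.trans he)
      have h2 := hcon b he
      constructor
      · intro h3
        rcases h2 with h2 | h2
        · linarith
        · exact h2
      · intro h3
        rcases h1 with h1 | h1
        · linarith
        · exact h1
    have h1 := (iff_of_hFace_eq key (ha.trans hb.symm)).1
      ⟨ha, (hcon a ha).resolve_left (by linarith)⟩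
    linarith [h1.2]
  · rw [halfIn_true] at hx
    simp only [halfIn_true, not_and_or, not_lt, not_le] at hcon
    have key : ∀ a b, HLink c a b → ((hFace c a = h ∧ a.1.1.x1 ≤ x) ↔
        (hFace c b = h ∧ b.1.1.x1 ≤ x)) := by
      intro a b hab
      have hf : hFace c a = hFace c b := Quot.sound hab
      rw [hf]
      refine and_congr_right fun he => ?_
      obtain ⟨p, ⟨hpa, hpb⟩, -⟩ := hab
      rw [mem_hEdge] at hpa hpb
      have h1 := hcon a (hf.trans he)
      have h2 := hcon b he
      constructor
      · intro h3
        rcases h2 with h2 | h2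
        · linarith
        · exact h2
      · intro h3
        rcases h1 with h1 | h1
        · linarith
        · exact h1
    have h1 := (iff_of_hFace_eq key (ha.trans hb.symm)).1
      ⟨ha, (hcon a ha).resolve_left (by linarith)⟩
    linarith [h1.2]

/-- Next to a point of a horizontal face, the squares to the north have their lower edge in the
face and the squares to the south have their upper edge in the face. -/
theorem EdgeFiniteFor.germ_hFace (hc : EdgeFiniteFor c) {h : HFace c} {s : Bool} {p : ℂ}
    (hp : HalfIn s h.lo h.hi p.re)
    (hy : p.im = h.y) :
    bottomFace c (T.germ p s true) = h ∧ topFace c (T.germ p s false) = h := by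
  obtain ⟨⟨q, b⟩, hq, hx⟩ := hc.exists_edge hp
  have hlt := q.1.y0_lt_y1
  have h1 := T.germ_spec p s true
  have h2 := T.germ_spec p s false
  -- The covering edge belongs to a square on one side of the line. The germ on the other side is a
  -- different square, so `bottomFace_eq_topFace` transfers the face across.
  cases b
  · have e : p.im = q.1.y0 := by rw [hy, ← hq]; rfl
    have e1 : q = T.germ p s true := eq_germ ⟨hx, e.ge, e.trans_lt hlt⟩
    rw [hFace_false, e1] at hq
    rw [e1] at e
    refine ⟨hq, ?_⟩
    rw [← bottomFace_eq_topFace, hq]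
    intro e2
    rw [← e2] at h2
    linarith [h2.2.1]
  · have e : p.im = q.1.y1 := by rw [hy, ← hq]; rfl
    have e1 : q = T.germ p s false := eq_germ ⟨hx, hlt.trans_le e.ge, e.le⟩
    rw [hFace_true, e1] at hq
    rw [e1] at e
    refine ⟨?_, hq⟩
    rw [bottomFace_eq_topFace, hq]
    intro e2
    rw [e2] at h1
    linarith [h1.2.2]

theorem EdgeFiniteFor.germ_hFace_y (hc : EdgeFiniteFor c) {h : HFace c} {s : Bool} {p : ℂ}
    (hp : HalfIn s h.lo h.hi p.re) (hy : p.im = h.y) :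
    (T.germ p s true).1.y0 = h.y ∧ (T.germ p s false).1.y1 = h.y := by
  obtain ⟨h1, h2⟩ := hc.germ_hFace hp hy
  exact ⟨congrArg HFace.y h1, congrArg HFace.y h2⟩

theorem EdgeFiniteFor.germ_north_ne_south (hc : EdgeFiniteFor c) {h : HFace c} {s : Bool} {p : ℂ}
    (hp : HalfIn s h.lo h.hi p.re) (hy : p.im = h.y) : T.germ p s true ≠ T.germ p s false := by
  intro e
  have h1 := (hc.germ_hFace_y hp hy).1
  have h2 := (T.germ_spec p s false).2.1
  rw [← e] at h2
  linarith

/-- The left end of a horizontal face is not a point at which vertical faces are broken. -/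
theorem EdgeFiniteFor.left_end_notMem_horiz (hc : EdgeFiniteFor c) (h : HFace c) :
    (⟨h.lo, h.y⟩ : ℂ) ∉ c.horiz := by
  intro hp
  set p : ℂ := ⟨h.lo, h.y⟩ with hpdef
  have hx : HalfIn true h.lo h.hi p.re := ⟨le_rfl, hc.lo_lt_hi h⟩
  have h1 := hc.germ_hFace hx rfl
  have hs := c.horiz_subset hp
  have h2 : p.im = (T.germ p false true).1.y0 := by
    refine ((corner_of_singular hs (T.germ_region p false true)).2).resolve_right fun e => ?_
    linarith [(T.germ_spec p false true).2.2]
  have h3 := T.germ_spec p false true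
  have h4 := T.germ_spec p true true
  -- If the horizontal direction passed through `p`, the edge beyond `p` would be linked to the
  -- face, which would then extend to the left of its own left end.
  have h5 : bottomFace c (T.germ p false true) = bottomFace c (T.germ p true true) := by
    refine Quot.sound ⟨p, ⟨?_, ?_⟩, fun hh => hh.2 hp⟩
    · exact Square.mem_bottom.2 ⟨h3.1.mem, h2⟩
    · exact Square.mem_bottom.2 ⟨h4.1.mem, (hc.germ_hFace_y hx rfl).1.symm⟩
  have h6 := hc.lo_le (T.germ p false true, false)
  rw [hFace_false, h5, h1.1] at h6
  exact absurd h3.1.1 (not_lt.2 h6)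

/-- The right end of a horizontal face is not a point at which vertical faces are broken. -/
theorem EdgeFiniteFor.right_end_notMem_horiz (hc : EdgeFiniteFor c) (h : HFace c) :
    (⟨h.hi, h.y⟩ : ℂ) ∉ c.horiz := by
  intro hp
  set p : ℂ := ⟨h.hi, h.y⟩ with hpdef
  have hx : HalfIn false h.lo h.hi p.re := ⟨hc.lo_lt_hi h, le_rfl⟩
  have h1 := hc.germ_hFace hx rfl
  have hs := c.horiz_subset hp
  have h2 : p.im = (T.germ p true true).1.y0 := by
    refine ((corner_of_singular hs (T.germ_region p true true)).2).resolve_right fun e => ?_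
    linarith [(T.germ_spec p true true).2.2]
  have h3 := T.germ_spec p true true
  have h4 := T.germ_spec p false true
  have h5 : bottomFace c (T.germ p true true) = bottomFace c (T.germ p false true) := by
    refine Quot.sound ⟨p, ⟨?_, ?_⟩, fun hh => hh.2 hp⟩
    · exact Square.mem_bottom.2 ⟨h3.1.mem, h2⟩
    · exact Square.mem_bottom.2 ⟨h4.1.mem, (hc.germ_hFace_y hx rfl).1.symm⟩
  have h6 := hc.le_hi (T.germ p true true, false)
  rw [hFace_false, h5, h1.1] at h6
  exact absurd h3.1.2 (not_lt.2 h6)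

theorem hEdge_y {h : HFace c} {q : T.squares} (hq : topFace c q = h ∨ bottomFace c q = h) :
    q.1.y0 ≤ h.y ∧ h.y ≤ q.1.y1 := by
  have := q.1.y0_lt_y1
  rcases hq with rfl | rfl
  · exact ⟨this.le, le_rfl⟩
  · exact ⟨le_rfl, this.le⟩

theorem EdgeFiniteFor.bounds (hc : EdgeFiniteFor c) {h : HFace c} {q : T.squares}
    (hq : topFace c q = h ∨ bottomFace c q = h) :
    h.lo ≤ q.1.x0 ∧ q.1.x1 ≤ h.hi ∧ 4 * h.gap ≤ q.1.side := by
  rcases hq with rfl | rfl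
  · exact ⟨hc.lo_le (q, true), hc.le_hi (q, true), hc.gap_le (q, true)⟩
  · exact ⟨hc.lo_le (q, false), hc.le_hi (q, false), hc.gap_le (q, false)⟩

/-- All squares at the left end of a horizontal face have the same vertical face on the left. -/
theorem EdgeFiniteFor.leftFace_eq (hc : EdgeFiniteFor c) {h : HFace c} {q q' : T.squares}
    (hq : topFace c q = h ∨ bottomFace c q = h) (hq' : topFace c q' = h ∨ bottomFace c q' = h)
    (hx : q.1.x0 = h.lo) (hx' : q'.1.x0 = h.lo) : leftFace c q = leftFace c q' :=
  Quot.sound ⟨⟨h.lo, h.y⟩, ⟨Square.mem_left.2 ⟨hx.symm, hEdge_y hq⟩,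
    Square.mem_left.2 ⟨hx'.symm, hEdge_y hq'⟩⟩, hc.left_end_notMem_horiz h⟩

/-- All squares at the right end of a horizontal face have the same vertical face on the right. -/
theorem EdgeFiniteFor.rightFace_eq (hc : EdgeFiniteFor c) {h : HFace c} {q q' : T.squares}
    (hq : topFace c q = h ∨ bottomFace c q = h) (hq' : topFace c q' = h ∨ bottomFace c q' = h)
    (hx : q.1.x1 = h.hi) (hx' : q'.1.x1 = h.hi) : rightFace c q = rightFace c q' :=
  Quot.sound ⟨⟨h.hi, h.y⟩, ⟨Square.mem_right.2 ⟨hx.symm, hEdge_y hq⟩,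
    Square.mem_right.2 ⟨hx'.symm, hEdge_y hq'⟩⟩, hc.right_end_notMem_horiz h⟩

/-- A square at a horizontal face that is not the first one has a left neighbour. -/
theorem EdgeFiniteFor.exists_left_neighbour (hc : EdgeFiniteFor c) {h : HFace c} {q : T.squares}
    (hq : topFace c q = h ∨ bottomFace c q = h) (hx : h.lo < q.1.x0) :
    ∃ q' : T.squares, (topFace c q' = h ∨ bottomFace c q' = h) ∧ q'.1.x1 = q.1.x0 ∧
      leftFace c q = rightFace c q' := by
  have hlt := q.1.y0_lt_y1
  have hxx := q.1.x0_lt_x1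
  set p : ℂ := ⟨q.1.x0, h.y⟩ with hp
  have hhalf : HalfIn false h.lo h.hi p.re := ⟨hx, hxx.le.trans (hc.bounds hq).2.1⟩
  have h1 := hc.germ_hFace hhalf rfl
  -- Here `q` is the eastern germ at its corner `p` on the line of `h`. As `p` is beyond the left
  -- end of `h`, the western germ on the same side `t` also borders `h` and is the neighbour.
  have key : ∀ t, q.1.Germ true t p → (topFace c (T.germ p false t) = h ∨
      bottomFace c (T.germ p false t) = h) → ∃ q' : T.squares,
      (topFace c q' = h ∨ bottomFace c q' = h) ∧ q'.1.x1 = q.1.x0 ∧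
        leftFace c q = rightFace c q' := by
    intro t ht h2
    have e := eq_germ ht
    have hne : T.germ p true t ≠ T.germ p false t := fun e2 => by
      have h3 := (T.germ_spec p false t).1.1
      rw [← e2, ← e] at h3
      exact lt_irrefl _ h3
    refine ⟨_, h2, (germ_east_west hne).2, ?_⟩
    rw [← leftFace_eq_rightFace hne, ← e]
  rcases hq with hq | hq
  · have hy : h.y = q.1.y1 := by rw [← hq]; rfl
    exact key false ⟨⟨le_rfl, hxx⟩, ⟨hlt.trans_le hy.ge, hy.le⟩⟩ (Or.inl h1.2)
  · have hy : h.y = q.1.y0 := by rw [← hq]; rfl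
    exact key true ⟨⟨le_rfl, hxx⟩, ⟨hy.ge, hy.trans_lt hlt⟩⟩ (Or.inr h1.1)

/-- A square at a horizontal face that is not the last one has a right neighbour. -/
theorem EdgeFiniteFor.exists_right_neighbour (hc : EdgeFiniteFor c) {h : HFace c} {q : T.squares}
    (hq : topFace c q = h ∨ bottomFace c q = h) (hx : q.1.x1 < h.hi) :
    ∃ q' : T.squares, (topFace c q' = h ∨ bottomFace c q' = h) ∧ q'.1.x0 = q.1.x1 := by
  have hlt := q.1.y0_lt_y1
  have hxx := q.1.x0_lt_x1
  set p : ℂ := ⟨q.1.x1, h.y⟩ with hp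
  have hhalf : HalfIn true h.lo h.hi p.re := ⟨(hc.bounds hq).1.trans hxx.le, hx⟩
  have h1 := hc.germ_hFace hhalf rfl
  have key : ∀ t, q.1.Germ false t p → (topFace c (T.germ p true t) = h ∨
      bottomFace c (T.germ p true t) = h) → ∃ q' : T.squares,
      (topFace c q' = h ∨ bottomFace c q' = h) ∧ q'.1.x0 = q.1.x1 := by
    intro t ht h2
    have e := eq_germ ht
    have hne : T.germ p true t ≠ T.germ p false t := fun e2 => by
      have h3 := (T.germ_spec p true t).1.2
      rw [e2, ← e] at h3
      exact lt_irrefl _ h3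
    exact ⟨_, h2, (germ_east_west hne).1⟩
  rcases hq with hq | hq
  · have hy : h.y = q.1.y1 := by rw [← hq]; rfl
    exact key false ⟨⟨hxx, le_rfl⟩, ⟨hlt.trans_le hy.ge, hy.le⟩⟩ (Or.inl h1.2)
  · have hy : h.y = q.1.y0 := by rw [← hq]; rfl
    exact key true ⟨⟨hxx, le_rfl⟩, ⟨hy.ge, hy.trans_lt hlt⟩⟩ (Or.inr h1.1)

/-- Otherwise there is a left neighbour at the same face, of size at least `4 * h.gap`, which fits
in between `h.lo` and the square. -/
theorem EdgeFiniteFor.x0_eq_lo (hc : EdgeFiniteFor c) {h : HFace c} {q : T.squares}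
    (hq : topFace c q = h ∨ bottomFace c q = h) (hx : q.1.x0 < h.lo + h.gap) :
    q.1.x0 = h.lo := by
  refine le_antisymm (not_lt.1 fun hlt => ?_) (hc.bounds hq).1
  obtain ⟨q', hq', he, -⟩ := hc.exists_left_neighbour hq hlt
  have h1 := hc.bounds hq'
  linarith [h1.1, h1.2.2, hc.gap_pos h, q'.1.x1_eq]

theorem EdgeFiniteFor.x1_eq_hi (hc : EdgeFiniteFor c) {h : HFace c} {q : T.squares}
    (hq : topFace c q = h ∨ bottomFace c q = h) (hx : h.hi - h.gap < q.1.x1) :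
    q.1.x1 = h.hi := by
  refine le_antisymm (hc.bounds hq).2.1 (not_lt.1 fun hlt => ?_)
  obtain ⟨q', hq', he⟩ := hc.exists_right_neighbour hq hlt
  have h1 := hc.bounds hq'
  linarith [h1.2.1, h1.2.2, hc.gap_pos h, q'.1.x1_eq]

/-- Additivity of Lebesgue measure; half-open intervals are used so that adjacent ones are disjoint
and still leave no gap. -/
theorem sum_sub_eq_of_pairwiseDisjoint {ι : Type*} (s : Finset ι) (l r : ι → ℝ) (a b : ℝ)
    (hab : a ≤ b) (hlr : ∀ i ∈ s, l i ≤ r i)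
    (hd : (s : Set ι).PairwiseDisjoint fun i => Ico (l i) (r i))
    (hU : ⋃ i ∈ s, Ico (l i) (r i) = Ico a b) : ∑ i ∈ s, (r i - l i) = b - a := by
  have h1 := MeasureTheory.measure_biUnion_finset (μ := MeasureTheory.volume) hd
    (fun i _ => measurableSet_Ico)
  rw [hU, Real.volume_Ico, Finset.sum_congr rfl (fun i _ => Real.volume_Ico),
    ← ENNReal.ofReal_sum_of_nonneg (fun i hi => sub_nonneg.2 (hlr i hi))] at h1
  exact ((ENNReal.ofReal_eq_ofReal_iff (sub_nonneg.2 hab)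
    (Finset.sum_nonneg fun i hi => sub_nonneg.2 (hlr i hi))).1 h1).symm

/-- The squares on either side of a horizontal face have the length of the face as total size. -/
theorem EdgeFiniteFor.finsum_side (hc : EdgeFiniteFor c) (h : HFace c) (b : Bool) :
    ∑ᶠ (q : T.squares) (_ : hFace c (q, b) = h), q.1.side = h.hi - h.lo := by
  have hfin : {q : T.squares | hFace c (q, b) = h}.Finite :=
    (hc.finite_edges h).preimage (f := fun q => (q, b)) (fun q _ q' _ e => congrArg Prod.fst e)
  have hq : ∀ q : T.squares, hFace c (q, b) = h → (topFace c q = h ∨ bottomFace c q = h) := by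
    intro q hq
    cases b
    · exact Or.inr hq
    · exact Or.inl hq
  -- Top edges (`b = true`) belong to squares south of the face, whence the negation in `!b`. Every
  -- point of the half-open face lies in the interval of exactly one square, its eastern germ on
  -- that side.
  have hgerm : ∀ (q : T.squares) (x : ℝ), hFace c (q, b) = h → x ∈ Ico q.1.x0 q.1.x1 →
      q.1.Germ true (!b) ⟨x, h.y⟩ := by
    intro q x hq hx
    refine ⟨hx, ?_⟩
    have hlt := q.1.y0_lt_y1
    rw [← hq]
    cases b
    · exact ⟨le_rfl, hlt⟩
    · exact ⟨hlt, le_rfl⟩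
  have h1 := finsum_mem_eq_finite_toFinset_sum (fun q : T.squares => q.1.side) hfin
  refine h1.trans ?_
  have h2 : ∀ q : T.squares, q.1.side = q.1.x1 - q.1.x0 := fun q => by
    rw [Square.x1_eq]; ring
  rw [Finset.sum_congr rfl (fun q _ => h2 q)]
  refine sum_sub_eq_of_pairwiseDisjoint _ _ _ _ _ (hc.lo_lt_hi h).le
    (fun q _ => q.1.x0_lt_x1.le) ?_ ?_
  · intro q hq1 q' hq1' hne
    refine Set.disjoint_left.2 fun x hx hx' => hne ?_
    simp only [Finite.coe_toFinset] at hq1 hq1'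
    exact eq_of_germ (hgerm q x hq1 hx) (hgerm q' x hq1' hx')
  · ext x
    simp only [Finite.mem_toFinset, mem_iUnion, exists_prop]
    constructor
    · rintro ⟨q, hq1, hx⟩
      have h3 := hc.bounds (hq q hq1)
      exact ⟨h3.1.trans hx.1, hx.2.trans_le h3.2.1⟩
    · intro hx
      have h3 := hc.germ_hFace (s := true) (p := ⟨x, h.y⟩) hx rfl
      refine ⟨T.germ ⟨x, h.y⟩ true (!b), ?_, (T.germ_spec ⟨x, h.y⟩ true (!b)).1⟩
      cases b
      · exact h3.1
      · exact h3.2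

/-- Squares at the same horizontal face are related by any equivalence relation that relates
squares with a common vertical face. -/
theorem EdgeFiniteFor.rel_of_hFace (hc : EdgeFiniteFor c) {r : T.squares → T.squares → Prop}
    (hr : Equivalence r)
    (hv : ∀ a b, vFace c a = vFace c b → r a.1 b.1) (a b : T.squares × Bool)
    (hab : hFace c a = hFace c b) : r a.1 b.1 := by
  set h := hFace c a with hh
  have hedge : ∀ a : T.squares × Bool, hFace c a = h →
      (topFace c a.1 = h ∨ bottomFace c a.1 = h) := by
    rintro ⟨q, b⟩ hq
    cases b
    · exact Or.inr hq
    · exact Or.inl hq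
  obtain ⟨e, he, hx⟩ := hc.exists_lo h
  have hfin : {q : T.squares | topFace c q = h ∨ bottomFace c q = h}.Finite := by
    refine ((hc.finite_edges h).image Prod.fst).subset ?_
    rintro q (hq | hq)
    · exact ⟨(q, true), hq, rfl⟩
    · exact ⟨(q, false), hq, rfl⟩
  have key : ∀ q : T.squares, (topFace c q = h ∨ bottomFace c q = h) → r q e.1 := by
    by_contra! hcon
    obtain ⟨q0, hq0, hq0'⟩ := hcon
    -- A leftmost counterexample either starts at the end of the face, where it shares its left
    -- vertical face with `e.1`, or shares it with a left neighbour that is no counterexample.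
    obtain ⟨q, ⟨hq, hqr⟩, hmin⟩ := Set.exists_min_image
      {q : T.squares | (topFace c q = h ∨ bottomFace c q = h) ∧ ¬ r q e.1} (fun q => q.1.x0)
      (hfin.subset fun q hq => hq.1) ⟨q0, hq0, hq0'⟩
    rcases (hc.bounds hq).1.eq_or_lt with h1 | h1
    · exact hqr (hv (q, true) (e.1, true) (hc.leftFace_eq hq (hedge e he) h1.symm hx))
    · obtain ⟨q', hq', hx', hf⟩ := hc.exists_left_neighbour hq h1
      have h2 : r q' e.1 := by
        by_contra h2
        have := hmin q' ⟨hq', h2⟩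
        linarith [q'.1.x0_lt_x1]
      exact hqr (hr.trans (hv (q, true) (q', false) hf) h2)
  exact hr.trans (key a.1 (hedge a rfl)) (hr.symm (key b.1 (hedge b hab.symm)))

end SquareTiling

/-! ### Rotation by 90 degrees -/

namespace Square

@[simp] theorem x0_rotate (q : Square) : q.rotate.x0 = -q.y1 := by
  simp [x0, y1, rotate]; ring

@[simp] theorem x1_rotate (q : Square) : q.rotate.x1 = -q.y0 := by
  simp [x1, y0, rotate]

@[simp] theorem y0_rotate (q : Square) : q.rotate.y0 = q.x0 := by
  simp [x0, y0, rotate]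

@[simp] theorem y1_rotate (q : Square) : q.rotate.y1 = q.x1 := by
  simp [x1, y1, rotate]

theorem rotate_injective : Function.Injective rotate := by
  intro q q' h
  have h0 : q.rotate.side = q'.rotate.side := congrArg Square.side h
  have h1 := congrArg x1 h
  have h2 := congrArg y0 h
  simp only [x1_rotate, y0_rotate, neg_inj] at h1 h2
  exact ext_coord h2 h1 h0

end Square

namespace SquareTiling

variable {T : SquareTiling}

/-- The correspondence between the squares of a tiling and those of the rotated tiling. -/
def rotateEquiv (T : SquareTiling) : T.squares ≃ T.rotate.squares :=
  Equiv.Set.image Square.rotate T.squares Square.rotate_injective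

@[simp] theorem rotateEquiv_val (q : T.squares) : (T.rotateEquiv q).1 = q.1.rotate := rfl

theorem mem_region_rotate {q : Square} {p : ℂ} : I * p ∈ q.rotate.region ↔ p ∈ q.region := by
  rw [Square.region_rotate]
  exact (mul_right_injective₀ I_ne_zero).mem_set_image

theorem mem_singular_rotate {p : ℂ} : I * p ∈ T.rotate.singular ↔ p ∈ T.singular := by
  have h : {q ∈ T.rotate.squares | I * p ∈ q.region} =
      Square.rotate '' {q ∈ T.squares | p ∈ q.region} := by
    ext q'
    constructor
    · rintro ⟨⟨q, hq, rfl⟩, hp⟩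
      exact ⟨q, ⟨hq, mem_region_rotate.1 hp⟩, rfl⟩
    · rintro ⟨q, ⟨hq, hp⟩, rfl⟩
      exact ⟨⟨q, hq, rfl⟩, mem_region_rotate.2 hp⟩
  rw [singular, singular, mem_ofPred_eq, mem_ofPred_eq, h,
    Set.ncard_image_of_injective _ Square.rotate_injective]

theorem mul_I_surjective (z : ℂ) : ∃ p, I * p = z := ⟨-I * z, by simp [← mul_assoc]⟩

/-- The choice of faces of the rotated tiling that corresponds to a choice of faces. -/
def FaceChoice.rotate (c : T.FaceChoice) : T.rotate.FaceChoice where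
  -- Rotation exchanges the directions, so the horizontal one now passes where the vertical one did.
  horiz := (fun z => I * z) '' (T.singular \ c.horiz)
  horiz_subset := by
    rintro _ ⟨p, hp, rfl⟩
    exact mem_singular_rotate.2 hp.1

variable {c : T.FaceChoice}

theorem mem_horiz_rotate {p : ℂ} : I * p ∈ c.rotate.horiz ↔ p ∈ T.singular \ c.horiz :=
  (mul_right_injective₀ I_ne_zero).mem_set_image

/-- Counterclockwise rotation takes left to bottom and right to top, which negates the Boolean; top
goes to left and bottom to right, which keeps it in `mem_vEdge_rotate`. -/
theorem mem_hEdge_rotate {q : T.squares} {b : Bool} {p : ℂ} :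
    I * p ∈ T.rotate.hEdge (T.rotateEquiv q, !b) ↔ p ∈ T.vEdge (q, b) := by
  rw [mem_hEdge, mem_vEdge]
  cases b <;> simp [hy, vx] <;> tauto

theorem mem_vEdge_rotate {q : T.squares} {b : Bool} {p : ℂ} :
    I * p ∈ T.rotate.vEdge (T.rotateEquiv q, b) ↔ p ∈ T.hEdge (q, b) := by
  rw [mem_hEdge, mem_vEdge]
  cases b <;> simp [hy, vx] <;> tauto

/-- In the rotated tiling the horizontal faces are broken exactly at the rotated points of
`c.horiz`, that is, where the vertical faces were broken. -/
theorem hLink_rotate (a b : T.squares × Bool) :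
    HLink c.rotate (T.rotateEquiv a.1, !a.2) (T.rotateEquiv b.1, !b.2) ↔ VLink c a b := by
  constructor
  · rintro ⟨z, ⟨h1, h2⟩, h3⟩
    obtain ⟨p, rfl⟩ := mul_I_surjective z
    refine ⟨p, ⟨mem_hEdge_rotate.1 h1, mem_hEdge_rotate.1 h2⟩, fun h4 => h3 ⟨?_, fun h5 => ?_⟩⟩
    · exact mem_singular_rotate.2 (c.horiz_subset h4)
    · exact (mem_horiz_rotate.1 h5).2 h4
  · rintro ⟨p, ⟨h1, h2⟩, h3⟩
    refine ⟨I * p, ⟨mem_hEdge_rotate.2 h1, mem_hEdge_rotate.2 h2⟩, fun h4 => h4.2 ?_⟩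
    exact mem_horiz_rotate.2 ⟨mem_singular_rotate.1 h4.1, h3⟩

theorem vLink_rotate (a b : T.squares × Bool) :
    VLink c.rotate (T.rotateEquiv a.1, a.2) (T.rotateEquiv b.1, b.2) ↔ HLink c a b := by
  constructor
  · rintro ⟨z, ⟨h1, h2⟩, h3⟩
    obtain ⟨p, rfl⟩ := mul_I_surjective z
    exact ⟨p, ⟨mem_vEdge_rotate.1 h1, mem_vEdge_rotate.1 h2⟩, fun h4 => h3 (mem_horiz_rotate.2 h4)⟩
  · rintro ⟨p, ⟨h1, h2⟩, h3⟩
    exact ⟨I * p, ⟨mem_vEdge_rotate.2 h1, mem_vEdge_rotate.2 h2⟩,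
      fun h4 => h3 (mem_horiz_rotate.1 h4)⟩

/-- Vertical edges become horizontal edges. -/
def vEdgeRotate (T : SquareTiling) : T.squares × Bool ≃ T.rotate.squares × Bool :=
  T.rotateEquiv.prodCongr Equiv.boolNot

/-- Horizontal edges become vertical edges. -/
def hEdgeRotate (T : SquareTiling) : T.squares × Bool ≃ T.rotate.squares × Bool :=
  T.rotateEquiv.prodCongr (Equiv.refl Bool)

/-- Vertical faces become horizontal faces. -/
def vFaceRotate (c : T.FaceChoice) : VFace c ≃ HFace c.rotate :=
  Quot.congr T.vEdgeRotate fun a b => (hLink_rotate a b).symm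

/-- Horizontal faces become vertical faces. -/
def hFaceRotate (c : T.FaceChoice) : HFace c ≃ VFace c.rotate :=
  Quot.congr T.hEdgeRotate fun a b => (vLink_rotate a b).symm

theorem EdgeFiniteFor.rotate (hc : EdgeFiniteFor c) : EdgeFiniteFor c.rotate := by
  constructor
  · intro h
    obtain ⟨f, rfl⟩ := (vFaceRotate c).surjective h
    refine ((hc.2 f).image T.vEdgeRotate).subset ?_
    intro a' ha'
    obtain ⟨a, rfl⟩ := T.vEdgeRotate.surjective a'
    exact ⟨a, (vFaceRotate c).injective ha', rfl⟩
  · intro h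
    obtain ⟨f, rfl⟩ := (hFaceRotate c).surjective h
    refine ((hc.1 f).image T.hEdgeRotate).subset ?_
    intro a' ha'
    obtain ⟨a, rfl⟩ := T.hEdgeRotate.surjective a'
    exact ⟨a, (hFaceRotate c).injective ha', rfl⟩

/-- The right-hand side does not depend on `b`: both sides of a vertical face have the same total
size, as is seen after rotation. -/
theorem EdgeFiniteFor.finsum_side_vFace (hc : EdgeFiniteFor c) (f : VFace c) (b : Bool) :
    ∑ᶠ (q : T.squares) (_ : vFace c (q, b) = f), q.1.side =
      (vFaceRotate c f).hi - (vFaceRotate c f).lo := by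
  rw [← hc.rotate.finsum_side _ (!b), ← finsum_comp_equiv T.rotateEquiv]
  refine finsum_congr fun q => ?_
  have h : vFace c (q, b) = f ↔ hFace c.rotate (T.rotateEquiv q, !b) = vFaceRotate c f :=
    (vFaceRotate c).injective.eq_iff.symm
  rw [propext h]
  rfl

theorem EdgeFiniteFor.rel_of_vFace (hc : EdgeFiniteFor c) {r : T.squares → T.squares → Prop}
    (hr : Equivalence r) (hh : ∀ a b, hFace c a = hFace c b → r a.1 b.1)
    (a b : T.squares × Bool) (hab : vFace c a = vFace c b) : r a.1 b.1 := by
  have h1 := hc.rotate.rel_of_hFace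
    (r := fun q q' => r (T.rotateEquiv.symm q) (T.rotateEquiv.symm q'))
    ⟨fun q => hr.refl _, fun h => hr.symm h, fun h h' => hr.trans h h'⟩ ?_
    (T.vEdgeRotate a) (T.vEdgeRotate b) (congrArg (vFaceRotate c) hab)
  · simpa [vEdgeRotate] using h1
  · intro a' b' h
    obtain ⟨a, rfl⟩ := T.hEdgeRotate.surjective a'
    obtain ⟨b, rfl⟩ := T.hEdgeRotate.surjective b'
    have := hh a b ((hFaceRotate c).injective h)
    simpa [hEdgeRotate] using this

/-! ### Closed unions and connectedness of the tiling -/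

theorem isClosed_iUnion_of_subset_region {ι : Type*} (T : SquareTiling) (f : ι → T.squares)
    (hf : ∀ q, (f ⁻¹' {q}).Finite) (A : ι → Set ℂ) (hA : ∀ i, A i ⊆ (f i).1.region)
    (hcl : ∀ i, IsClosed (A i)) : IsClosed (⋃ i, A i) := by
  refine LocallyFinite.isClosed_iUnion (fun p => ⟨Metric.closedBall p 1,
    Metric.closedBall_mem_nhds p one_pos, ?_⟩) hcl
  have h1 := T.locallyFinite _ (isCompact_closedBall p 1)
  have h2 : {q : T.squares | (q.1.region ∩ Metric.closedBall p 1).Nonempty}.Finite :=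
    Set.Finite.subset (h1.preimage Subtype.val_injective.injOn) fun q hq => ⟨q.2, hq⟩
  refine (h2.preimage' (f := f) fun q _ => hf q).subset ?_
  rintro i ⟨z, hz, hz'⟩
  exact ⟨z, hA i hz, hz'⟩

/-- Any two squares are related by an equivalence relation that relates squares with a common
horizontal face. -/
theorem EdgeFiniteFor.rel_of_hFace_rel (hc : EdgeFiniteFor c) {r : T.squares → T.squares → Prop}
    (hr : Equivalence r) (hh : ∀ a b, hFace c a = hFace c b → r a.1 b.1) (q q' : T.squares) :
    r q q' := by
  have hcl : ∀ P : T.squares → Prop, IsClosed (⋃ i : {q : T.squares // P q}, i.1.1.region) := by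
    intro P
    refine T.isClosed_iUnion_of_subset_region (fun i => i.1) ?_ _ (fun i => subset_rfl)
      fun i => i.1.1.isCompact_region.isClosed
    intro q
    exact Set.Subsingleton.finite fun i hi j hj => Subtype.ext (hi.trans hj.symm)
  by_contra hcon
  -- The squares related to `q` and the others form two closed sets covering the connected plane, so
  -- they meet in some point `p`.
  obtain ⟨p, -, hp, hp'⟩ := isPreconnected_closed_iff.1 (isPreconnected_univ (α := ℂ)) _ _
    (hcl (r q)) (hcl fun q' => ¬ r q q') (fun p _ => by
      obtain ⟨q1, hq1, hp⟩ := T.cover p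
      by_cases h : r q ⟨q1, hq1⟩
      · exact Or.inl (mem_iUnion.2 ⟨⟨_, h⟩, hp⟩)
      · exact Or.inr (mem_iUnion.2 ⟨⟨_, h⟩, hp⟩))
    ⟨q.1.corner, mem_univ _, mem_iUnion.2 ⟨⟨q, hr.refl q⟩, Square.mem_region.2
      ⟨⟨le_rfl, q.1.x0_lt_x1.le⟩, le_rfl, q.1.y0_lt_y1.le⟩⟩⟩
    ⟨q'.1.corner, mem_univ _, mem_iUnion.2 ⟨⟨q', hcon⟩, Square.mem_region.2
      ⟨⟨le_rfl, q'.1.x0_lt_x1.le⟩, le_rfl, q'.1.y0_lt_y1.le⟩⟩⟩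
  obtain ⟨⟨q1, h1⟩, hp⟩ := mem_iUnion.1 hp
  obtain ⟨⟨q2, h2⟩, hp'⟩ := mem_iUnion.1 hp'
  obtain ⟨s, t, rfl⟩ := exists_eq_germ hp
  obtain ⟨s', t', rfl⟩ := exists_eq_germ hp'
  -- All germs at `p` are related, a contradiction: neighbours across a vertical line share a
  -- vertical face, those across a horizontal line a horizontal face.
  have hew : ∀ t, r (T.germ p true t) (T.germ p false t) := by
    intro t
    by_cases e : T.germ p true t = T.germ p false t
    · rw [e]; exact hr.refl _
    · exact hc.rel_of_vFace hr hh (_, true) (_, false) (leftFace_eq_rightFace e)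
  have hns : ∀ s, r (T.germ p s true) (T.germ p s false) := by
    intro s
    by_cases e : T.germ p s true = T.germ p s false
    · rw [e]; exact hr.refl _
    · exact hh (_, false) (_, true) (bottomFace_eq_topFace e)
  have h3 : r (T.germ p s t) (T.germ p s' t) := by
    cases s <;> cases s'
    · exact hr.refl _
    · exact hr.symm (hew t)
    · exact hew t
    · exact hr.refl _
  have h4 : r (T.germ p s' t) (T.germ p s' t') := by
    cases t <;> cases t'
    · exact hr.refl _
    · exact hr.symm (hns s')
    · exact hns s'
    · exact hr.refl _
  exact h2 (hr.trans h1 (hr.trans h3 h4))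

/-! ### The vertical face on the right determines the square at a horizontal face -/

/-- The two faces fix ordinate and abscissa of the upper left corner, and only one square lies
south-east of that point. -/
theorem eq_of_topFace_eq_of_leftFace_eq {q q' : T.squares} (h : topFace c q = topFace c q')
    (f : leftFace c q = leftFace c q') : q = q' := by
  have hy := congrArg HFace.y h
  have hx := congrArg VFace.x f
  simp only [y_topFace, x_leftFace] at hx hy
  refine eq_of_germ (p := ⟨q.1.x0, q.1.y1⟩) (s := true) (t := false)
    ⟨⟨le_rfl, q.1.x0_lt_x1⟩, q.1.y0_lt_y1, le_rfl⟩ ⟨?_, ?_⟩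
  · exact ⟨hx.ge, hx.trans_lt q'.1.x0_lt_x1⟩
  · exact ⟨q'.1.y0_lt_y1.trans_le hy.ge, hy.le⟩

theorem eq_of_bottomFace_eq_of_rightFace_eq {q q' : T.squares}
    (h : bottomFace c q = bottomFace c q') (f : rightFace c q = rightFace c q') : q = q' := by
  have hy := congrArg HFace.y h
  have hx := congrArg VFace.x f
  simp only [y_bottomFace, x_rightFace] at hx hy
  refine eq_of_germ (p := ⟨q.1.x1, q.1.y0⟩) (s := false) (t := true)
    ⟨⟨q.1.x0_lt_x1, le_rfl⟩, le_rfl, q.1.y0_lt_y1⟩ ⟨?_, ?_⟩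
  · exact ⟨q'.1.x0_lt_x1.trans_le hx.ge, hx.le⟩
  · exact ⟨hy.ge, hy.trans_lt q'.1.y0_lt_y1⟩

/-- Otherwise `q` and `q'` touch diagonally at a point `p`, `q` in the south-east and `q'` in the
north-west. Then `p` is singular and both a horizontal and a vertical face continue across it, but
one direction is broken there. -/
theorem leftFace_ne_rightFace_of_topFace_eq {q q' : T.squares}
    (h : topFace c q = bottomFace c q') : leftFace c q ≠ rightFace c q' := by
  intro f
  have hy := congrArg HFace.y h
  have hx := congrArg VFace.x f
  simp only [y_topFace, x_leftFace, y_bottomFace, x_rightFace] at hx hy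
  set p : ℂ := ⟨q.1.x0, q.1.y1⟩ with hp
  have e1 : q = T.germ p true false := eq_germ ⟨⟨le_rfl, q.1.x0_lt_x1⟩, q.1.y0_lt_y1, le_rfl⟩
  have e2 : q' = T.germ p false true := eq_germ
    ⟨⟨q'.1.x0_lt_x1.trans_le hx.ge, hx.le⟩, hy.ge, hy.trans_lt q'.1.y0_lt_y1⟩
  have n1 : q.1.y1 = p.im := rfl
  have n2 : q.1.x0 = p.re := rfl
  have n3 : q'.1.y0 = p.im := hy.symm
  have n4 : q'.1.x1 = p.re := hx.symm
  have hs : p ∈ T.singular := by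
    refine mem_singular_of_ne ?_ ?_ ?_ ?_
    · intro e
      have := (T.germ_spec p true true).1.2
      rw [e, ← e2] at this
      linarith
    · intro e
      have := (T.germ_spec p false false).1.1
      rw [← e, ← e1] at this
      linarith
    · intro e
      have := (T.germ_spec p true true).2.2
      rw [e, ← e1] at this
      linarith
    · intro e
      have := (T.germ_spec p false false).2.1
      rw [← e, ← e2] at this
      linarith
  by_cases hh : p ∈ c.horiz
  · have := vFace_broken hh (a := (q, true)) (b := (q', false)) f n2 n1.le
    linarith [q'.1.y0_lt_y1, show q'.1.y1 ≤ p.im from this]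
  · have := hFace_broken ⟨hs, hh⟩ (a := (q', false)) (b := (q, true)) h.symm n3 n4.le
    linarith [q.1.x0_lt_x1, show q.1.x1 ≤ p.re from this]

end SquareTiling

/-! ### Polygonal lines -/

theorem polyLine_cons_cons (a b : ℂ) (l : List ℂ) :
    polyLine (a :: b :: l) = segment ℝ a b ∪ polyLine (b :: l) := by
  ext x
  constructor
  · rintro ⟨p, q, h, hx⟩
    rw [List.infix_cons_iff] at h
    rcases h with h | h
    · rw [List.cons_prefix_cons, List.cons_prefix_cons] at h
      obtain ⟨rfl, rfl, -⟩ := h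
      exact Or.inl hx
    · exact Or.inr ⟨p, q, h, hx⟩
  · rintro (hx | ⟨p, q, h, hx⟩)
    · exact ⟨a, b, ⟨[], l, rfl⟩, hx⟩
    · exact ⟨p, q, List.infix_cons_iff.2 (Or.inr h), hx⟩

theorem polyLine_singleton (a : ℂ) : polyLine [a] = ∅ := by
  ext x
  simp only [mem_empty_iff_false, iff_false]
  rintro ⟨p, q, h, -⟩
  have := h.length_le
  simp at this

theorem polyLine_nil : polyLine [] = ∅ := by
  ext x
  simp only [mem_empty_iff_false, iff_false]
  rintro ⟨p, q, h, -⟩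
  have := h.length_le
  simp at this

theorem isCompact_segment (a b : ℂ) : IsCompact (segment ℝ a b) := by
  rw [segment_eq_image]
  exact isCompact_Icc.image (by fun_prop)

theorem isCompact_polyLine : ∀ l : List ℂ, IsCompact (polyLine l)
  | [] => by rw [polyLine_nil]; exact isCompact_empty
  | [a] => by rw [polyLine_singleton]; exact isCompact_empty
  | a :: b :: l => by
    rw [polyLine_cons_cons]
    exact (isCompact_segment a b).union (isCompact_polyLine (b :: l))

theorem polyLine_reverse (l : List ℂ) : polyLine l.reverse = polyLine l := by
  have key : ∀ l : List ℂ, polyLine l ⊆ polyLine l.reverse := by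
    rintro l x ⟨p, q, ⟨s, t, rfl⟩, hx⟩
    exact ⟨q, p, ⟨t.reverse, s.reverse, by simp⟩, by rwa [segment_symm]⟩
  refine Subset.antisymm ?_ (key l)
  have := key l.reverse
  rwa [List.reverse_reverse] at this

theorem mem_polyLine_of_mem : ∀ {l : List ℂ} {x : ℂ}, 2 ≤ l.length → x ∈ l → x ∈ polyLine l
  | [], _, h, _ => by simp at h
  | [_], _, h, _ => by simp at h
  | [a, b], x, _, hx => by
    rw [polyLine_cons_cons]
    simp only [List.mem_cons, List.not_mem_nil, or_false] at hx
    rcases hx with rfl | rfl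
    · exact Or.inl (left_mem_segment ℝ _ _)
    · exact Or.inl (right_mem_segment ℝ _ _)
  | a :: b :: c :: l, x, _, hx => by
    rw [polyLine_cons_cons]
    rcases List.mem_cons.1 hx with rfl | hx
    · exact Or.inl (left_mem_segment ℝ _ _)
    · exact Or.inr (mem_polyLine_of_mem (by simp) hx)

theorem IsPolyArc.two_le_length : ∀ {l : List ℂ}, IsPolyArc l → 2 ≤ l.length
  | [], h => h.elim
  | [_], h => h.elim
  | _ :: _ :: _, _ => by simp

theorem IsPolyArc.ne {a b : ℂ} : ∀ {l : List ℂ}, IsPolyArc (a :: b :: l) → a ≠ b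
  | [], h => h
  | _ :: _, h => h.1

theorem IsPolyArc.head_notMem {a b : ℂ} : ∀ {l : List ℂ}, IsPolyArc (a :: b :: l) →
    a ∉ polyLine (b :: l)
  | [], _ => by rw [polyLine_singleton]; exact notMem_empty a
  | _ :: _, h => fun ha => h.1 (h.2.1.subset ⟨left_mem_segment ℝ a b, ha⟩)

/-- Simplicity is defined recursively from the head; this is its counterpart at the last node,
needed for edges that are run through backwards. -/
theorem IsPolyArc.getLast_notMem : ∀ {l : List ℂ} {x y : ℂ}, IsPolyArc (l ++ [x, y]) →
    y ∉ polyLine (l ++ [x])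
  | [], x, y, _ => by rw [List.nil_append, polyLine_singleton]; exact notMem_empty y
  | [a], x, y, h => by
    intro hy
    have h' : IsPolyArc [a, x, y] := h
    rw [List.cons_append, List.nil_append, polyLine_cons_cons, polyLine_singleton, union_empty]
      at hy
    have h1 : y ∈ polyLine [x, y] := by
      rw [polyLine_cons_cons]; exact Or.inl (right_mem_segment ℝ _ _)
    have h2 : y ∈ ({x} : Set ℂ) := h'.2.1.subset ⟨hy, h1⟩
    exact (h'.2.2 : x ≠ y) (mem_singleton_iff.1 h2).symm
  | a :: b :: l, x, y, h => by
    have h' : IsPolyArc (a :: b :: (l ++ [x, y])) := h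
    have h3 : segment ℝ a b ∩ polyLine (b :: (l ++ [x, y])) = {b} ∧
        IsPolyArc (b :: (l ++ [x, y])) := by
      cases l with
      | nil => exact h'.2
      | cons c l => exact h'.2
    intro hy
    rw [List.cons_append, List.cons_append, polyLine_cons_cons] at hy
    have h4 : y ∉ polyLine (b :: (l ++ [x])) := IsPolyArc.getLast_notMem (l := b :: l) h3.2
    rcases hy with hy | hy
    · have h1 : y ∈ polyLine (b :: (l ++ [x, y])) := mem_polyLine_of_mem (by simp) (by simp)
      have h2 : y ∈ ({b} : Set ℂ) := h3.1.subset ⟨hy, h1⟩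
      rw [mem_singleton_iff] at h2
      subst h2
      exact h4 (mem_polyLine_of_mem (by simp) (by simp))
    · exact h4 hy

/-! ### Ends and first pieces of edges -/

namespace PlaneGraph

variable (M : PlaneGraph)

theorem two_le_length (e : M.E) : 2 ≤ (M.path e).length := (M.isPolyArc e).two_le_length

/-- The two ends of an edge. -/
theorem exists_ends (e : M.E) : ∃ u v : M.V, u ≠ v ∧ (M.path e).head? = some (M.pos u) ∧
    (M.path e).getLast? = some (M.pos v) ∧ ∀ x : M.V, M.Inc x e ↔ x = u ∨ x = v := by
  obtain ⟨u, v, hu, hv, h⟩ := M.ends e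
  have hu' : M.pos u ∈ M.path e := List.mem_of_head? hu
  have hv' : M.pos v ∈ M.path e := List.mem_of_getLast? hv
  refine ⟨u, v, ?_, hu, hv, fun x => ⟨h x, ?_⟩⟩
  · rintro rfl
    have h2 := M.isPolyArc e
    match hl : M.path e, h2 with
    | a :: b :: l, h2 =>
      rw [hl] at hu hv
      simp only [List.head?_cons, Option.some.injEq] at hu
      rw [List.getLast?_cons_cons] at hv
      have hmem : M.pos u ∈ b :: l := List.mem_of_getLast? hv
      cases l with
      | nil =>
        simp only [List.mem_singleton] at hmem
        exact h2.ne (hu.trans hmem)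
      | cons d l =>
        exact h2.head_notMem (hu ▸ mem_polyLine_of_mem (by simp) hmem)
  · rintro (rfl | rfl)
    · exact mem_polyLine_of_mem (M.two_le_length e) hu'
    · exact mem_polyLine_of_mem (M.two_le_length e) hv'

theorem pathFrom_of_head {v : M.V} {e : M.E} (h : (M.path e).head? = some (M.pos v)) :
    M.pathFrom v e = M.path e := if_pos h

theorem pathFrom_of_getLast {v : M.V} {e : M.E} (h : (M.path e).getLast? = some (M.pos v)) :
    M.pathFrom v e = (M.path e).reverse := by
  obtain ⟨u, v', huv, hu, hv', -⟩ := M.exists_ends e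
  refine if_neg fun h' => huv (M.pos_injective ?_)
  have h1 : M.pos v' = M.pos v := Option.some.inj (hv'.symm.trans h)
  have h2 : M.pos u = M.pos v := Option.some.inj (hu.symm.trans h')
  rw [h1, h2]

/-- An edge at `v` has another end, from which it is run through in the opposite order. -/
theorem exists_other_end {v : M.V} {e : M.E} (h : M.Inc v e) :
    ∃ v', v' ≠ v ∧ M.Inc v' e ∧ M.pathFrom v' e = (M.pathFrom v e).reverse := by
  obtain ⟨u, u', huu, hu, hu', hinc⟩ := M.exists_ends e
  rcases (hinc v).1 h with rfl | rfl
  · refine ⟨u', huu.symm, (hinc u').2 (Or.inr rfl), ?_⟩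
    rw [M.pathFrom_of_getLast hu', M.pathFrom_of_head hu]
  · refine ⟨u, huu, (hinc u).2 (Or.inl rfl), ?_⟩
    rw [M.pathFrom_of_getLast hu', M.pathFrom_of_head hu, List.reverse_reverse]

/-- The first straight piece of an edge, run through from an end of it. -/
theorem exists_pathFrom_eq {v : M.V} {e : M.E} (h : M.Inc v e) :
    ∃ (q : ℂ) (l : List ℂ), M.pathFrom v e = M.pos v :: q :: l ∧ q ≠ M.pos v ∧
      M.pos v ∉ polyLine (q :: l) := by
  obtain ⟨u, u', huu, hu, hu', hinc⟩ := M.exists_ends e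
  have h2 := M.isPolyArc e
  rcases (hinc v).1 h with rfl | rfl
  · rw [M.pathFrom_of_head hu]
    match hl : M.path e, h2 with
    | a :: b :: l, h2 =>
      rw [hl] at hu
      simp only [List.head?_cons, Option.some.injEq] at hu
      subst hu
      exact ⟨b, l, rfl, h2.ne.symm, h2.head_notMem⟩
  · rw [M.pathFrom_of_getLast hu']
    have hlen := M.two_le_length e
    obtain ⟨m, y, hm⟩ : ∃ m y, M.path e = m ++ [y] :=
      ⟨_, _, (List.dropLast_append_getLast (List.ne_nil_of_length_pos (by omega))).symm⟩
    have hy : y = M.pos v := by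
      rw [hm] at hu'
      simpa using hu'
    subst hy
    obtain ⟨l, x, hl⟩ : ∃ l x, m = l ++ [x] := by
      refine ⟨_, _, (List.dropLast_append_getLast (List.ne_nil_of_length_pos ?_)).symm⟩
      rw [hm] at hlen
      simp at hlen
      omega
    subst hl
    have h3 : IsPolyArc (l ++ [x, M.pos v]) := by
      rw [hm] at h2; simpa using h2
    have h4 := h3.getLast_notMem
    refine ⟨x, l.reverse, by rw [hm]; simp, ?_, ?_⟩
    · rintro rfl
      refine h4 (mem_polyLine_of_mem ?_ (by simp))
      rcases l with _ | ⟨a, l⟩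
      · exact absurd rfl (h3 : M.pos v ≠ M.pos v)
      · simp
    · rw [← polyLine_reverse] at h4
      simpa using h4

end PlaneGraph

/-! ### The order of the edges around a vertex -/

/-- The angle, between `0` (excluded) and `2 * π` (included), of a counterclockwise turn from the
direction `u` to the direction `w`. -/
def turnAngle (u w : ℂ) : ℝ :=
  if arg u < arg w then arg w - arg u else arg w - arg u + 2 * Real.pi

theorem turnAngle_pos (u w : ℂ) : 0 < turnAngle u w := by
  have h1 := neg_pi_lt_arg w
  have h2 := arg_le_pi u
  rw [turnAngle]
  split_ifs <;> linarith

theorem turnAngle_le (u w : ℂ) : turnAngle u w ≤ 2 * Real.pi := by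
  have h1 := neg_pi_lt_arg u
  have h2 := arg_le_pi w
  rw [turnAngle]
  split_ifs <;> linarith

theorem turnAngle_eq_iff {u w : ℂ} : turnAngle u w = 2 * Real.pi ↔ arg w = arg u := by
  have h1 := neg_pi_lt_arg u
  have h2 := arg_le_pi w
  rw [turnAngle]
  split_ifs with h
  · constructor <;> intro h3 <;> linarith
  · constructor <;> intro h3 <;> linarith

theorem turnAngle_self (u : ℂ) : turnAngle u u = 2 * Real.pi := turnAngle_eq_iff.2 rfl

/-- The inequality of arguments is needed since a turn back to the initial direction counts as a
full turn in `turnAngle`, whereas `Ccw` requires three distinct directions. -/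
theorem ccw_iff {u v w : ℂ} (h : arg w ≠ arg u) : Ccw u v w ↔ turnAngle u v < turnAngle u w := by
  have h1 := neg_pi_lt_arg u
  have h2 := arg_le_pi u
  have h3 := neg_pi_lt_arg v
  have h4 := arg_le_pi v
  have h5 := neg_pi_lt_arg w
  have h6 := arg_le_pi w
  rw [Ccw, turnAngle, turnAngle]
  constructor
  · rintro (⟨a, b⟩ | ⟨a, b⟩ | ⟨a, b⟩) <;> split_ifs <;> linarith
  · rcases lt_or_gt_of_ne h with h | h <;> split_ifs with k1 <;> intro k3
    · linarith
    · exact Or.inr (Or.inr ⟨h, k1⟩)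
    · linarith
    · exact Or.inr (Or.inl ⟨by linarith, h⟩)
    · exact Or.inl ⟨k1, by linarith⟩
    · linarith

theorem not_ccw_self (u v : ℂ) : ¬ Ccw u v u := by
  rintro (⟨a, b⟩ | ⟨a, b⟩ | ⟨a, b⟩) <;> linarith

/-- The angle of a turn is determined by the direction it leads to. -/
theorem eq_turnAngle {u w : ℂ} {ρ α : ℝ} (hρ : 0 < ρ) (h0 : 0 < α)
    (h1 : α ≤ 2 * Real.pi) (h : (ρ : ℂ) * exp ((arg u + α : ℝ) * I) = w) :
    α = turnAngle u w := by
  have hn : ρ = ‖w‖ := by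
    rw [← h, norm_mul, norm_exp_ofReal_mul_I, mul_one, norm_real, Real.norm_of_nonneg hρ.le]
  have h2 : exp ((arg u + α : ℝ) * I) = exp (arg w * I) := by
    have h3 := norm_mul_exp_arg_mul_I w
    rw [← hn] at h3
    exact mul_left_cancel₀ (ofReal_ne_zero.2 hρ.ne') (h.trans h3.symm)
  obtain ⟨n, hn⟩ := exp_eq_exp_iff_exists_int.1 h2
  have h4 : arg u + α = arg w + n * (2 * Real.pi) := by
    have h5 : ((arg u + α : ℝ) : ℂ) * I = ((arg w + n * (2 * Real.pi) : ℝ) : ℂ) * I := by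
      rw [hn]; push_cast; ring
    exact_mod_cast mul_right_cancel₀ I_ne_zero h5
  have hpi := Real.pi_pos
  have b1 := neg_pi_lt_arg u
  have b2 := arg_le_pi u
  have b3 := neg_pi_lt_arg w
  have b4 := arg_le_pi w
  -- A multiple of `2 * π` strictly between `-2 * π` and `2 * π` vanishes. With the ranges of the
  -- angles this forces `n = 0` or `n = 1` in the two branches of `turnAngle`.
  have key : ∀ k : ℤ, -(2 * Real.pi) < ((n - k : ℤ) : ℝ) * (2 * Real.pi) →
      ((n - k : ℤ) : ℝ) * (2 * Real.pi) < 2 * Real.pi → n = k := by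
    intro k k1 k2
    have k3 : (-1 : ℝ) < ((n - k : ℤ) : ℝ) := by nlinarith
    have k4 : ((n - k : ℤ) : ℝ) < 1 := by nlinarith
    have k5 : (-1 : ℤ) < n - k := by exact_mod_cast k3
    have k6 : n - k < (1 : ℤ) := by exact_mod_cast k4
    omega
  rw [turnAngle]
  split_ifs with hlt
  · have : n = 0 := key 0 (by push_cast; linarith) (by push_cast; linarith)
    subst this
    push_cast at h4
    linarith
  · have : n = 1 := key 1 (by push_cast; linarith) (by push_cast; linarith)
    subst this
    push_cast at h4
    linarith

theorem exp_arg_add_turnAngle (u w : ℂ) :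
    (‖w‖ : ℂ) * exp ((arg u + turnAngle u w : ℝ) * I) = w := by
  have h : exp ((arg u + turnAngle u w : ℝ) * I) = exp (arg w * I) := by
    rw [turnAngle]
    split_ifs
    · congr 2; push_cast; ring
    · rw [show ((arg u + (arg w - arg u + 2 * Real.pi) : ℝ) : ℂ) * I =
        arg w * I + 2 * Real.pi * I by push_cast; ring]
      exact exp_periodic _
  rw [h, norm_mul_exp_arg_mul_I]

theorem mul_eq_polar {u : ℂ} {β : ℝ} (hu : (‖u‖ : ℂ) * exp (β * I) = u) (y : ℂ) :
    u * y = ((‖u‖ * ‖y‖ : ℝ) : ℂ) * exp ((β + arg y : ℝ) * I) := by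
  conv_lhs => rw [← hu, ← norm_mul_exp_arg_mul_I y]
  push_cast
  rw [add_mul, exp_add]
  ring

/-- After division by the direction of an edge, a small step to its right from one of its points has
the form `s - ε * I`; its polar angle is slightly less than that of the edge. -/
theorem eventually_arg_right {s τ : ℝ} (hs : 0 < s) (hτ : 0 < τ) :
    ∀ᶠ ε : ℝ in 𝓝[>] 0, -τ < arg (s - ε * I) ∧ arg (s - ε * I) < 0 := by
  have hslit : (s : ℂ) - ((0 : ℝ) : ℂ) * I ∈ slitPlane := by
    simp [slitPlane, hs]
  have h1 : Tendsto (fun ε : ℝ => arg (s - ε * I)) (𝓝 0) (𝓝 (arg (s - (0 : ℝ) * I))) :=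
    (continuousAt_arg hslit).tendsto.comp (Continuous.tendsto (by fun_prop) 0)
  have h2 : arg ((s : ℂ) - (0 : ℝ) * I) = 0 := by
    simp [arg_ofReal_of_nonneg hs.le]
  rw [h2] at h1
  filter_upwards [mem_nhdsWithin_of_mem_nhds (h1 (Ioi_mem_nhds (neg_lt_zero.2 hτ))),
    self_mem_nhdsWithin] with ε h3 h4
  exact ⟨h3, arg_neg_iff.2 (by simpa using h4)⟩

theorem eventually_arg_left {s τ : ℝ} (hs : 0 < s) (hτ : 0 < τ) :
    ∀ᶠ ε : ℝ in 𝓝[>] 0, 0 < arg (s + ε * I) ∧ arg (s + ε * I) < τ := by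
  have hslit : (s : ℂ) + ((0 : ℝ) : ℂ) * I ∈ slitPlane := by
    simp [slitPlane, hs]
  have h1 : Tendsto (fun ε : ℝ => arg (s + ε * I)) (𝓝 0) (𝓝 (arg (s + (0 : ℝ) * I))) :=
    (continuousAt_arg hslit).tendsto.comp (Continuous.tendsto (by fun_prop) 0)
  have h2 : arg ((s : ℂ) + (0 : ℝ) * I) = 0 := by
    simp [arg_ofReal_of_nonneg hs.le]
  rw [h2] at h1
  filter_upwards [mem_nhdsWithin_of_mem_nhds (h1 (Iio_mem_nhds hτ)),
    self_mem_nhdsWithin] with ε h3 h4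
  refine ⟨lt_of_le_of_ne (arg_nonneg_iff.2 (by simpa using (mem_Ioi.1 h4).le)) fun h5 => ?_, h3⟩
  have h6 := (arg_eq_zero_iff.1 h5.symm).2
  simp at h6
  exact (mem_Ioi.1 h4).ne' h6

theorem eventually_norm_mul_lt {u : ℂ} {s r : ℝ} (hs : 0 < s) (hr : s * ‖u‖ < r) (z : ℂ) :
    ∀ᶠ ε : ℝ in 𝓝[>] 0, ‖u‖ * ‖s + ε * z‖ < r := by
  have h1 : Tendsto (fun ε : ℝ => ‖u‖ * ‖(s : ℂ) + ε * z‖) (𝓝 0)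
      (𝓝 (‖u‖ * ‖(s : ℂ) + (0 : ℝ) * z‖)) := Continuous.tendsto (by fun_prop) 0
  have h2 : ‖u‖ * ‖(s : ℂ) + (0 : ℝ) * z‖ < r := by
    rw [ofReal_zero, zero_mul, add_zero, norm_real, Real.norm_of_nonneg hs.le, mul_comm]
    exact hr
  exact mem_nhdsWithin_of_mem_nhds (h1 (Iio_mem_nhds h2))

/-! ### Local structure of a plane map at a vertex -/

namespace PlaneGraph

variable {M : PlaneGraph}

/-- The direction in which the edge `e` leaves the vertex `v`. -/
def dir (M : PlaneGraph) (v : M.V) (e : M.E) : ℂ := initialDir (M.pathFrom v e)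

theorem exists_pathFrom_dir {v : M.V} {e : M.E} (h : M.Inc v e) :
    ∃ l : List ℂ, M.pathFrom v e = M.pos v :: (M.pos v + M.dir v e) :: l ∧ M.dir v e ≠ 0 ∧
      M.pos v ∉ polyLine ((M.pos v + M.dir v e) :: l) := by
  obtain ⟨q, l, h1, h2, h3⟩ := M.exists_pathFrom_eq h
  have h4 : M.dir v e = q - M.pos v := by rw [dir, h1]; rfl
  refine ⟨l, ?_, ?_, ?_⟩
  · rw [h1, h4]; simp
  · rw [h4]; exact sub_ne_zero.2 h2
  · rw [h4]; simpa using h3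

theorem arc_eq_pathFrom (v : M.V) (e : M.E) : M.arc e = polyLine (M.pathFrom v e) := by
  classical
  rw [arc, pathFrom]
  split_ifs
  · rfl
  · rw [polyLine_reverse]

theorem arc_eq_union {v : M.V} {e : M.E} {l : List ℂ}
    (h : M.pathFrom v e = M.pos v :: (M.pos v + M.dir v e) :: l) :
    M.arc e = segment ℝ (M.pos v) (M.pos v + M.dir v e) ∪
      polyLine ((M.pos v + M.dir v e) :: l) := by
  rw [arc_eq_pathFrom v e, h, polyLine_cons_cons]

/-- Near a vertex there is no other vertex. -/
theorem IsPlaneMap.eventually_vertex (hM : M.IsPlaneMap) (v : M.V) :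
    ∀ᶠ z in 𝓝 (M.pos v), z ∈ range M.pos → z = M.pos v := by
  have hfin := hM.finite_verts _ (isCompact_closedBall (M.pos v) 1)
  have h1 : ∀ u ∈ {u | M.pos u ∈ Metric.closedBall (M.pos v) 1},
      ∀ᶠ z in 𝓝 (M.pos v), z = M.pos u → z = M.pos v := by
    intro u _
    by_cases h : u = v
    · subst h
      exact Eventually.of_forall fun z hz => hz
    · have hne : M.pos v ≠ M.pos u := fun e => h (M.pos_injective e).symm
      filter_upwards [isOpen_ne.mem_nhds hne] with z hz hz'
      exact absurd hz' hz
  filter_upwards [(eventually_all_finite hfin).2 h1,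
    Metric.closedBall_mem_nhds (M.pos v) one_pos] with z h2 h3
  rintro ⟨u, rfl⟩
  exact h2 u h3 rfl

/-- Near a vertex, the plane map consists of the first pieces of the edges at the vertex. -/
theorem IsPlaneMap.eventually_support (hM : M.IsPlaneMap) (v : M.V) :
    ∀ᶠ z in 𝓝 (M.pos v), z ∈ M.support → z = M.pos v ∨
      ∃ d, M.Inc v d ∧ z ∈ segment ℝ (M.pos v) (M.pos v + M.dir v d) := by
  have hfin := hM.finite_edges _ (isCompact_closedBall (M.pos v) 1)
  have h1 : ∀ e ∈ {e | (M.arc e ∩ Metric.closedBall (M.pos v) 1).Nonempty},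
      ∀ᶠ z in 𝓝 (M.pos v), z ∈ M.arc e →
        ∃ d, M.Inc v d ∧ z ∈ segment ℝ (M.pos v) (M.pos v + M.dir v d) := by
    intro e _
    -- The compact set to be avoided near `v` is the rest of the arc after its first piece if `e`
    -- ends at `v`, and the whole arc otherwise.
    by_cases h : M.Inc v e
    · obtain ⟨l, h2, h3, h4⟩ := exists_pathFrom_dir h
      filter_upwards [(isCompact_polyLine _).isClosed.isOpen_compl.mem_nhds h4] with z hz hz'
      rw [arc_eq_union h2] at hz'
      exact ⟨e, h, hz'.resolve_right hz⟩
    · filter_upwards [(isCompact_polyLine (M.path e)).isClosed.isOpen_compl.mem_nhds h]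
        with z hz hz'
      exact absurd hz' hz
  filter_upwards [(eventually_all_finite hfin).2 h1, hM.eventually_vertex v,
    Metric.closedBall_mem_nhds (M.pos v) one_pos] with z h2 h3 h4
  rintro (hz | hz)
  · exact Or.inl (h3 hz)
  · obtain ⟨e, he⟩ := mem_iUnion.1 hz
    exact Or.inr (h2 e ⟨z, he, h4⟩ he)

/-- Different edges leaving `v` in the same direction would overlap in points arbitrarily close to
`v`. These would have to be vertices, but no other vertex is near `v`. -/
theorem IsPlaneMap.eq_of_arg_eq (hM : M.IsPlaneMap) {v : M.V} {d e : M.E} (hd : M.Inc v d)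
    (he : M.Inc v e) (h : arg (M.dir v d) = arg (M.dir v e)) : d = e := by
  by_contra hne
  obtain ⟨l, h1, h2, -⟩ := exists_pathFrom_dir hd
  obtain ⟨l', h1', h2', -⟩ := exists_pathFrom_dir he
  have h3 := (arg_eq_arg_iff h2 h2').1 h
  set κ : ℝ := ‖M.dir v e‖ / ‖M.dir v d‖ with hκ
  have hκ0 : 0 < κ := div_pos (norm_pos_iff.2 h2') (norm_pos_iff.2 h2)
  have h3 : (κ : ℂ) * M.dir v d = M.dir v e := by rw [hκ]; push_cast; exact h3
  have hseg : ∀ (w : ℂ) (s : ℝ), 0 ≤ s → s ≤ 1 →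
      M.pos v + s * w ∈ segment ℝ (M.pos v) (M.pos v + w) := by
    intro w s hs hs'
    rw [segment_eq_image']
    exact ⟨s, ⟨hs, hs'⟩, by simp⟩
  have h4 : Tendsto (fun s : ℝ => M.pos v + s * M.dir v d) (𝓝[>] 0) (𝓝 (M.pos v)) := by
    have : Tendsto (fun s : ℝ => M.pos v + s * M.dir v d) (𝓝 0)
        (𝓝 (M.pos v + (0 : ℝ) * M.dir v d)) := Continuous.tendsto (by fun_prop) 0
    rw [ofReal_zero, zero_mul, add_zero] at this
    exact this.mono_left nhdsWithin_le_nhds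
  have h0 : ∀ᶠ s : ℝ in 𝓝[>] 0, 0 < s := eventually_mem_nhdsWithin
  have h5 : ∀ a : ℝ, 0 < a → ∀ᶠ s : ℝ in 𝓝[>] 0, s < a := fun a ha =>
    mem_nhdsWithin_of_mem_nhds (Iio_mem_nhds ha)
  obtain ⟨s, k1, k2, k3, k4⟩ := ((h4.eventually (hM.eventually_vertex v)).and
    (h0.and ((h5 1 one_pos).and (h5 κ hκ0)))).exists
  have m1 : M.pos v + s * M.dir v d ∈ M.arc d := by
    rw [arc_eq_union h1]; exact Or.inl (hseg _ s k2.le k3.le)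
  have m2 : M.pos v + s * M.dir v d ∈ M.arc e := by
    rw [arc_eq_union h1']
    refine Or.inl ?_
    have h6 := hseg (M.dir v e) (s / κ) (by positivity) ((div_le_one hκ0).2 k4.le)
    rw [← h3] at h6 ⊢
    convert h6 using 2
    have hκ1 : (κ : ℂ) ≠ 0 := ofReal_ne_zero.2 hκ0.ne'
    push_cast
    field_simp
  have h7 := k1 (M.inter d e hne ⟨m1, m2⟩)
  rw [add_eq_left, mul_eq_zero, ofReal_eq_zero] at h7
  rcases h7 with h7 | h7
  · exact k2.ne' h7
  · exact h2 h7

/-- The sector between consecutive edges at a vertex belongs to a face that is to the left of the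
first edge and to the right of the second one. -/
theorem IsPlaneMap.exists_sector_face (hM : M.IsPlaneMap) {v : M.V} {e e' : M.E}
    (he : M.Inc v e) (he' : M.Inc v e')
    (hmin : ∀ d, M.Inc v d → turnAngle (M.dir v e) (M.dir v e') ≤
      turnAngle (M.dir v e) (M.dir v d)) :
    ∃ f, M.LeftOf v e f ∧ M.RightOf v e' f := by
  obtain ⟨l, h1, h2, -⟩ := exists_pathFrom_dir he
  obtain ⟨l', h1', h2', -⟩ := exists_pathFrom_dir he'
  set u := M.dir v e with hu
  set u' := M.dir v e' with hu'
  set τ := turnAngle u u' with hτ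
  have hτ0 : 0 < τ := turnAngle_pos _ _
  have hτ1 : τ ≤ 2 * Real.pi := turnAngle_le _ _
  obtain ⟨r, hr, hball⟩ := Metric.eventually_nhds_iff.1 (hM.eventually_support v)
  set F : ℝ × ℝ → ℂ := fun x => M.pos v + x.1 * exp ((arg u + x.2 : ℝ) * I) with hF
  -- The open sector from `e` to `e'`, with radius so small that the map consists of straight pieces
  -- from `v`. It is connected and avoids the map, hence lies in one face.
  set S : Set ℂ := F '' (Ioo 0 r ×ˢ Ioo 0 τ) with hS
  have hconn : IsPreconnected S := by
    refine ((convex_Ioo 0 r).prod (convex_Ioo 0 τ)).isPreconnected.image F ?_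
    exact Continuous.continuousOn (by fun_prop)
  have hdisj : S ⊆ M.supportᶜ := by
    rintro _ ⟨⟨ρ, α⟩, ⟨hρ, hα⟩, rfl⟩ hz
    simp only [mem_Ioo] at hρ hα
    have hne : (ρ : ℂ) * exp ((arg u + α : ℝ) * I) ≠ 0 :=
      mul_ne_zero (ofReal_ne_zero.2 hρ.1.ne') (exp_ne_zero _)
    -- A point of an edge `d` in the sector would give `d` the turn angle `α < τ`, against the
    -- minimality of `e'`.
    have hdist : dist (F (ρ, α)) (M.pos v) < r := by
      simp only [hF, dist_eq_norm, add_sub_cancel_left]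
      rw [norm_mul, norm_exp_ofReal_mul_I, mul_one, norm_real, Real.norm_of_nonneg hρ.1.le]
      exact hρ.2
    rcases hball hdist hz with h3 | ⟨d, hd, h3⟩
    · simp only [hF, add_eq_left] at h3
      exact hne h3
    · rw [segment_eq_image'] at h3
      obtain ⟨s, hs, h4⟩ := h3
      simp only [hF, add_sub_cancel_left, add_right_inj, real_smul] at h4
      have hs0 : 0 < s := lt_of_le_of_ne hs.1 (by
        rintro rfl
        rw [ofReal_zero, zero_mul] at h4
        exact hne h4.symm)
      have h5 : ((ρ / s : ℝ) : ℂ) * exp ((arg u + α : ℝ) * I) = M.dir v d := by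
        have hs1 : (s : ℂ) ≠ 0 := ofReal_ne_zero.2 hs0.ne'
        rw [ofReal_div, div_mul_eq_mul_div, ← h4]
        field_simp
      have h6 := eq_turnAngle (div_pos hρ.1 hs0) hα.1 (hα.2.le.trans hτ1) h5
      have h7 := hmin d hd
      rw [← h6] at h7
      linarith
  have hx0 : F (r / 2, τ / 2) ∈ S :=
    ⟨_, ⟨⟨by simpa using hr, by simpa using hr⟩, by simpa using hτ0, by simpa using hτ0⟩, rfl⟩
  have hsub := hconn.subset_connectedComponentIn hx0 hdisj
  -- Writing a point near the ray along `w` as a multiple `w * y` turns its angle relative to the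
  -- ray into `arg y`: small positive values enter the sector from `e`, small negative ones from
  -- `e'`.
  have hpoint : ∀ (w y : ℂ) (β α : ℝ), w ≠ 0 → y ≠ 0 → (‖w‖ : ℂ) * exp (β * I) = w →
      ‖w‖ * ‖y‖ < r → β + arg y = arg u + α → 0 < α → α < τ → M.pos v + w * y ∈ S := by
    intro w y β α hw hy hβ hlt hα h0 h1
    refine ⟨(‖w‖ * ‖y‖, α), ⟨⟨mul_pos (norm_pos_iff.2 hw) (norm_pos_iff.2 hy), hlt⟩, h0, h1⟩, ?_⟩
    simp only [hF]
    rw [mul_eq_polar hβ y, hα]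
  have hs : ∀ w : ℂ, w ≠ 0 → ∃ s : ℝ, 0 < s ∧ s < 1 ∧ s * ‖w‖ < r := by
    intro w hw
    have hw' := norm_pos_iff.2 hw
    refine ⟨min (1 / 2) (r / (2 * ‖w‖)), lt_min (by norm_num) (by positivity),
      (min_le_left _ _).trans_lt (by norm_num), ?_⟩
    calc min (1 / 2) (r / (2 * ‖w‖)) * ‖w‖ ≤ r / (2 * ‖w‖) * ‖w‖ := by
          gcongr; exact min_le_right _ _
      _ = r / 2 := by field_simp
      _ < r := by linarith
  refine ⟨⟨_, _, hdisj hx0, rfl⟩, ⟨he, ?_⟩, he', M.pos v, M.pos v + u', ?_, ?_⟩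
  · obtain ⟨v', hv', hinc, hrev⟩ := M.exists_other_end he
    refine ⟨v', hv', hinc, M.pos v + u, M.pos v, ?_, ?_⟩
    · rw [hrev, h1]
      exact ⟨l.reverse, [], by simp⟩
    · obtain ⟨s, hs0, hs1, hsr⟩ := hs u h2
      refine ⟨M.pos v + s * u, ?_, ?_⟩
      · rw [openSegment_symm, openSegment_eq_image']
        exact ⟨s, ⟨hs0, hs1⟩, by simp⟩
      · filter_upwards [eventually_arg_left hs0 hτ0, eventually_norm_mul_lt hs0 hsr I]
          with ε k1 k2
        refine hsub ?_
        have hy : (s : ℂ) + ε * I ≠ 0 := fun h => by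
          rw [h, arg_zero] at k1; exact lt_irrefl _ k1.1
        have := hpoint u (s + ε * I) (arg u) (arg (s + ε * I)) h2 hy
          (norm_mul_exp_arg_mul_I u) k2 rfl k1.1 k1.2
        convert this using 1
        ring
  · rw [h1']
    exact ⟨[], l', rfl⟩
  · obtain ⟨s, hs0, hs1, hsr⟩ := hs u' h2'
    refine ⟨M.pos v + s * u', ?_, ?_⟩
    · rw [openSegment_eq_image']
      exact ⟨s, ⟨hs0, hs1⟩, by simp⟩
    · filter_upwards [eventually_arg_right hs0 hτ0, eventually_norm_mul_lt hs0 hsr (-I)]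
        with ε k1 k2
      refine hsub ?_
      have hy : (s : ℂ) - ε * I ≠ 0 := fun h => by
        rw [h, arg_zero] at k1; exact lt_irrefl _ k1.2
      have := hpoint u' (s - ε * I) (arg u + τ) (τ + arg (s - ε * I)) h2' hy
        (exp_arg_add_turnAngle u u') (by rwa [mul_neg, ← sub_eq_add_neg] at k2) (by ring)
        (by linarith) (by linarith)
      convert this using 1
      ring

/-- Each edge at a vertex is followed by an edge. -/
theorem IsPlaneMap.exists_nextAt (hM : M.IsPlaneMap) {v : M.V} {e : M.E} (he : M.Inc v e) :
    ∃ e', M.NextAt v e e' := by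
  have hfin : {d | M.Inc v d}.Finite :=
    (hM.finite_edges {M.pos v} isCompact_singleton).subset fun d hd => ⟨M.pos v, hd, rfl⟩
  -- The edge `e` itself competes with a full turn, so it is its own successor only if it is the
  -- only edge at `v`.
  obtain ⟨e', he', hmin⟩ := Set.exists_min_image _
    (fun d => turnAngle (M.dir v e) (M.dir v d)) hfin ⟨e, he⟩
  refine ⟨e', he, he', ?_, ?_⟩
  · rintro rfl d hd
    have h1 := hmin d hd
    simp only [turnAngle_self] at h1
    exact hM.eq_of_arg_eq hd he (turnAngle_eq_iff.1 (le_antisymm (turnAngle_le _ _) h1))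
  · intro d hd
    by_cases h : e' = e
    · subst h
      exact not_ccw_self _ _
    · change ¬ Ccw (M.dir v e) (M.dir v d) (M.dir v e')
      rw [ccw_iff (fun h1 => h (hM.eq_of_arg_eq he' he h1))]
      exact not_lt.2 (hmin d hd)

theorem IsPlaneMap.exists_face_of_nextAt (hM : M.IsPlaneMap) {v : M.V} {e e' : M.E}
    (h : M.NextAt v e e') : ∃ f, M.LeftOf v e f ∧ M.RightOf v e' f := by
  obtain ⟨he, he', h1, h2⟩ := h
  refine hM.exists_sector_face he he' fun d hd => ?_
  by_cases h : e' = e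
  · rw [h1 h d hd, h]
  · have h3 : ¬ Ccw (M.dir v e) (M.dir v d) (M.dir v e') := h2 d hd
    rw [ccw_iff (fun h1 => h (hM.eq_of_arg_eq he' he h1))] at h3
    exact not_lt.1 h3

/-- If no vertex touches a face twice, then the order of the edges around the vertices is determined
by the faces on their sides. -/
theorem IsPlaneMap.nextAt_iff (hM : M.IsPlaneMap)
    (hleft : ∀ v e f f', M.LeftOf v e f → M.LeftOf v e f' → f = f')
    (hright : ∀ v e e' f, M.RightOf v e f → M.RightOf v e' f → e = e') {v : M.V} {e e' : M.E} :
    M.NextAt v e e' ↔ ∃ f, M.LeftOf v e f ∧ M.RightOf v e' f := by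
  refine ⟨hM.exists_face_of_nextAt, ?_⟩
  rintro ⟨f, h1, h2⟩
  -- The true successor `e''` has on its right the face on the left of `e`, which is `f`, as does
  -- `e'`; uniqueness on the right gives `e' = e''`.
  obtain ⟨e'', h3⟩ := hM.exists_nextAt h1.1
  obtain ⟨f', h4, h5⟩ := hM.exists_face_of_nextAt h3
  rw [hleft v e f f' h1 h4] at h2
  rwa [hright v e' e'' f' h2 h5]

end PlaneGraph

open SquareTiling

/-! ### Uniqueness of the plane map and duality -/

namespace Corresponds

variable {T : SquareTiling} {c : T.FaceChoice} {M : PlaneGraph} {w : M.Dart → ℝ}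

theorem leftOf_iff (r : Corresponds c M w) {v : M.V} {e : M.E} {f : M.Face} : M.LeftOf v e f ↔
    (r.vert v = topFace c (r.edge e) ∧ r.face f = rightFace c (r.edge e)) ∨
    (r.vert v = bottomFace c (r.edge e) ∧ r.face f = leftFace c (r.edge e)) := by
  have hne := topFace_ne_bottomFace (c := c) (r.edge e)
  constructor
  · rintro ⟨h1, v', hv', h2⟩
    rw [r.inc] at h1
    have hv : r.vert v' ≠ r.vert v := fun e => hv' (r.vert.injective e)
    rcases (r.right v' e f).1 h2 with ⟨h3, h4⟩ | ⟨h3, h4⟩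
    · exact Or.inr ⟨h1.resolve_left fun h5 => hv (h3.trans h5.symm), h4⟩
    · exact Or.inl ⟨h1.resolve_right fun h5 => hv (h3.trans h5.symm), h4⟩
  · rintro (⟨h1, h2⟩ | ⟨h1, h2⟩)
    · refine ⟨(r.inc v e).2 (Or.inl h1), r.vert.symm (bottomFace c (r.edge e)), ?_, ?_⟩
      · rintro rfl
        rw [Equiv.apply_symm_apply] at h1
        exact hne h1.symm
      · exact (r.right _ _ _).2 (Or.inr ⟨Equiv.apply_symm_apply _ _, h2⟩)
    · refine ⟨(r.inc v e).2 (Or.inr h1), r.vert.symm (topFace c (r.edge e)), ?_, ?_⟩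
      · rintro rfl
        rw [Equiv.apply_symm_apply] at h1
        exact hne h1
      · exact (r.right _ _ _).2 (Or.inl ⟨Equiv.apply_symm_apply _ _, h2⟩)

theorem leftOf_unique (r : Corresponds c M w) {v : M.V} {e : M.E} {f f' : M.Face}
    (h : M.LeftOf v e f)
    (h' : M.LeftOf v e f') : f = f' := by
  have hne := topFace_ne_bottomFace (c := c) (r.edge e)
  rw [r.leftOf_iff] at h h'
  refine r.face.injective ?_
  rcases h with ⟨h1, h2⟩ | ⟨h1, h2⟩ <;> rcases h' with ⟨h3, h4⟩ | ⟨h3, h4⟩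
  · rw [h2, h4]
  · exact absurd (h1.symm.trans h3) hne
  · exact absurd (h3.symm.trans h1) hne
  · rw [h2, h4]

/-- This excludes that a vertex touches a face twice, so that sides of edges determine the rotation
at each vertex. The mixed cases are those in which a vertical and a horizontal face would cross at a
singular point. -/
theorem edge_unique (r : Corresponds c M w) {v : M.V} {e e' : M.E} {f : M.Face}
    (h : M.RightOf v e f)
    (h' : M.RightOf v e' f) : e = e' := by
  rw [r.right] at h h'
  refine r.edge.injective ?_
  rcases h with ⟨h1, h2⟩ | ⟨h1, h2⟩ <;> rcases h' with ⟨h3, h4⟩ | ⟨h3, h4⟩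
  · exact eq_of_topFace_eq_of_leftFace_eq (h1.symm.trans h3) (h2.symm.trans h4)
  · exact absurd (h2.symm.trans h4) (leftFace_ne_rightFace_of_topFace_eq (h1.symm.trans h3))
  · exact absurd (h4.symm.trans h2) (leftFace_ne_rightFace_of_topFace_eq (h3.symm.trans h1))
  · exact eq_of_bottomFace_eq_of_rightFace_eq (h1.symm.trans h3) (h2.symm.trans h4)

theorem nextAt_iff (r : Corresponds c M w) (hM : M.IsPlaneMap) {v : M.V} {e e' : M.E} :
    M.NextAt v e e' ↔ ∃ f, M.LeftOf v e f ∧ M.RightOf v e' f :=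
  hM.nextAt_iff (fun _ _ _ _ h h' => r.leftOf_unique h h') (fun _ _ _ _ h h' => r.edge_unique h h')

variable {M' : PlaneGraph} {w' : M'.Dart → ℝ} (r : Corresponds c M w) (r' : Corresponds c M' w')

theorem leftOf_iff_leftOf (v : M.V) (e : M.E) (f : M.Face) :
    M.LeftOf v e f ↔ M'.LeftOf ((r.vert.trans r'.vert.symm) v) ((r.edge.trans r'.edge.symm) e)
      ((r.face.trans r'.face.symm) f) := by
  rw [r.leftOf_iff, r'.leftOf_iff]
  simp

theorem rightOf_iff_rightOf (v : M.V) (e : M.E) (f : M.Face) :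
    M.RightOf v e f ↔ M'.RightOf ((r.vert.trans r'.vert.symm) v) ((r.edge.trans r'.edge.symm) e)
      ((r.face.trans r'.face.symm) f) := by
  rw [r.right, r'.right]
  simp

/-- The isomorphism between two plane maps that correspond to the same tiling. -/
def iso (hM : M.IsPlaneMap) (hM' : M'.IsPlaneMap) : M.Iso M' where
  vert := r.vert.trans r'.vert.symm
  edge := r.edge.trans r'.edge.symm
  face := r.face.trans r'.face.symm
  inc v e := by rw [r.inc, r'.inc]; simp
  right := r.rightOf_iff_rightOf r'
  next v e e' := by
    rw [r.nextAt_iff hM, r'.nextAt_iff hM', (r.face.trans r'.face.symm).surjective.exists]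
    exact exists_congr fun f =>
      and_congr (r.leftOf_iff_leftOf r' v e f) (r.rightOf_iff_rightOf r' v e' f)

theorem weight_eq (hM : M.IsPlaneMap) (hM' : M'.IsPlaneMap) (d : M.Dart) (d' : M'.Dart)
    (h : d'.1 = ((r.iso r' hM hM').vert d.1.1, (r.iso r' hM hM').edge d.1.2)) : w' d' = w d := by
  have h1 : r'.vert d'.1.1 = r.vert d.1.1 := by rw [h]; simp [iso]
  have h2 : r'.edge d'.1.2 = r.edge d.1.2 := by rw [h]; simp [iso]
  rcases (r.inc _ _).1 d.2 with h3 | h3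
  · rw [r.weight_top d h3, r'.weight_top d' (by rw [h1, h2, h3]), h2]
  · rw [r.weight_bottom d h3, r'.weight_bottom d' (by rw [h1, h2, h3]), h2]

end Corresponds

theorem SquareTiling.FaceChoice.eq_of_singular_eq_empty {T : SquareTiling} (h : T.singular = ∅)
    (c c' : T.FaceChoice) : c = c' := by
  have key : ∀ c : T.FaceChoice, c.horiz = ∅ := fun c => subset_empty_iff.1 (h ▸ c.horiz_subset)
  cases c with
  | mk a ha =>
    cases c' with
    | mk b hb =>
      have h1 : a = ∅ := key ⟨a, ha⟩
      have h2 : b = ∅ := key ⟨b, hb⟩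
      subst h1 h2
      rfl

theorem SquareTiling.singular_rotate_eq_empty {T : SquareTiling} (h : T.singular = ∅) :
    T.rotate.singular = ∅ := by
  rw [eq_empty_iff_forall_notMem] at h ⊢
  intro z hz
  obtain ⟨p, rfl⟩ := mul_I_surjective z
  exact h p (mem_singular_rotate.1 hz)

/-- Without singular points every choice is the empty one, so any choice for the rotated tiling is a
rotated choice, and edge finiteness transfers. -/
theorem SquareTiling.Regular.rotate {T : SquareTiling} (h : T.Regular) : T.rotate.Regular := by
  have h1 := singular_rotate_eq_empty h.2
  refine ⟨fun c' => ?_, h1⟩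
  have c : T.FaceChoice := ⟨∅, empty_subset _⟩
  rw [FaceChoice.eq_of_singular_eq_empty h1 c' c.rotate]
  exact (h.1 c).rotate

namespace Corresponds

variable {T : SquareTiling} {c : T.FaceChoice} {M M' : PlaneGraph} {w : M.Dart → ℝ}
  {w' : M'.Dart → ℝ} (r : Corresponds c M w) (r' : Corresponds c.rotate M' w')

/-- The plane map of the rotated tiling is the dual map. -/
def dualIso (hM : M.IsPlaneMap) (hM' : M'.IsPlaneMap) : M.DualIso M' := by
  let V : M'.V ≃ M.Face := (r'.vert.trans (vFaceRotate c).symm).trans r.face.symm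
  let E : M'.E ≃ M.E := (r'.edge.trans T.rotateEquiv.symm).trans r.edge.symm
  let F : M'.Face ≃ M.V := (r'.face.trans (hFaceRotate c).symm).trans r.vert.symm
  have hV : ∀ f, r'.vert f = vFaceRotate c (r.face (V f)) := fun f => by simp [V]
  have hE : ∀ e, r'.edge e = T.rotateEquiv (r.edge (E e)) := fun e => by simp [E]
  have hF : ∀ v, r'.face v = hFaceRotate c (r.vert (F v)) := fun v => by simp [F]
  have htop : ∀ q, topFace c.rotate (T.rotateEquiv q) = vFaceRotate c (rightFace c q) :=
    fun q => rfl
  have hbottom : ∀ q, bottomFace c.rotate (T.rotateEquiv q) = vFaceRotate c (leftFace c q) :=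
    fun q => rfl
  have hleft : ∀ q, leftFace c.rotate (T.rotateEquiv q) = hFaceRotate c (topFace c q) :=
    fun q => rfl
  have hright : ∀ q, rightFace c.rotate (T.rotateEquiv q) = hFaceRotate c (bottomFace c q) :=
    fun q => rfl
  have hinc : ∀ f e, M'.Inc f e ↔ ∃ v, M.RightOf v (E e) (V f) := by
    intro f e
    simp only [r'.inc, r.right, hV, hE, htop, hbottom, EmbeddingLike.apply_eq_iff_eq]
    constructor
    · rintro (h | h)
      · exact ⟨r.vert.symm (bottomFace c (r.edge (E e))), Or.inr ⟨by simp, h⟩⟩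
      · exact ⟨r.vert.symm (topFace c (r.edge (E e))), Or.inl ⟨by simp, h⟩⟩
    · rintro ⟨v, ⟨-, h⟩ | ⟨-, h⟩⟩
      · exact Or.inr h
      · exact Or.inl h
  have hr : ∀ f e v, M'.RightOf f e v ↔ M.LeftOf (F v) (E e) (V f) := by
    intro f e v
    simp only [r'.right, r.leftOf_iff, hV, hE, hF, htop, hbottom, hleft, hright,
      EmbeddingLike.apply_eq_iff_eq]
    tauto
  have hl : ∀ f e v, M'.LeftOf f e v ↔ M.RightOf (F v) (E e) (V f) := by
    intro f e v
    simp only [r'.leftOf_iff, r.right, hV, hE, hF, htop, hbottom, hleft, hright,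
      EmbeddingLike.apply_eq_iff_eq]
    tauto
  refine ⟨V, E, F, hinc, hr, fun f e e' => ?_⟩
  -- Both cyclic orders are expressed by sides of edges, and rotation interchanges "left" and
  -- "right" in that description.
  rw [r'.nextAt_iff hM']
  constructor
  · rintro ⟨v, h1, h2⟩
    exact ⟨F v, (hl _ _ _).1 h1, (hr _ _ _).1 h2,
      (r.nextAt_iff hM).2 ⟨V f, (hr _ _ _).1 h2, (hl _ _ _).1 h1⟩⟩
  · rintro ⟨v, h1, h2, -⟩
    obtain ⟨v, rfl⟩ := F.surjective v
    exact ⟨v, (hl _ _ _).2 h1, (hr _ _ _).2 h2⟩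

theorem edge_dualIso (hM : M.IsPlaneMap) (hM' : M'.IsPlaneMap) (e : M'.E) :
    (r'.edge e).1 = (r.edge ((r.dualIso r' hM hM').edge e)).1.rotate := by
  have h : r'.edge e = T.rotateEquiv (r.edge ((r.dualIso r' hM hM').edge e)) := by
    simp [dualIso]
  rw [h, rotateEquiv_val]

end Corresponds

/-! ### Collapsing the horizontal faces to points -/

/-- An increasing piecewise linear map of the interval `[a, b]` onto itself. It multiplies the
distance to the midpoint by `t`, except near the ends of the interval. -/
def collapse (a b δ t x : ℝ) : ℝ :=
  max (min ((a + b) / 2 + t * (x - (a + b) / 2)) (a + (b - a) / (2 * δ) * (x - a)))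
    (b - (b - a) / (2 * δ) * (b - x))

section collapse

variable {a b δ t x x' : ℝ}

/-- The steep end pieces rise from an end to the midpoint over a length `δ`, so for `t = 0`
precisely `[a + δ, b - δ]` is flattened. A slope of at least 2 makes the middle branch win
everywhere when `t = 1`. -/
theorem collapse_slope (hδ : 0 < δ) (hab : a + 4 * δ ≤ b) :
    2 ≤ (b - a) / (2 * δ) ∧ (b - a) / (2 * δ) * δ = (b - a) / 2 := by
  constructor
  · rw [le_div_iff₀ (by linarith)]; linarith
  · field_simp

theorem collapse_one (hδ : 0 < δ) (hab : a + 4 * δ ≤ b) (hx : a ≤ x) (hx' : x ≤ b) :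
    collapse a b δ 1 x = x := by
  obtain ⟨h1, h2⟩ := collapse_slope hδ hab
  rw [collapse]
  set K := (b - a) / (2 * δ)
  rw [min_eq_left, max_eq_left] <;> nlinarith

theorem collapse_left (hδ : 0 < δ) (hab : a + 4 * δ ≤ b) (ht' : t ≤ 1) :
    collapse a b δ t a = a := by
  obtain ⟨h1, h2⟩ := collapse_slope hδ hab
  rw [collapse]
  set K := (b - a) / (2 * δ)
  rw [min_eq_right, max_eq_left] <;> nlinarith

theorem collapse_right (hδ : 0 < δ) (hab : a + 4 * δ ≤ b) (ht' : t ≤ 1) :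
    collapse a b δ t b = b := by
  obtain ⟨h1, h2⟩ := collapse_slope hδ hab
  rw [collapse]
  set K := (b - a) / (2 * δ)
  rw [max_eq_right]
  · ring
  · refine (min_le_left _ _).trans ?_
    nlinarith

theorem collapse_mid (hδ : 0 < δ) (hab : a + 4 * δ ≤ b) (ht : 0 ≤ t) (ht' : t ≤ 1)
    (hx : a + δ ≤ x) (hx' : x ≤ b - δ) :
    collapse a b δ t x = (a + b) / 2 + t * (x - (a + b) / 2) := by
  obtain ⟨h1, h2⟩ := collapse_slope hδ hab
  rw [collapse]
  set K := (b - a) / (2 * δ)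
  have h3 : (a + b) / 2 ≤ a + K * (x - a) := by nlinarith
  have h4 : b - K * (b - x) ≤ (a + b) / 2 := by nlinarith
  have h5 : x ≤ a + K * (x - a) := by nlinarith
  have h6 : b - K * (b - x) ≤ x := by nlinarith
  rcases le_total x ((a + b) / 2) with h | h
  · rw [min_eq_left, max_eq_left] <;> nlinarith
  · rw [min_eq_left, max_eq_left] <;> nlinarith

/-- The map `collapse` is strictly increasing, except that for `t = 0` an interval is mapped to the
midpoint. -/
theorem collapse_lt (hδ : 0 < δ) (hab : a + 4 * δ ≤ b) (ht : 0 ≤ t) (h : x < x')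
    (hne : t = 0 → x < a + δ ∨ b - δ < x') :
    collapse a b δ t x < collapse a b δ t x' := by
  obtain ⟨h1, h2⟩ := collapse_slope hδ hab
  rw [collapse, collapse]
  set K := (b - a) / (2 * δ)
  have h3 : a + K * (x - a) < a + K * (x' - a) := by nlinarith
  have h4 : b - K * (b - x) < b - K * (b - x') := by nlinarith
  rcases ht.eq_or_lt with rfl | ht
  · simp only [zero_mul, add_zero]
    rcases hne rfl with h5 | h5
    · have h6 : a + K * (x - a) < (a + b) / 2 := by nlinarith
      exact max_lt_max ((min_le_right _ _).trans_lt (lt_min h6 h3)) h4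
    · have h6 : (a + b) / 2 < b - K * (b - x') := by nlinarith
      exact lt_max_of_lt_right (max_lt ((min_le_left _ _).trans_lt h6) h4)
  · refine max_lt_max (min_lt_min ?_ h3) h4
    nlinarith

theorem collapse_mem_Ioo (hδ : 0 < δ) (hab : a + 4 * δ ≤ b) (ht : 0 ≤ t) (ht' : t ≤ 1)
    (hx : a < x) (hx' : x < b) : a < collapse a b δ t x ∧ collapse a b δ t x < b := by
  constructor
  · have := collapse_lt hδ hab ht hx fun _ => Or.inl (by linarith)
    rwa [collapse_left hδ hab ht'] at this
  · have := collapse_lt hδ hab ht hx' fun _ => Or.inr (by linarith)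
    rwa [collapse_right hδ hab ht'] at this

theorem exists_collapse_eq (hδ : 0 < δ) (hab : a + 4 * δ ≤ b) (ht' : t ≤ 1)
    {z : ℝ} (hz : a < z) (hz' : z < b) : ∃ x, a < x ∧ x < b ∧ collapse a b δ t x = z := by
  have hcont : ContinuousOn (collapse a b δ t) (Icc a b) := by
    unfold collapse
    exact Continuous.continuousOn (by fun_prop)
  have h := intermediate_value_Ioo (show a ≤ b by linarith) hcont
  rw [collapse_left hδ hab ht', collapse_right hδ hab ht'] at h
  obtain ⟨x, hx, rfl⟩ := h ⟨hz, hz'⟩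
  exact ⟨x, hx.1, hx.2, rfl⟩

end collapse

/-! ### Boxes, cores and the squashing map -/

namespace SquareTiling

variable {T : SquareTiling} {c : T.FaceChoice}

/-- An open neighbourhood of a horizontal face without its ends. -/
def HFace.box (h : HFace c) : Set ℂ := {p | (h.lo < p.re ∧ p.re < h.hi) ∧ |p.im - h.y| < h.gap}

/-- The middle part of a horizontal face. -/
def HFace.core (h : HFace c) : Set ℂ :=
  {p | (h.lo + h.gap ≤ p.re ∧ p.re ≤ h.hi - h.gap) ∧ p.im = h.y}

/-- The midpoint of a horizontal face. -/
def HFace.center (h : HFace c) : ℂ := ⟨(h.lo + h.hi) / 2, h.y⟩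

theorem HFace.mem_box {h : HFace c} {p : ℂ} :
    p ∈ h.box ↔ (h.lo < p.re ∧ p.re < h.hi) ∧ |p.im - h.y| < h.gap := Iff.rfl

theorem HFace.mem_core {h : HFace c} {p : ℂ} :
    p ∈ h.core ↔ (h.lo + h.gap ≤ p.re ∧ p.re ≤ h.hi - h.gap) ∧ p.im = h.y := Iff.rfl

theorem EdgeFiniteFor.core_subset_box (hc : EdgeFiniteFor c) (h : HFace c) : h.core ⊆ h.box := by
  intro p hp
  have := hc.gap_pos h
  rw [HFace.mem_core] at hp
  rw [HFace.mem_box, hp.2, sub_self, abs_zero]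
  exact ⟨⟨by linarith [hp.1.1], by linarith [hp.1.2]⟩, this⟩

theorem EdgeFiniteFor.center_mem_core (hc : EdgeFiniteFor c) (h : HFace c) :
    h.center ∈ h.core := by
  have := hc.gap_pos h
  have := hc.lo_add_gap_le h
  refine HFace.mem_core.2 ⟨⟨?_, ?_⟩, rfl⟩ <;> simp only [HFace.center] <;> linarith

/-- The squares that meet the box of a horizontal face. -/
theorem EdgeFiniteFor.face_of_mem_box (hc : EdgeFiniteFor c) {h : HFace c} {p : ℂ}
    (hp : p ∈ h.box) {q : T.squares} (hq : p ∈ q.1.region) :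
    (topFace c q = h ∧ q.1.y1 - h.gap < p.im) ∨ (bottomFace c q = h ∧ p.im < q.1.y0 + h.gap) := by
  obtain ⟨s, t, rfl⟩ := exists_eq_germ hq
  rw [HFace.mem_box, abs_lt] at hp
  -- The projection of `p` to the line of the face. The squares at `p₀` are taller than `h.gap`, so
  -- the germ at `p` is one of them.
  set p₀ : ℂ := ⟨p.re, h.y⟩ with hp₀
  have hx : HalfIn s h.lo h.hi p₀.re := halfIn_of_lt s hp.1.1 hp.1.2
  have h1 := hc.germ_hFace hx rfl
  have h2 := hc.germ_hFace_y hx rfl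
  have b1 := (hc.bounds (Or.inr h1.1)).2.2
  have b2 := (hc.bounds (Or.inl h1.2)).2.2
  have g1 := T.germ_spec p₀ s true
  have g2 := T.germ_spec p₀ s false
  have hg := hc.gap_pos h
  have north : T.germ p s t = T.germ p₀ s true → (bottomFace c (T.germ p s t) = h ∧
      p.im < (T.germ p s t).1.y0 + h.gap) := by
    intro e
    rw [e]
    exact ⟨h1.1, by linarith [h2.1, hp.2.2]⟩
  have south : T.germ p s t = T.germ p₀ s false → (topFace c (T.germ p s t) = h ∧
      (T.germ p s t).1.y1 - h.gap < p.im) := by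
    intro e
    rw [e]
    exact ⟨h1.2, by linarith [h2.2, hp.2.1]⟩
  rcases lt_trichotomy p.im h.y with hlt | heq | hgt
  · refine Or.inl (south (eq_germ (p := p) (q := T.germ p₀ s false)
      ⟨g2.1, halfIn_of_lt t ?_ ?_⟩).symm)
    · linarith [(T.germ p₀ s false).1.y1_eq, h2.2, hp.2.1]
    · linarith [h2.2]
  · have e : p = p₀ := Complex.ext rfl heq
    cases t
    · exact Or.inl (south (by rw [← e]))
    · exact Or.inr (north (by rw [← e]))
  · refine Or.inr (north (eq_germ (p := p) (q := T.germ p₀ s true)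
      ⟨g1.1, halfIn_of_lt t ?_ ?_⟩).symm)
    · linarith [h2.1]
    · linarith [(T.germ p₀ s true).1.y1_eq, h2.1, hp.2.2]

/-- A square at `p` has `p` close to its top or its bottom, within a quarter of its size; the choice
between the two is therefore the same for both faces. -/
theorem EdgeFiniteFor.box_disjoint (hc : EdgeFiniteFor c) {h h' : HFace c} {p : ℂ}
    (hp : p ∈ h.box) (hp' : p ∈ h'.box) : h = h' := by
  have hq := T.germ_region p true true
  set q := T.germ p true true
  have hs := q.1.y1_eq
  have g := hc.gap_pos h
  have g' := hc.gap_pos h'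
  rcases hc.face_of_mem_box hp hq with ⟨h1, h2⟩ | ⟨h1, h2⟩ <;>
    rcases hc.face_of_mem_box hp' hq with ⟨h3, h4⟩ | ⟨h3, h4⟩
  · rw [← h1, ← h3]
  · linarith [(hc.bounds (Or.inl h1)).2.2, (hc.bounds (Or.inr h3)).2.2]
  · linarith [(hc.bounds (Or.inr h1)).2.2, (hc.bounds (Or.inl h3)).2.2]
  · rw [← h1, ← h3]

theorem EdgeFiniteFor.finite_box (hc : EdgeFiniteFor c) {K : Set ℂ} (hK : IsCompact K) :
    {h : HFace c | (h.box ∩ K).Nonempty}.Finite := by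
  have h1 : {q : T.squares | (q.1.region ∩ K).Nonempty}.Finite :=
    Set.Finite.subset ((T.locallyFinite K hK).preimage Subtype.val_injective.injOn)
      fun q hq => ⟨q.2, hq⟩
  refine ((h1.image (topFace c)).union (h1.image (bottomFace c))).subset ?_
  rintro h ⟨p, hp, hpK⟩
  have hq := T.germ_region p true true
  rcases hc.face_of_mem_box hp hq with ⟨h1, -⟩ | ⟨h1, -⟩
  · exact Or.inl ⟨_, ⟨p, hq, hpK⟩, h1⟩
  · exact Or.inr ⟨_, ⟨p, hq, hpK⟩, h1⟩

/-- The horizontal displacement of points near a horizontal face. -/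
def HFace.shift (h : HFace c) (p : ℂ) : ℝ :=
  collapse h.lo h.hi h.gap (min 1 (|p.im - h.y| / h.gap)) (max h.lo (min p.re h.hi)) -
    max h.lo (min p.re h.hi)

theorem HFace.continuous_shift (h : HFace c) : Continuous h.shift := by
  unfold HFace.shift collapse
  fun_prop

/-- At height `gap` the collapse map is the identity, and at all heights it fixes the ends of the
face. Thus the shifts fade out at the boundary of the box and can be added up over all faces. -/
theorem EdgeFiniteFor.shift_eq_zero (hc : EdgeFiniteFor c) {h : HFace c} {p : ℂ}
    (hp : p ∉ h.box) : h.shift p = 0 := by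
  have hg := hc.gap_pos h
  have hl := hc.lo_add_gap_le h
  have ht' : min 1 (|p.im - h.y| / h.gap) ≤ 1 := min_le_left _ _
  rw [HFace.shift]
  by_cases h1 : h.lo < p.re
  · by_cases h2 : p.re < h.hi
    · have h3 : h.gap ≤ |p.im - h.y| := not_lt.1 fun h3 => hp ⟨⟨h1, h2⟩, h3⟩
      rw [min_eq_left ((one_le_div hg).2 h3), collapse_one hg hl, sub_self]
      · exact le_max_left _ _
      · exact max_le (hc.lo_lt_hi h).le (min_le_right _ _)
    · rw [min_eq_right (not_lt.1 h2), max_eq_right (hc.lo_lt_hi h).le,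
        collapse_right hg hl ht', sub_self]
  · rw [max_eq_left ((min_le_left _ _).trans (not_lt.1 h1)), collapse_left hg hl ht', sub_self]

/-- The map of the plane that collapses the middle part of each horizontal face to its midpoint. -/
def squash (c : T.FaceChoice) (p : ℂ) : ℂ := p + ((∑ᶠ h : HFace c, h.shift p : ℝ) : ℂ)

@[simp] theorem squash_im (p : ℂ) : (squash c p).im = p.im := by simp [squash]

theorem EdgeFiniteFor.squash_of_notMem (hc : EdgeFiniteFor c) {p : ℂ}
    (hp : ∀ h : HFace c, p ∉ h.box) : squash c p = p := by
  rw [squash, finsum_congr fun h => hc.shift_eq_zero (hp h), finsum_zero]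
  simp

theorem EdgeFiniteFor.squash_re (hc : EdgeFiniteFor c) {h : HFace c} {p : ℂ} (hp : p ∈ h.box) :
    (squash c p).re = collapse h.lo h.hi h.gap (|p.im - h.y| / h.gap) p.re := by
  have h1 : ∑ᶠ h : HFace c, h.shift p = h.shift p :=
    finsum_eq_single _ h fun h' hne => hc.shift_eq_zero fun hp' => hne (hc.box_disjoint hp' hp)
  rw [squash, h1, add_re, ofReal_re, HFace.shift]
  rw [HFace.mem_box] at hp
  rw [min_eq_left hp.1.2.le, max_eq_right hp.1.1.le, min_eq_right]
  · ring
  · exact ((div_lt_one (hc.gap_pos h)).2 hp.2).le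

theorem EdgeFiniteFor.level_mem (hc : EdgeFiniteFor c) {h : HFace c} {p : ℂ} (hp : p ∈ h.box) :
    0 ≤ |p.im - h.y| / h.gap ∧ |p.im - h.y| / h.gap ≤ 1 := by
  have hg := hc.gap_pos h
  exact ⟨by positivity, ((div_lt_one hg).2 hp.2).le⟩

theorem EdgeFiniteFor.squash_mem_box (hc : EdgeFiniteFor c) {h : HFace c} {p : ℂ}
    (hp : p ∈ h.box) : squash c p ∈ h.box := by
  obtain ⟨ht, ht'⟩ := hc.level_mem hp
  have h1 := collapse_mem_Ioo (hc.gap_pos h) (hc.lo_add_gap_le h) ht ht' hp.1.1 hp.1.2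
  rw [HFace.mem_box, squash_im, hc.squash_re hp]
  exact ⟨h1, hp.2⟩

theorem EdgeFiniteFor.continuous_squash (hc : EdgeFiniteFor c) : Continuous (squash c) := by
  refine continuous_id.add (continuous_ofReal.comp (continuous_finsum
    (fun h => h.continuous_shift) fun p => ⟨Metric.closedBall p 1,
      Metric.closedBall_mem_nhds p one_pos, ?_⟩))
  refine (hc.finite_box (isCompact_closedBall p 1)).subset ?_
  rintro h ⟨z, hz, hz'⟩
  exact ⟨z, by_contra fun hb => hz (hc.shift_eq_zero hb), hz'⟩

/-- Each box is mapped into itself, so a preimage of `K` lies in `K` or in one of the finitely many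
boxes that meet `K`. This properness makes `squash` a closed map. -/
theorem EdgeFiniteFor.isCompact_preimage_squash (hc : EdgeFiniteFor c) {K : Set ℂ}
    (hK : IsCompact K) : IsCompact (squash c ⁻¹' K) := by
  have hsub : squash c ⁻¹' K ⊆ K ∪ ⋃ h ∈ {h : HFace c | (h.box ∩ K).Nonempty},
      Icc h.lo h.hi ×ℂ Icc (h.y - h.gap) (h.y + h.gap) := by
    intro p hp
    by_cases hb : ∃ h : HFace c, p ∈ h.box
    · obtain ⟨h, hb⟩ := hb
      refine Or.inr (mem_biUnion (x := h) ⟨_, hc.squash_mem_box hb, hp⟩ ?_)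
      rw [HFace.mem_box, abs_lt] at hb
      exact ⟨⟨hb.1.1.le, hb.1.2.le⟩, by linarith [hb.2.1], by linarith [hb.2.2]⟩
    · push Not at hb
      refine Or.inl ?_
      rwa [mem_preimage, hc.squash_of_notMem hb] at hp
  refine IsCompact.of_isClosed_subset ?_ (hK.isClosed.preimage hc.continuous_squash) hsub
  exact hK.union ((hc.finite_box hK).isCompact_biUnion fun h _ =>
    isCompact_Icc.reProdIm isCompact_Icc)

theorem EdgeFiniteFor.isClosedMap_squash (hc : EdgeFiniteFor c) : IsClosedMap (squash c) :=
  (isProperMap_iff_isCompact_preimage.2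
    ⟨hc.continuous_squash, fun _ hK => hc.isCompact_preimage_squash hK⟩).isClosedMap

theorem EdgeFiniteFor.squash_surjective (hc : EdgeFiniteFor c) :
    Function.Surjective (squash c) := by
  intro z
  by_cases hb : ∃ h : HFace c, z ∈ h.box
  · obtain ⟨h, hb⟩ := hb
    obtain ⟨x, hx, hx', h1⟩ := exists_collapse_eq (hc.gap_pos h) (hc.lo_add_gap_le h)
      (hc.level_mem hb).2 hb.1.1 hb.1.2
    have h2 : (⟨x, z.im⟩ : ℂ) ∈ h.box := ⟨⟨hx, hx'⟩, hb.2⟩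
    exact ⟨⟨x, z.im⟩, Complex.ext ((hc.squash_re h2).trans h1) (squash_im _)⟩
  · push Not at hb
    exact ⟨z, hc.squash_of_notMem hb⟩

/-- Inside a box this is the monotonicity of `collapse`. Otherwise the order is kept because every
box is preserved and different boxes at the same height occupy non-overlapping intervals. -/
theorem EdgeFiniteFor.squash_lt (hc : EdgeFiniteFor c) {p p' : ℂ} (him : p.im = p'.im)
    (hlt : p.re < p'.re) (hne : ¬ ∃ h : HFace c, p ∈ h.core ∧ p' ∈ h.core) :
    (squash c p).re < (squash c p').re := by
  by_cases hb : ∃ h : HFace c, p ∈ h.box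
  · obtain ⟨h, hb⟩ := hb
    obtain ⟨ht, ht'⟩ := hc.level_mem hb
    have hm := (hc.squash_mem_box hb).1.2
    by_cases hb' : p' ∈ h.box
    · rw [hc.squash_re hb, hc.squash_re hb', ← him]
      refine collapse_lt (hc.gap_pos h) (hc.lo_add_gap_le h) ht hlt fun h0 => ?_
      by_contra! hcon
      rw [div_eq_zero_iff, abs_eq_zero, sub_eq_zero] at h0
      have h0 := h0.resolve_right (hc.gap_pos h).ne'
      exact hne ⟨h, ⟨⟨hcon.1, hlt.le.trans hcon.2⟩, h0⟩,
        ⟨hcon.1.trans hlt.le, hcon.2⟩, him.symm.trans h0⟩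
    · have hge : h.hi ≤ p'.re := not_lt.1 fun h1 =>
        hb' ⟨⟨hb.1.1.trans hlt, h1⟩, by rw [← him]; exact hb.2⟩
      by_cases hb2 : ∃ h' : HFace c, p' ∈ h'.box
      · obtain ⟨h', hb2⟩ := hb2
        have hlo : h.hi ≤ h'.lo := by
          by_contra! hcon
          have hx : max h.lo h'.lo < min h.hi h'.hi := by
            refine max_lt (lt_min (hc.lo_lt_hi h) ?_) (lt_min hcon (hc.lo_lt_hi h'))
            exact (hb.1.1.trans hlt).trans hb2.1.2
          obtain ⟨x, hx1, hx2⟩ := exists_between hx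
          rw [max_lt_iff] at hx1
          rw [lt_min_iff] at hx2
          have e1 : (⟨x, p.im⟩ : ℂ) ∈ h.box := ⟨⟨hx1.1, hx2.1⟩, hb.2⟩
          have e2 : (⟨x, p.im⟩ : ℂ) ∈ h'.box :=
            ⟨⟨hx1.2, hx2.2⟩, by rw [show (⟨x, p.im⟩ : ℂ).im = p'.im from him]; exact hb2.2⟩
          rw [hc.box_disjoint e1 e2] at hb'
          exact hb' hb2
        exact hm.trans (hlo.trans_lt (hc.squash_mem_box hb2).1.1)
      · push Not at hb2
        rw [hc.squash_of_notMem hb2]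
        exact hm.trans_le hge
  · push Not at hb
    rw [hc.squash_of_notMem hb]
    by_cases hb2 : ∃ h' : HFace c, p' ∈ h'.box
    · obtain ⟨h', hb2⟩ := hb2
      have hge : p.re ≤ h'.lo := not_lt.1 fun h1 =>
        hb h' ⟨⟨h1, hlt.trans hb2.1.2⟩, by rw [him]; exact hb2.2⟩
      exact hge.trans_lt (hc.squash_mem_box hb2).1.1
    · push Not at hb2
      rwa [hc.squash_of_notMem hb2]

/-- Heights are preserved, so points with equal images lie on one horizontal line, where `squash_lt`
applies. -/
theorem EdgeFiniteFor.eq_or_core_of_squash_eq (hc : EdgeFiniteFor c) {p p' : ℂ}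
    (h : squash c p = squash c p') : p = p' ∨ ∃ h : HFace c, p ∈ h.core ∧ p' ∈ h.core := by
  by_contra! hcon
  obtain ⟨h1, h2⟩ := hcon
  have him : p.im = p'.im := by rw [← squash_im (c := c) p, h, squash_im]
  rcases lt_trichotomy p.re p'.re with hlt | heq | hgt
  · refine (hc.squash_lt him hlt ?_).ne (by rw [h])
    rintro ⟨h, hp, hp'⟩
    exact h2 h hp hp'
  · exact h1 (Complex.ext heq him)
  · refine (hc.squash_lt him.symm hgt ?_).ne (by rw [h])
    rintro ⟨h, hp', hp⟩
    exact h2 h hp hp'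

theorem EdgeFiniteFor.squash_of_mem_core (hc : EdgeFiniteFor c) {h : HFace c} {p : ℂ}
    (hp : p ∈ h.core) : squash c p = h.center := by
  rw [HFace.mem_core] at hp
  refine Complex.ext ?_ ((squash_im p).trans hp.2)
  rw [hc.squash_re (hc.core_subset_box h hp), hp.2, sub_self, abs_zero, zero_div,
    collapse_mid (hc.gap_pos h) (hc.lo_add_gap_le h) le_rfl zero_le_one hp.1.1 hp.1.2]
  simp [HFace.center]

end SquareTiling

/-! ### The skeleton and the cells of its complement -/

namespace SquareTiling

variable {T : SquareTiling} {c : T.FaceChoice}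

/-- The abscissa of the centre of a square. -/
def _root_.Square.xc (q : Square) : ℝ := q.x0 + q.side / 2

/-- The vertical middle line of a square. -/
def _root_.Square.mid (q : Square) : Set ℂ := {p | p.re = q.xc ∧ q.y0 ≤ p.im ∧ p.im ≤ q.y1}

theorem _root_.Square.mem_mid {q : Square} {p : ℂ} :
    p ∈ q.mid ↔ p.re = q.xc ∧ q.y0 ≤ p.im ∧ p.im ≤ q.y1 := Iff.rfl

theorem _root_.Square.xc_mem (q : Square) : q.x0 < q.xc ∧ q.xc < q.x1 := by
  have := q.side_pos
  rw [q.x1_eq, Square.xc]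
  constructor <;> linarith

theorem _root_.Square.mid_subset_region (q : Square) : q.mid ⊆ q.region := by
  intro p hp
  rw [Square.mem_mid] at hp
  rw [Square.mem_region, hp.1]
  exact ⟨⟨q.xc_mem.1.le, q.xc_mem.2.le⟩, hp.2⟩

/-- The middle parts of the horizontal faces together with the middle lines of the squares. -/
def skeleton (c : T.FaceChoice) : Set ℂ := (⋃ h : HFace c, h.core) ∪ ⋃ q : T.squares, q.1.mid

theorem core_subset_skeleton (h : HFace c) : h.core ⊆ skeleton c :=
  fun _ hp => Or.inl (mem_iUnion.2 ⟨h, hp⟩)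

theorem mid_subset_skeleton (q : T.squares) : q.1.mid ⊆ skeleton c :=
  fun _ hp => Or.inr (mem_iUnion.2 ⟨q, hp⟩)

theorem EdgeFiniteFor.face_of_mem_core (hc : EdgeFiniteFor c) {h : HFace c} {p : ℂ}
    (hp : p ∈ h.core) {q : T.squares} (hq : p ∈ q.1.region) :
    (topFace c q = h ∧ p.im = q.1.y1) ∨ (bottomFace c q = h ∧ p.im = q.1.y0) := by
  rcases hc.face_of_mem_box (hc.core_subset_box h hp) hq with ⟨h1, -⟩ | ⟨h1, -⟩
  · exact Or.inl ⟨h1, by rw [hp.2, ← h1]; rfl⟩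
  · exact Or.inr ⟨h1, by rw [hp.2, ← h1]; rfl⟩

theorem EdgeFiniteFor.mem_core_of_face (hc : EdgeFiniteFor c) {h : HFace c} {q : T.squares}
    (hq : topFace c q = h ∨ bottomFace c q = h) {p : ℂ} (hx : p.re = q.1.xc) (hy : p.im = h.y) :
    p ∈ h.core := by
  have hb := hc.bounds hq
  have hg := hc.gap_pos h
  have hs := q.1.x1_eq
  rw [HFace.mem_core, hx, Square.xc]
  exact ⟨⟨by linarith, by linarith⟩, hy⟩

/-- Apart from its two ends, the middle line is interior to its square; the ends lie in cores. -/
theorem EdgeFiniteFor.mem_core_of_mem_mid (hc : EdgeFiniteFor c) {q q' : T.squares} {p : ℂ}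
    (hp : p ∈ q.1.mid) (hp' : p ∈ q'.1.region) (hne : q ≠ q') :
    p ∈ (topFace c q).core ∨ p ∈ (bottomFace c q).core := by
  have hp1 := Square.mem_mid.1 hp
  rcases hp1.2.2.eq_or_lt with h1 | h1
  · exact Or.inl (hc.mem_core_of_face (Or.inl rfl) hp1.1 h1)
  rcases hp1.2.1.eq_or_lt with h2 | h2
  · exact Or.inr (hc.mem_core_of_face (Or.inr rfl) hp1.1 h2.symm)
  obtain ⟨s, t, rfl⟩ := exists_eq_germ hp'
  refine absurd (eq_germ ⟨halfIn_of_lt s ?_ ?_, halfIn_of_lt t h2 h1⟩) hne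
  · rw [hp1.1]; exact q.1.xc_mem.1
  · rw [hp1.1]; exact q.1.xc_mem.2

theorem EdgeFiniteFor.notMem_skeleton (hc : EdgeFiniteFor c) {q : T.squares} {p : ℂ}
    (hp : p ∈ q.1.region) (hy : q.1.y0 < p.im) (hy' : p.im < q.1.y1) (hx : p.re ≠ q.1.xc) :
    p ∉ skeleton c := by
  have hcore : ∀ h : HFace c, p ∉ h.core := by
    intro h hh
    rcases hc.face_of_mem_core hh hp with ⟨-, h1⟩ | ⟨-, h1⟩
    · exact hy'.ne h1
    · exact hy.ne' h1
  rintro (h1 | h1)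
  · obtain ⟨h, h1⟩ := mem_iUnion.1 h1
    exact hcore h h1
  · obtain ⟨q', h1⟩ := mem_iUnion.1 h1
    by_cases e : q' = q
    · subst e
      exact hx h1.1
    · rcases hc.mem_core_of_mem_mid h1 hp e with h2 | h2
      · exact hcore _ h2
      · exact hcore _ h2

/-- The half of a square next to one of its vertical edges. -/
def halfSquare (a : T.squares × Bool) : Set ℂ :=
  {p ∈ a.1.1.region | cond a.2 (p.re ≤ a.1.1.xc) (a.1.1.xc ≤ p.re)}

theorem isCompact_halfSquare (a : T.squares × Bool) : IsCompact (halfSquare a) := by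
  refine a.1.1.isCompact_region.inter_right (t := {p | cond a.2 (p.re ≤ a.1.1.xc) _}) ?_
  cases a.2
  · exact isClosed_le continuous_const continuous_re
  · exact isClosed_le continuous_re continuous_const

theorem halfSquare_subset (a : T.squares × Bool) : halfSquare a ⊆ a.1.1.region := fun _ h => h.1

theorem vEdge_subset_halfSquare (a : T.squares × Bool) : T.vEdge a ⊆ halfSquare a := by
  intro p hp
  obtain ⟨q, b⟩ := a
  rw [mem_vEdge] at hp
  have hx := q.1.xc_mem
  have hx' := q.1.x0_lt_x1
  cases b
  · have e : p.re = q.1.x1 := hp.1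
    exact ⟨Square.mem_region.2 ⟨⟨hx'.le.trans e.ge, e.le⟩, hp.2⟩, hx.2.le.trans e.ge⟩
  · have e : p.re = q.1.x0 := hp.1
    exact ⟨Square.mem_region.2 ⟨⟨e.ge, e.le.trans hx'.le⟩, hp.2⟩, e.le.trans hx.1.le⟩

theorem exists_mem_halfSquare (p : ℂ) : ∃ a : T.squares × Bool, p ∈ halfSquare a := by
  obtain ⟨q, hq, hp⟩ := T.cover p
  rcases le_total p.re q.xc with h | h
  · exact ⟨(⟨q, hq⟩, true), hp, h⟩
  · exact ⟨(⟨q, hq⟩, false), hp, h⟩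

open Classical in
/-- The vertical face on the side of the germ at `p` of a square on which `p` lies. -/
def sideFace (c : T.FaceChoice) (p : ℂ) (s t : Bool) : VFace c :=
  vFace c (T.germ p s t, decide (p.re < (T.germ p s t).1.xc))

theorem sideFace_eq_left {p : ℂ} {s t : Bool} (h : p.re < (T.germ p s t).1.xc) :
    sideFace c p s t = leftFace c (T.germ p s t) := by
  rw [sideFace, decide_eq_true h]; rfl

theorem sideFace_eq_right {p : ℂ} {s t : Bool} (h : (T.germ p s t).1.xc ≤ p.re) :
    sideFace c p s t = rightFace c (T.germ p s t) := by
  rw [sideFace, decide_eq_false (not_lt.2 h)]; rfl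

theorem sideFace_east_west (p : ℂ) (t : Bool) : sideFace c p true t = sideFace c p false t := by
  by_cases e : T.germ p true t = T.germ p false t
  · rw [sideFace, sideFace, e]
  · have h := germ_east_west e
    rw [sideFace_eq_left, sideFace_eq_right, leftFace_eq_rightFace e]
    · rw [← h.2]; exact (Square.xc_mem _).2.le
    · rw [← h.1]; exact (Square.xc_mem _).1

/-- A point of a horizontal face outside the core is within `gap` of an end of the face. The squares
above and below then both reach this end and share the vertical face there. -/
theorem EdgeFiniteFor.sideFace_north_south (hc : EdgeFiniteFor c) {p : ℂ} (hp : p ∉ skeleton c)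
    (s : Bool) : sideFace c p s true = sideFace c p s false := by
  by_cases e : T.germ p s true = T.germ p s false
  · rw [sideFace, sideFace, e]
  have hf := bottomFace_eq_topFace (c := c) e
  have hns := germ_north_south e
  set h := topFace c (T.germ p s false) with hh
  have hy : p.im = h.y := hns.2.symm
  have hn : topFace c (T.germ p s true) = h ∨ bottomFace c (T.germ p s true) = h := Or.inr hf
  have hs : topFace c (T.germ p s false) = h ∨ bottomFace c (T.germ p s false) = h := Or.inl hh.symm
  have b1 := hc.bounds hn
  have b2 := hc.bounds hs
  have g1 := (T.germ_spec p s true).1.mem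
  have g2 := (T.germ_spec p s false).1.mem
  have hg := hc.gap_pos h
  have w1 := (T.germ p s true).1.x1_eq
  have w2 := (T.germ p s false).1.x1_eq
  have hcore : p.re < h.lo + h.gap ∨ h.hi - h.gap < p.re := by
    by_contra! hcon
    exact hp (core_subset_skeleton h ⟨hcon, hy⟩)
  rcases hcore with hx | hx
  · have e1 := hc.x0_eq_lo hn (g1.1.trans_lt hx)
    have e2 := hc.x0_eq_lo hs (g2.1.trans_lt hx)
    rw [sideFace_eq_left, sideFace_eq_left, hc.leftFace_eq hn hs e1 e2] <;>
      rw [Square.xc] <;> linarith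
  · have e1 := hc.x1_eq_hi hn (hx.trans_le g1.2)
    have e2 := hc.x1_eq_hi hs (hx.trans_le g2.2)
    rw [sideFace_eq_right, sideFace_eq_right, hc.rightFace_eq hn hs e1 e2] <;>
      rw [Square.xc] <;> linarith

theorem EdgeFiniteFor.sideFace_eq (hc : EdgeFiniteFor c) {p : ℂ} (hp : p ∉ skeleton c)
    (s t : Bool) : sideFace c p s t = sideFace c p true true := by
  cases s <;> cases t
  · rw [← sideFace_east_west, ← hc.sideFace_north_south hp]
  · rw [← sideFace_east_west]
  · rw [← hc.sideFace_north_south hp]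
  · rfl

/-- All halves of squares that contain a point outside the skeleton lie at the same vertical face;
this makes the cells disjoint. -/
theorem EdgeFiniteFor.vFace_eq_sideFace (hc : EdgeFiniteFor c) {p : ℂ} (hp : p ∉ skeleton c)
    {a : T.squares × Bool} (ha : p ∈ halfSquare a) : vFace c a = sideFace c p true true := by
  obtain ⟨q, b⟩ := a
  obtain ⟨s, t, rfl⟩ := exists_eq_germ ha.1
  rw [← hc.sideFace_eq hp s t]
  have hne : p.re ≠ (T.germ p s t).1.xc := fun h =>
    hp (mid_subset_skeleton _ ⟨h, (Square.mem_region.1 ha.1).2⟩)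
  cases b
  · exact (sideFace_eq_right ha.2).symm
  · exact (sideFace_eq_left (lt_of_le_of_ne ha.2 hne)).symm

theorem EdgeFiniteFor.vFace_eq_of_mem (hc : EdgeFiniteFor c) {p : ℂ} (hp : p ∉ skeleton c)
    {a b : T.squares × Bool} (ha : p ∈ halfSquare a) (hb : p ∈ halfSquare b) :
    vFace c a = vFace c b :=
  (hc.vFace_eq_sideFace hp ha).trans (hc.vFace_eq_sideFace hp hb).symm

/-- An inner point of a half of a square. -/
def halfCenter (a : T.squares × Bool) : ℂ :=
  ⟨cond a.2 ((a.1.1.x0 + a.1.1.xc) / 2) ((a.1.1.xc + a.1.1.x1) / 2), (a.1.1.y0 + a.1.1.y1) / 2⟩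

/-- The set is star-shaped about `halfCenter a`: on a segment from there to `p` all points except
possibly `p` are in the open half, which the skeleton does not meet. -/
theorem EdgeFiniteFor.isPreconnected_halfSquare (hc : EdgeFiniteFor c) (a : T.squares × Bool) :
    IsPreconnected (halfSquare a \ skeleton c) := by
  refine isPreconnected_of_forall (halfCenter a) fun p hp => ?_
  refine ⟨segment ℝ (halfCenter a) p, ?_, left_mem_segment ℝ _ _, right_mem_segment ℝ _ _,
    (convex_segment _ _).isPreconnected⟩
  rintro z ⟨u, v, hu, hv, huv, rfl⟩
  rcases hu.eq_or_lt with rfl | hu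
  · have : v = 1 := by linarith
    subst this
    simpa using hp
  obtain ⟨q, b⟩ := a
  have h1 := Square.mem_region.1 hp.1.1
  have hx := q.1.xc_mem
  have hy := q.1.y0_lt_y1
  have hv' : v = 1 - u := by linarith
  set m := halfCenter (q, b) with hm
  have him : m.im = (q.1.y0 + q.1.y1) / 2 := rfl
  have hmean : ∀ l r x : ℝ, l < r → l ≤ x → x ≤ r →
      l < u * ((l + r) / 2) + v * x ∧ u * ((l + r) / 2) + v * x < r := by
    intro l r x hlr hl hr
    rw [hv'] at hv ⊢
    have k := mul_pos hu (sub_pos.2 hlr)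
    constructor
    · linarith [mul_nonneg hv (sub_nonneg.2 hl)]
    · linarith [mul_nonneg hv (sub_nonneg.2 hr)]
  have key : ∀ l r : ℝ, l < r → m.re = (l + r) / 2 → l ≤ p.re → p.re ≤ r →
      l < u * m.re + v * p.re ∧ u * m.re + v * p.re < r := by
    intro l r hlr hme hl hr
    rw [hme]
    exact hmean l r p.re hlr hl hr
  have hre : (u • m + v • p).re = u * m.re + v * p.re := by simp
  have him' : (u • m + v • p).im = u * m.im + v * p.im := by simp
  have hY : q.1.y0 < u * m.im + v * p.im ∧ u * m.im + v * p.im < q.1.y1 := by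
    rw [him]
    exact hmean _ _ _ hy h1.2.1 h1.2.2
  have hmem : u • m + v • p ∈ halfSquare (q, b) ∧ (u • m + v • p).re ≠ q.1.xc := by
    cases b
    · have k := key q.1.xc q.1.x1 hx.2 rfl hp.1.2 h1.1.2
      rw [← hre] at k
      rw [← him'] at hY
      exact ⟨⟨Square.mem_region.2 ⟨⟨(hx.1.trans k.1).le, k.2.le⟩, hY.1.le, hY.2.le⟩, k.1.le⟩,
        k.1.ne'⟩
    · have k := key q.1.x0 q.1.xc hx.1 rfl h1.1.1 hp.1.2
      rw [← hre] at k
      rw [← him'] at hY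
      exact ⟨⟨Square.mem_region.2 ⟨⟨k.1.le, (k.2.trans hx.2).le⟩, hY.1.le, hY.2.le⟩, k.2.le⟩,
        k.2.ne⟩
  rw [← him'] at hY
  exact ⟨hmem.1, hc.notMem_skeleton hmem.1.1 hY.1 hY.2 hmem.2⟩

theorem EdgeFiniteFor.vEdge_notMem_skeleton (hc : EdgeFiniteFor c) {a : T.squares × Bool} {p : ℂ}
    (hp : p ∈ T.vEdge a) (hy : a.1.1.y0 < p.im) (hy' : p.im < a.1.1.y1) : p ∉ skeleton c := by
  refine hc.notMem_skeleton (vEdge_subset_halfSquare a hp).1 hy hy' fun h => ?_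
  have hx := a.1.1.xc_mem
  have h1 := (mem_vEdge.1 hp).1
  rw [h, vx] at h1
  cases h2 : a.2 <;> rw [h2] at h1
  · exact hx.2.ne h1
  · exact hx.1.ne' h1

/-- The halves of squares at linked vertical edges are connected outside the skeleton. -/
theorem EdgeFiniteFor.exists_mem_of_vLink (hc : EdgeFiniteFor c) {a b : T.squares × Bool}
    (hab : VLink c a b) : ∃ p, p ∈ T.vEdge a ∧ p ∈ T.vEdge b ∧ p ∉ skeleton c := by
  obtain ⟨p, ⟨hpa, hpb⟩, hph⟩ := hab
  by_cases hps : p ∉ skeleton c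
  · exact ⟨p, hpa, hpb, hps⟩
  rw [not_not] at hps
  have hpa' := (vEdge_subset_halfSquare a hpa).1
  have hpb' := (vEdge_subset_halfSquare b hpb).1
  have hcore : ∃ h : HFace c, p ∈ h.core := by
    rcases hps with h1 | h1
    · exact mem_iUnion.1 h1
    · obtain ⟨q, h1⟩ := mem_iUnion.1 h1
      have hne : q ≠ a.1 := by
        rintro rfl
        have hx := a.1.1.xc_mem
        have h2 := (mem_vEdge.1 hpa).1
        rw [h1.1, vx] at h2
        cases h3 : a.2 <;> rw [h3] at h2
        · exact hx.2.ne h2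
        · exact hx.1.ne' h2
      rcases hc.mem_core_of_mem_mid (c := c) h1 hpa' hne with h2 | h2
      · exact ⟨_, h2⟩
      · exact ⟨_, h2⟩
  obtain ⟨h, hh⟩ := hcore
  have hbox := hc.core_subset_box h hh
  have hy : p.im = h.y := hh.2
  have hhalf : ∀ s, HalfIn s h.lo h.hi p.re := fun s => halfIn_of_lt s hbox.1.1 hbox.1.2
  have hY := fun s => hc.germ_hFace_y (hhalf s) hy
  have hF := fun s => hc.germ_hFace (hhalf s) hy
  have hNS := fun s => hc.germ_north_ne_south (hhalf s) hy
  -- With four squares at `p`, the horizontal direction would be broken there, as `p ∉ c.horiz`. But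
  -- `p` is in the core, where the face runs on; so a single square lies at `p` on the north or on
  -- the south side.
  have hcases : T.germ p true true = T.germ p false true ∨
      T.germ p true false = T.germ p false false := by
    by_contra! hcon
    have hs := mem_singular_of_ne hcon.1 hcon.2 (hNS true) (hNS false)
    have h1 := hFace_broken ⟨hs, hph⟩ (a := (T.germ p false true, false))
      (b := (T.germ p true true, false)) ((hF false).1.trans (hF true).1.symm)
      ((hY false).1.trans hy.symm) (germ_east_west hcon.1).2.le
    exact absurd (T.germ_spec p true true).1.2 (not_lt.2 h1)
  have hvx : ∀ a : T.squares × Bool, p ∈ T.vEdge a → p.re = a.1.1.x0 ∨ p.re = a.1.1.x1 := by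
    intro a ha
    have h1 := (mem_vEdge.1 ha).1
    rw [vx] at h1
    cases h2 : a.2 <;> rw [h2] at h1
    · exact Or.inr h1
    · exact Or.inl h1
  -- A vertical edge through `p` cannot belong to the square spanning side `t`, so its square is on
  -- the side `!t`. Both edges thus run along the same line to the same side, and a common point
  -- near `p` avoids the skeleton.
  have hstraight : ∀ t, T.germ p true t = T.germ p false t → ∀ a : T.squares × Bool,
      p ∈ T.vEdge a → ∃ s, a.1 = T.germ p s (!t) := by
    intro t e a ha
    obtain ⟨s, t', h1⟩ := exists_eq_germ (vEdge_subset_halfSquare a ha).1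
    by_cases ht : t' = t
    · subst ht
      have h2 : a.1 = T.germ p true t' := by
        cases s
        · rw [e]; exact h1
        · exact h1
      have k1 := (T.germ_spec p true t').1.2
      have k2 := (T.germ_spec p false t').1.1
      rw [← e] at k2
      rw [← h2] at k1 k2
      rcases hvx a ha with h3 | h3 <;> linarith
    · refine ⟨s, ?_⟩
      rw [h1]
      congr 1
      cases t <;> cases t' <;> simp_all
  have hpoint : ∀ y : ℝ, (a.1.1.y0 < y ∧ y < a.1.1.y1) → (b.1.1.y0 < y ∧ y < b.1.1.y1) →
      ∃ p, p ∈ T.vEdge a ∧ p ∈ T.vEdge b ∧ p ∉ skeleton c := by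
    intro y ha hb
    have m1 : (⟨p.re, y⟩ : ℂ) ∈ T.vEdge a :=
      mem_vEdge.2 ⟨(mem_vEdge.1 hpa).1, ha.1.le, ha.2.le⟩
    have m2 : (⟨p.re, y⟩ : ℂ) ∈ T.vEdge b :=
      mem_vEdge.2 ⟨(mem_vEdge.1 hpb).1, hb.1.le, hb.2.le⟩
    exact ⟨_, m1, m2, hc.vEdge_notMem_skeleton m1 ha.1 ha.2⟩
  rcases hcases with e | e
  · obtain ⟨s, hs⟩ := hstraight true e a hpa
    obtain ⟨s', hs'⟩ := hstraight true e b hpb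
    have k1 := (hY s).2
    have k2 := (hY s').2
    rw [Bool.not_true] at hs hs'
    rw [← hs] at k1
    rw [← hs'] at k2
    obtain ⟨y, hy1, hy2⟩ := exists_between (max_lt (a.1.1.y0_lt_y1.trans_le k1.le)
      (b.1.1.y0_lt_y1.trans_le k2.le))
    rw [max_lt_iff] at hy1
    exact hpoint y ⟨hy1.1, hy2.trans_le k1.ge⟩ ⟨hy1.2, hy2.trans_le k2.ge⟩
  · obtain ⟨s, hs⟩ := hstraight false e a hpa
    obtain ⟨s', hs'⟩ := hstraight false e b hpb
    have k1 := (hY s).1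
    have k2 := (hY s').1
    rw [Bool.not_false] at hs hs'
    rw [← hs] at k1
    rw [← hs'] at k2
    obtain ⟨y, hy1, hy2⟩ := exists_between (lt_min (k1.ge.trans_lt a.1.1.y0_lt_y1)
      (k2.ge.trans_lt b.1.1.y0_lt_y1))
    rw [lt_min_iff] at hy2
    exact hpoint y ⟨k1.le.trans_lt hy1, hy2.1⟩ ⟨k2.le.trans_lt hy1, hy2.2⟩

/-- The part of the complement of the skeleton that belongs to a vertical face. -/
def VFace.cell (f : VFace c) : Set ℂ :=
  {p | p ∉ skeleton c ∧ ∃ a, vFace c a = f ∧ p ∈ halfSquare a}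

theorem exists_mem_cell {p : ℂ} (hp : p ∉ skeleton c) : ∃ f : VFace c, p ∈ f.cell := by
  obtain ⟨a, ha⟩ := exists_mem_halfSquare (T := T) p
  exact ⟨vFace c a, hp, a, rfl, ha⟩

theorem EdgeFiniteFor.cell_disjoint (hc : EdgeFiniteFor c) {f f' : VFace c} {p : ℂ}
    (h : p ∈ f.cell) (h' : p ∈ f'.cell) : f = f' := by
  obtain ⟨h1, a, rfl, ha⟩ := h
  obtain ⟨-, b, rfl, hb⟩ := h'
  exact hc.vFace_eq_of_mem h1 ha hb

theorem EdgeFiniteFor.cell_nonempty (hc : EdgeFiniteFor c) (f : VFace c) : f.cell.Nonempty := by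
  obtain ⟨a, rfl⟩ := exists_vFace f
  have hy := a.1.1.y0_lt_y1
  have hm : (⟨vx a, (a.1.1.y0 + a.1.1.y1) / 2⟩ : ℂ) ∈ T.vEdge a :=
    mem_vEdge.2 ⟨rfl, by simp only; linarith, by simp only; linarith⟩
  exact ⟨_, hc.vEdge_notMem_skeleton hm (by simp only; linarith) (by simp only; linarith), a, rfl,
    vEdge_subset_halfSquare a hm⟩

/-- Halves at linked edges share a point outside the skeleton, so being contained in a fixed
component of the cell passes from a half to all others of the same vertical face. -/
theorem EdgeFiniteFor.isPreconnected_cell (hc : EdgeFiniteFor c) (f : VFace c) :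
    IsPreconnected f.cell := by
  obtain ⟨z, hz⟩ := hc.cell_nonempty f
  have hsub : ∀ a, vFace c a = f → halfSquare a \ skeleton c ⊆ f.cell :=
    fun a ha p hp => ⟨hp.2, a, ha, hp.1⟩
  have hcomp : ∀ a p, vFace c a = f → p ∈ halfSquare a \ skeleton c →
      p ∈ connectedComponentIn f.cell z →
      halfSquare a \ skeleton c ⊆ connectedComponentIn f.cell z := by
    intro a p ha hp hpz
    rw [connectedComponentIn_eq hpz]
    exact (hc.isPreconnected_halfSquare a).subset_connectedComponentIn hp (hsub a ha)
  have key : ∀ a b, VLink c a b →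
      (vFace c a = f ∧ halfSquare a \ skeleton c ⊆ connectedComponentIn f.cell z) →
      (vFace c b = f ∧ halfSquare b \ skeleton c ⊆ connectedComponentIn f.cell z) := by
    rintro a b hab ⟨h1, h2⟩
    have h3 : vFace c b = f := (Quot.sound hab : vFace c a = vFace c b).symm.trans h1
    obtain ⟨p, h4, h5, h6⟩ := hc.exists_mem_of_vLink hab
    exact ⟨h3, hcomp b p h3 ⟨vEdge_subset_halfSquare b h5, h6⟩
      (h2 ⟨vEdge_subset_halfSquare a h4, h6⟩)⟩
  have symm : ∀ a b, VLink c a b → VLink c b a := fun a b ⟨z, hz, hz'⟩ => ⟨z, hz.symm, hz'⟩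
  obtain ⟨a, ha, hza⟩ := hz.2
  have hall : f.cell ⊆ connectedComponentIn f.cell z := by
    rintro p ⟨hp, b, hb, hpb⟩
    have := congrArg (Quot.lift (fun a => vFace c a = f ∧
      halfSquare a \ skeleton c ⊆ connectedComponentIn f.cell z)
      fun a b h => propext ⟨key a b h, key b a (symm a b h)⟩) (ha.trans hb.symm)
    exact ((iff_of_eq this).1 ⟨ha, hcomp a z ha ⟨hza, hz.1⟩ (mem_connectedComponentIn hz)⟩).2
      ⟨hpb, hp⟩
  rw [(connectedComponentIn_subset _ _).antisymm' hall]
  exact isPreconnected_connectedComponentIn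

theorem HFace.isClosed_core (h : HFace c) : IsClosed h.core :=
  ((isClosed_Icc.preimage continuous_re).inter (isClosed_singleton.preimage continuous_im) :
    IsClosed (re ⁻¹' Icc (h.lo + h.gap) (h.hi - h.gap) ∩ im ⁻¹' {h.y}))

theorem _root_.Square.isClosed_mid (q : Square) : IsClosed q.mid :=
  ((isClosed_singleton.preimage continuous_re).inter (isClosed_Icc.preimage continuous_im) :
    IsClosed (re ⁻¹' {q.xc} ∩ im ⁻¹' Icc q.y0 q.y1))

theorem EdgeFiniteFor.isClosed_skeleton (hc : EdgeFiniteFor c) : IsClosed (skeleton c) := by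
  refine IsClosed.union ?_ ?_
  · refine LocallyFinite.isClosed_iUnion (fun p => ⟨Metric.closedBall p 1,
      Metric.closedBall_mem_nhds p one_pos, ?_⟩) fun h => h.isClosed_core
    refine (hc.finite_box (isCompact_closedBall p 1)).subset ?_
    rintro h ⟨z, hz, hz'⟩
    exact ⟨z, hc.core_subset_box h hz, hz'⟩
  · refine T.isClosed_iUnion_of_subset_region id (fun q => ?_) _ (fun q => q.1.mid_subset_region)
      fun q => q.1.isClosed_mid
    exact (Set.finite_singleton q)

/-- Its complement consists of the skeleton and the halves at other vertical faces, a closed set by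
local finiteness. -/
theorem EdgeFiniteFor.isOpen_cell (hc : EdgeFiniteFor c) (f : VFace c) : IsOpen f.cell := by
  have h1 : f.cellᶜ = skeleton c ∪ ⋃ a : {a : T.squares × Bool // vFace c a ≠ f},
      halfSquare a.1 := by
    ext p
    constructor
    · intro hp
      by_cases hs : p ∈ skeleton c
      · exact Or.inl hs
      · obtain ⟨a, ha⟩ := exists_mem_halfSquare (T := T) p
        exact Or.inr (mem_iUnion.2 ⟨⟨a, fun h => hp ⟨hs, a, h, ha⟩⟩, ha⟩)
    · rintro (hs | hs) ⟨hp, a, ha, hpa⟩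
      · exact hp hs
      · obtain ⟨⟨b, hb⟩, hpb⟩ := mem_iUnion.1 hs
        exact hb ((hc.vFace_eq_of_mem hp hpb hpa).trans ha)
  rw [← isClosed_compl_iff, h1]
  refine hc.isClosed_skeleton.union (T.isClosed_iUnion_of_subset_region (fun a => a.1.1) ?_ _
    (fun a => halfSquare_subset a.1) fun a => (isCompact_halfSquare a.1).isClosed)
  intro q
  refine Set.Finite.of_injOn (f := fun a => a.1.2) (t := Set.univ) (fun _ _ => mem_univ _) ?_
    Set.finite_univ
  rintro ⟨a, _⟩ ha ⟨b, _⟩ hb hab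
  exact Subtype.ext (Prod.ext (ha.trans hb.symm) hab)

theorem EdgeFiniteFor.squash_mem_image_skeleton (hc : EdgeFiniteFor c) {p : ℂ} :
    squash c p ∈ squash c '' skeleton c ↔ p ∈ skeleton c := by
  refine ⟨?_, fun h => mem_image_of_mem _ h⟩
  rintro ⟨p', hp', h⟩
  rcases hc.eq_or_core_of_squash_eq h with rfl | ⟨h, -, h2⟩
  · exact hp'
  · exact core_subset_skeleton h h2

theorem EdgeFiniteFor.squash_injOn (hc : EdgeFiniteFor c) {p p' : ℂ} (hp : p ∉ skeleton c)
    (h : squash c p = squash c p') : p = p' := by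
  rcases hc.eq_or_core_of_squash_eq h with h | ⟨h, h1, -⟩
  · exact h
  · exact absurd (core_subset_skeleton h h1) hp

/-- No point outside the cell has the same image as a point of it, so the complement of the image is
the image of the complement, closed because `squash` is a closed map. -/
theorem EdgeFiniteFor.isOpen_image_cell (hc : EdgeFiniteFor c) (f : VFace c) :
    IsOpen (squash c '' f.cell) := by
  have h1 : (squash c '' f.cell)ᶜ = squash c '' f.cellᶜ := by
    ext z
    obtain ⟨p, rfl⟩ := hc.squash_surjective z
    constructor
    · exact fun h => ⟨p, fun hp => h ⟨p, hp, rfl⟩, rfl⟩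
    · rintro ⟨p1, h1, e1⟩ ⟨p2, h2, e2⟩
      rw [hc.squash_injOn h2.1 (e2.trans e1.symm)] at h2
      exact h1 h2
  rw [← isClosed_compl_iff, h1]
  exact hc.isClosedMap_squash _ (hc.isOpen_cell f).isClosed_compl

theorem EdgeFiniteFor.image_cell_disjoint (hc : EdgeFiniteFor c) {f f' : VFace c} {z : ℂ}
    (h : z ∈ squash c '' f.cell) (h' : z ∈ squash c '' f'.cell) : f = f' := by
  obtain ⟨p, hp, rfl⟩ := h
  obtain ⟨p', hp', e⟩ := h'
  rw [hc.squash_injOn hp'.1 e] at hp'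
  exact hc.cell_disjoint hp hp'

/-- The images of the cells are the components of the complement of the image of the skeleton. -/
theorem EdgeFiniteFor.connectedComponentIn_eq (hc : EdgeFiniteFor c) {f : VFace c} {z : ℂ}
    (hz : z ∈ squash c '' f.cell) :
    connectedComponentIn (squash c '' skeleton c)ᶜ z = squash c '' f.cell := by
  have hsub : squash c '' f.cell ⊆ (squash c '' skeleton c)ᶜ := by
    rintro _ ⟨p, hp, rfl⟩ h
    exact hp.1 (hc.squash_mem_image_skeleton.1 h)
  refine Subset.antisymm ?_ ?_
  · refine isPreconnected_connectedComponentIn.subset_left_of_subset_union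
      (v := ⋃ f' : {f' : VFace c // f' ≠ f}, squash c '' f'.1.cell) (hc.isOpen_image_cell f)
      (isOpen_iUnion fun f' => hc.isOpen_image_cell f'.1) ?_ ?_
      ⟨z, mem_connectedComponentIn (hsub hz), hz⟩
    · refine Set.disjoint_left.2 fun x hx hx' => ?_
      obtain ⟨f', hx'⟩ := mem_iUnion.1 hx'
      exact f'.2 (hc.image_cell_disjoint hx' hx)
    · intro x hx
      have hx := connectedComponentIn_subset _ _ hx
      obtain ⟨p, rfl⟩ := hc.squash_surjective x
      obtain ⟨f', hf'⟩ := exists_mem_cell (c := c) fun h => hx (mem_image_of_mem _ h)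
      by_cases e : f' = f
      · subst e
        exact Or.inl (mem_image_of_mem _ hf')
      · exact Or.inr (mem_iUnion.2 ⟨⟨f', e⟩, mem_image_of_mem _ hf'⟩)
  · exact ((hc.isPreconnected_cell f).image _ hc.continuous_squash.continuousOn)
      |>.subset_connectedComponentIn hz hsub

end SquareTiling

/-! ### Drawing the plane map -/

theorem mem_segment_iff_of_im_lt {a b z : ℂ} (h : b.im < a.im) : z ∈ segment ℝ a b ↔
    (b.im ≤ z.im ∧ z.im ≤ a.im) ∧
      z.re = a.re + (a.im - z.im) / (a.im - b.im) * (b.re - a.re) := by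
  have hd : 0 < a.im - b.im := sub_pos.2 h
  have him : ∀ θ : ℝ, (a + θ • (b - a)).im = a.im + θ * (b.im - a.im) := fun θ => by simp
  have hre : ∀ θ : ℝ, (a + θ • (b - a)).re = a.re + θ * (b.re - a.re) := fun θ => by simp
  rw [segment_eq_image']
  constructor
  · rintro ⟨θ, ⟨h0, h1⟩, rfl⟩
    rw [him, hre]
    refine ⟨⟨by nlinarith, by nlinarith⟩, ?_⟩
    have : (a.im - (a.im + θ * (b.im - a.im))) / (a.im - b.im) = θ := by
      field_simp
      ring
    rw [this]
  · rintro ⟨⟨h0, h1⟩, h2⟩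
    refine ⟨(a.im - z.im) / (a.im - b.im), ⟨?_, ?_⟩, ?_⟩
    · exact div_nonneg (by linarith) hd.le
    · rw [div_le_one hd]; linarith
    · refine Complex.ext ?_ ?_
      · simp only [hre, h2]
      · simp only [him]
        field_simp
        ring

/-- Heights strictly decrease along the arc, so successive pieces occupy consecutive ranges of
heights. -/
theorem isPolyArc_of_im_lt {a b c d : ℂ} (h₁ : b.im < a.im) (h₂ : c.im < b.im)
    (h₃ : d.im < c.im) : IsPolyArc [a, b, c, d] := by
  have hne : ∀ {x y : ℂ}, y.im < x.im → x ≠ y := fun h e => by rw [e] at h; exact lt_irrefl _ h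
  have hseg : ∀ {x y z : ℂ}, y.im < x.im → z ∈ segment ℝ x y → z.im ≤ y.im → z = y := by
    intro x y z hxy hz hzy
    have h := (mem_segment_iff_of_im_lt hxy).1 hz
    have e : z.im = y.im := le_antisymm hzy h.1.1
    refine Complex.ext ?_ e
    rw [h.2, e, div_self (sub_pos.2 hxy).ne']
    ring
  refine ⟨hne h₁, ?_, hne h₂, ?_, hne h₃⟩
  · refine Subset.antisymm ?_ (singleton_subset_iff.2 ⟨right_mem_segment ℝ _ _,
      mem_polyLine_of_mem (by simp) (by simp)⟩)
    rintro z ⟨hz, hz'⟩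
    refine hseg h₁ hz ?_
    rw [polyLine_cons_cons, polyLine_cons_cons, polyLine_singleton, union_empty] at hz'
    rcases hz' with hz' | hz'
    · exact ((mem_segment_iff_of_im_lt h₂).1 hz').1.2
    · exact ((mem_segment_iff_of_im_lt h₃).1 hz').1.2.trans h₂.le
  · refine Subset.antisymm ?_ (singleton_subset_iff.2 ⟨right_mem_segment ℝ _ _,
      mem_polyLine_of_mem (by simp) (by simp)⟩)
    rintro z ⟨hz, hz'⟩
    refine hseg h₂ hz ?_
    rw [polyLine_cons_cons, polyLine_singleton, union_empty] at hz'
    exact ((mem_segment_iff_of_im_lt h₃).1 hz').1.2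

theorem pair_infix_four {p q a b c d : ℂ} : [p, q] <:+: [a, b, c, d] ↔
    (p = a ∧ q = b) ∨ (p = b ∧ q = c) ∨ (p = c ∧ q = d) := by
  simp [List.infix_cons_iff, List.cons_prefix_cons]

namespace SquareTiling

variable {T : SquareTiling} {c : T.FaceChoice}

/-- The nodes of the edge of the plane map that belongs to a square. -/
def drawPath (c : T.FaceChoice) (q : T.squares) : List ℂ :=
  [(topFace c q).center, ⟨q.1.xc, q.1.y1 - (topFace c q).gap⟩,
    ⟨q.1.xc, q.1.y0 + (bottomFace c q).gap⟩, (bottomFace c q).center]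

theorem EdgeFiniteFor.heights (hc : EdgeFiniteFor c) (q : T.squares) :
    q.1.y1 - (topFace c q).gap < q.1.y1 ∧
    q.1.y0 + (bottomFace c q).gap < q.1.y1 - (topFace c q).gap ∧
    q.1.y0 < q.1.y0 + (bottomFace c q).gap := by
  have h1 := hc.gap_pos (topFace c q)
  have h2 := hc.gap_pos (bottomFace c q)
  have h3 := (hc.bounds (q := q) (Or.inl rfl : topFace c q = topFace c q ∨ _)).2.2
  have h4 := (hc.bounds (q := q) (Or.inr rfl : _ ∨ bottomFace c q = bottomFace c q)).2.2
  have h5 := q.1.y1_eq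
  refine ⟨?_, ?_, ?_⟩ <;> linarith

/-- The image of the middle line of a square. -/
def curve (c : T.FaceChoice) (q : T.squares) (y : ℝ) : ℝ := (squash c ⟨q.1.xc, y⟩).re

theorem EdgeFiniteFor.squash_mid_middle (hc : EdgeFiniteFor c) {q : T.squares} {x y : ℝ}
    (hx : q.1.x0 ≤ x ∧ x ≤ q.1.x1)
    (h₁ : q.1.y0 + (bottomFace c q).gap ≤ y) (h₂ : y ≤ q.1.y1 - (topFace c q).gap) :
    squash c ⟨x, y⟩ = ⟨x, y⟩ := by
  refine hc.squash_of_notMem fun h hb => ?_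
  have hh := hc.heights q
  have hq : (⟨x, y⟩ : ℂ) ∈ q.1.region :=
    Square.mem_region.2 ⟨hx, hh.2.2.le.trans h₁, h₂.trans hh.1.le⟩
  rcases hc.face_of_mem_box hb hq with ⟨rfl, h3⟩ | ⟨rfl, h3⟩
  · exact absurd h3 (not_lt.2 h₂)
  · exact absurd h3 (not_lt.2 h₁)

theorem EdgeFiniteFor.curve_middle (hc : EdgeFiniteFor c) {q : T.squares} {y : ℝ}
    (h₁ : q.1.y0 + (bottomFace c q).gap ≤ y) (h₂ : y ≤ q.1.y1 - (topFace c q).gap) :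
    curve c q y = q.1.xc := by
  rw [curve, hc.squash_mid_middle ⟨q.1.xc_mem.1.le, q.1.xc_mem.2.le⟩ h₁ h₂]

/-- The middle line meets the box within the region where `collapse` scales distances to the
midpoint by `t`. As `t` is proportional to the height above or below the face, the image is straight
on either side. -/
theorem EdgeFiniteFor.curve_near (hc : EdgeFiniteFor c) {h : HFace c} {q : T.squares} {y : ℝ}
    (hq : topFace c q = h ∨ bottomFace c q = h) (hy : |y - h.y| < h.gap) :
    curve c q y = h.center.re + |y - h.y| / h.gap * (q.1.xc - h.center.re) := by
  have hcore := hc.mem_core_of_face (p := ⟨q.1.xc, h.y⟩) hq rfl rfl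
  have hbox : (⟨q.1.xc, y⟩ : ℂ) ∈ h.box := ⟨(hc.core_subset_box h hcore).1, hy⟩
  obtain ⟨ht, ht'⟩ := hc.level_mem hbox
  rw [curve, hc.squash_re hbox, collapse_mid (hc.gap_pos h) (hc.lo_add_gap_le h) ht ht'
    hcore.1.1 hcore.1.2]
  rfl

theorem EdgeFiniteFor.curve_upper (hc : EdgeFiniteFor c) {q : T.squares} {y : ℝ}
    (h₁ : q.1.y1 - (topFace c q).gap ≤ y) (h₂ : y ≤ q.1.y1) : curve c q y =
      (topFace c q).center.re +
        (q.1.y1 - y) / (topFace c q).gap * (q.1.xc - (topFace c q).center.re) := by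
  have hg := hc.gap_pos (topFace c q)
  rcases h₁.eq_or_lt with rfl | h₁
  · rw [hc.curve_middle (hc.heights q).2.1.le le_rfl, sub_sub_cancel, div_self hg.ne']
    ring
  · have e : |y - (topFace c q).y| = q.1.y1 - y := by
      rw [y_topFace, abs_sub_comm, abs_of_nonneg (by linarith)]
    rw [hc.curve_near (Or.inl rfl : topFace c q = topFace c q ∨ _), e]
    rw [e]
    linarith

theorem EdgeFiniteFor.curve_lower (hc : EdgeFiniteFor c) {q : T.squares} {y : ℝ}
    (h₁ : q.1.y0 ≤ y) (h₂ : y ≤ q.1.y0 + (bottomFace c q).gap) : curve c q y =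
      (bottomFace c q).center.re +
        (y - q.1.y0) / (bottomFace c q).gap * (q.1.xc - (bottomFace c q).center.re) := by
  have hg := hc.gap_pos (bottomFace c q)
  rcases h₂.eq_or_lt with rfl | h₂
  · rw [hc.curve_middle le_rfl (hc.heights q).2.1.le, add_sub_cancel_left, div_self hg.ne']
    ring
  · have e : |y - (bottomFace c q).y| = y - q.1.y0 := by
      rw [y_bottomFace, abs_of_nonneg (by linarith)]
    rw [hc.curve_near (Or.inr rfl : _ ∨ bottomFace c q = bottomFace c q), e]
    rw [e]
    linarith

/-- A straight piece of the drawing of a square, directed downwards. -/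
structure IsPiece (c : T.FaceChoice) (q : T.squares) (p p' : ℂ) : Prop where
  lt : p'.im < p.im
  low : q.1.y0 ≤ p'.im
  high : p.im ≤ q.1.y1
  mem_iff : ∀ z : ℂ, z ∈ segment ℝ p p' ↔
    (p'.im ≤ z.im ∧ z.im ≤ p.im) ∧ z.re = curve c q z.im

theorem EdgeFiniteFor.isPiece_upper (hc : EdgeFiniteFor c) (q : T.squares) :
    IsPiece c q (topFace c q).center ⟨q.1.xc, q.1.y1 - (topFace c q).gap⟩ := by
  have hh := hc.heights q
  have him : (topFace c q).center.im = q.1.y1 := rfl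
  refine ⟨hh.1, (hh.2.2.trans hh.2.1).le, le_rfl, fun z => ?_⟩
  rw [mem_segment_iff_of_im_lt hh.1]
  refine and_congr_right fun hz => ?_
  rw [him] at hz ⊢
  simp only [sub_sub_cancel] at hz ⊢
  rw [hc.curve_upper hz.1 hz.2]

theorem EdgeFiniteFor.isPiece_middle (hc : EdgeFiniteFor c) (q : T.squares) :
    IsPiece c q ⟨q.1.xc, q.1.y1 - (topFace c q).gap⟩ ⟨q.1.xc, q.1.y0 + (bottomFace c q).gap⟩ := by
  have hh := hc.heights q
  refine ⟨hh.2.1, hh.2.2.le, hh.1.le, fun z => ?_⟩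
  rw [mem_segment_iff_of_im_lt hh.2.1]
  refine and_congr_right fun hz => ?_
  rw [hc.curve_middle hz.1 hz.2]
  simp

theorem EdgeFiniteFor.isPiece_lower (hc : EdgeFiniteFor c) (q : T.squares) :
    IsPiece c q ⟨q.1.xc, q.1.y0 + (bottomFace c q).gap⟩ (bottomFace c q).center := by
  have hh := hc.heights q
  have hg := hc.gap_pos (bottomFace c q)
  have him : (bottomFace c q).center.im = q.1.y0 := rfl
  refine ⟨hh.2.2, le_rfl, (hh.2.1.trans hh.1).le, fun z => ?_⟩
  rw [mem_segment_iff_of_im_lt hh.2.2]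
  refine and_congr_right fun hz => ?_
  rw [him] at hz ⊢
  simp only [add_sub_cancel_left] at hz ⊢
  rw [hc.curve_lower hz.1 hz.2]
  have e : (bottomFace c q).center.re +
      (z.im - q.1.y0) / (bottomFace c q).gap * (q.1.xc - (bottomFace c q).center.re) =
    q.1.xc + (q.1.y0 + (bottomFace c q).gap - z.im) / (bottomFace c q).gap *
      ((bottomFace c q).center.re - q.1.xc) := by
    field_simp
    ring
  rw [e]

theorem EdgeFiniteFor.polyLine_drawPath (hc : EdgeFiniteFor c) (q : T.squares) :
    polyLine (drawPath c q) = squash c '' q.1.mid := by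
  have hh := hc.heights q
  ext z
  have h1 : z ∈ squash c '' q.1.mid ↔ (q.1.y0 ≤ z.im ∧ z.im ≤ q.1.y1) ∧ z.re = curve c q z.im := by
    constructor
    · rintro ⟨p, hp, rfl⟩
      rw [Square.mem_mid] at hp
      rw [squash_im]
      exact ⟨hp.2, by rw [curve, ← hp.1]⟩
    · rintro ⟨h2, h3⟩
      exact ⟨⟨q.1.xc, z.im⟩, ⟨rfl, h2⟩, Complex.ext h3.symm (squash_im _)⟩
  rw [h1, drawPath, polyLine_cons_cons, polyLine_cons_cons, polyLine_cons_cons, polyLine_singleton,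
    union_empty, mem_union, mem_union, (hc.isPiece_upper q).mem_iff, (hc.isPiece_middle q).mem_iff,
    (hc.isPiece_lower q).mem_iff, ← or_and_right, ← or_and_right]
  refine and_congr_left fun _ => ?_
  have e1 : (topFace c q).center.im = q.1.y1 := rfl
  have e2 : (bottomFace c q).center.im = q.1.y0 := rfl
  rw [e1, e2]
  simp only
  constructor
  · rintro (⟨h2, h3⟩ | ⟨h2, h3⟩ | ⟨h2, h3⟩) <;> constructor <;> linarith
  · rintro ⟨h2, h3⟩
    rcases le_total (q.1.y1 - (topFace c q).gap) z.im with h4 | h4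
    · exact Or.inl ⟨h4, h3⟩
    · rcases le_total (q.1.y0 + (bottomFace c q).gap) z.im with h5 | h5
      · exact Or.inr (Or.inl ⟨h5, h4⟩)
      · exact Or.inr (Or.inr ⟨h2, h5⟩)

/-- Only points of the core of `h` are mapped to its midpoint, and a square meeting the core has an
edge in `h`. -/
theorem EdgeFiniteFor.face_of_center_mem (hc : EdgeFiniteFor c) {q : T.squares} {h : HFace c}
    {p : ℂ} (hp : p ∈ q.1.mid) (he : squash c p = h.center) :
    h = topFace c q ∨ h = bottomFace c q := by
  have h1 : p ∈ h.core := by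
    rcases hc.eq_or_core_of_squash_eq (he.trans (hc.squash_of_mem_core (hc.center_mem_core h)).symm)
      with rfl | ⟨h', h2, h3⟩
    · exact hc.center_mem_core h
    · rwa [hc.box_disjoint (hc.core_subset_box _ (hc.center_mem_core h))
        (hc.core_subset_box _ h3)]
  rcases hc.face_of_mem_core h1 (q.1.mid_subset_region hp) with ⟨h2, -⟩ | ⟨h2, -⟩
  · exact Or.inl h2.symm
  · exact Or.inr h2.symm

/-- The plane graph that belongs to a tiling with a choice of faces. -/
def EdgeFiniteFor.drawing (hc : EdgeFiniteFor c) : PlaneGraph where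
  V := HFace c
  E := T.squares
  pos := HFace.center
  path := drawPath c
  pos_injective h h' e := hc.box_disjoint (hc.core_subset_box _ (hc.center_mem_core h))
    (e ▸ hc.core_subset_box _ (hc.center_mem_core h'))
  isPolyArc q := isPolyArc_of_im_lt (hc.heights q).1 (hc.heights q).2.1 (hc.heights q).2.2
  ends q := by
    refine ⟨topFace c q, bottomFace c q, rfl, rfl, fun h hh => ?_⟩
    rw [hc.polyLine_drawPath] at hh
    obtain ⟨p, hp, he⟩ := hh
    exact hc.face_of_center_mem hp he
  inter q q' hne := by
    rw [hc.polyLine_drawPath, hc.polyLine_drawPath]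
    rintro z ⟨⟨p, hp, rfl⟩, p', hp', he⟩
    rcases hc.eq_or_core_of_squash_eq he with rfl | ⟨h, h1, h2⟩
    · rcases hc.mem_core_of_mem_mid (c := c) hp (q'.1.mid_subset_region hp') hne with h1 | h1
      · exact ⟨_, (hc.squash_of_mem_core h1).symm⟩
      · exact ⟨_, (hc.squash_of_mem_core h1).symm⟩
    · exact ⟨h, (hc.squash_of_mem_core h2).symm⟩

theorem EdgeFiniteFor.inc_drawing (hc : EdgeFiniteFor c) (h : HFace c) (q : T.squares) :
    hc.drawing.Inc h q ↔ h = topFace c q ∨ h = bottomFace c q := by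
  constructor
  · intro hh
    have hh : h.center ∈ polyLine (drawPath c q) := hh
    rw [hc.polyLine_drawPath] at hh
    obtain ⟨p, hp, he⟩ := hh
    exact hc.face_of_center_mem hp he
  · have h2 : 2 ≤ (drawPath c q).length := by simp [drawPath]
    have h3 : (topFace c q).center ∈ drawPath c q := by simp [drawPath]
    have h4 : (bottomFace c q).center ∈ drawPath c q := by simp [drawPath]
    rintro (rfl | rfl)
    · exact mem_polyLine_of_mem h2 h3
    · exact mem_polyLine_of_mem h2 h4

theorem EdgeFiniteFor.support_drawing (hc : EdgeFiniteFor c) :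
    hc.drawing.support = squash c '' skeleton c := by
  have h1 : ∀ q : T.squares, hc.drawing.arc q = squash c '' q.1.mid := hc.polyLine_drawPath
  have h2 : range hc.drawing.pos = ⋃ h : HFace c, squash c '' h.core := by
    ext z
    rw [mem_iUnion]
    constructor
    · rintro ⟨h, rfl⟩
      exact ⟨h, h.center, hc.center_mem_core h, hc.squash_of_mem_core (hc.center_mem_core h)⟩
    · rintro ⟨h, p, hp, rfl⟩
      exact ⟨h, (hc.squash_of_mem_core hp).symm⟩
  rw [PlaneGraph.support, h2, skeleton, image_union, image_iUnion, image_iUnion]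
  exact congrArg _ (iUnion_congr h1)

/-- The face of the drawing that belongs to a vertical face. -/
def EdgeFiniteFor.faceOf (hc : EdgeFiniteFor c) (f : VFace c) : hc.drawing.Face :=
  ⟨squash c '' f.cell, by
    obtain ⟨p, hp⟩ := hc.cell_nonempty f
    refine ⟨squash c p, ?_, ?_⟩
    · rw [hc.support_drawing]
      exact fun h => hp.1 (hc.squash_mem_image_skeleton.1 h)
    · rw [hc.support_drawing, hc.connectedComponentIn_eq (mem_image_of_mem _ hp)]⟩

theorem EdgeFiniteFor.eq_faceOf (hc : EdgeFiniteFor c) {F : hc.drawing.Face} {f : VFace c} {z : ℂ}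
    (hz : z ∈ F.1) (hz' : z ∈ squash c '' f.cell) : F = hc.faceOf f := by
  obtain ⟨S, x, hx, rfl⟩ := F
  refine Subtype.ext ?_
  change connectedComponentIn hc.drawing.supportᶜ x = squash c '' f.cell
  change z ∈ connectedComponentIn hc.drawing.supportᶜ x at hz
  rw [_root_.connectedComponentIn_eq hz, hc.support_drawing, hc.connectedComponentIn_eq hz']

theorem EdgeFiniteFor.faceOf_bijective (hc : EdgeFiniteFor c) :
    Function.Bijective hc.faceOf := by
  constructor
  · intro f f' h
    obtain ⟨p, hp⟩ := hc.cell_nonempty f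
    have h1 : squash c p ∈ squash c '' f.cell := mem_image_of_mem _ hp
    have h2 : squash c '' f.cell = squash c '' f'.cell := congrArg Subtype.val h
    exact hc.image_cell_disjoint h1 (h2 ▸ h1)
  · rintro ⟨S, x, hx, rfl⟩
    have hx' := hx
    rw [hc.support_drawing] at hx'
    obtain ⟨p, rfl⟩ := hc.squash_surjective x
    obtain ⟨f, hf⟩ := exists_mem_cell (c := c) fun h => hx' (mem_image_of_mem _ h)
    exact ⟨f, (hc.eq_faceOf (mem_connectedComponentIn hx) (mem_image_of_mem _ hf)).symm⟩

/-- The faces of the drawing correspond to the vertical faces of the tiling. -/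
def EdgeFiniteFor.faceEquiv (hc : EdgeFiniteFor c) : VFace c ≃ hc.drawing.Face :=
  Equiv.ofBijective _ hc.faceOf_bijective

/-! ### The sides of the edges -/

/-- By the intermediate value theorem along a horizontal line, each point between the images of the
left edge and of the middle line comes from the open left half of `q`. -/
theorem EdgeFiniteFor.mem_left_cell (hc : EdgeFiniteFor c) {q : T.squares} {z : ℂ}
    (hy : q.1.y0 < z.im ∧ z.im < q.1.y1) (h₁ : (squash c ⟨q.1.x0, z.im⟩).re < z.re)
    (h₂ : z.re < curve c q z.im) : z ∈ squash c '' (leftFace c q).cell := by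
  have hx := q.1.xc_mem
  have hcont : Continuous fun x : ℝ => (squash c ⟨x, z.im⟩).re := by
    have : (fun x : ℝ => (⟨x, z.im⟩ : ℂ)) = fun x : ℝ => (x : ℂ) + z.im * I :=
      funext fun x => mk_eq_add_mul_I x z.im
    refine continuous_re.comp (hc.continuous_squash.comp ?_)
    rw [this]
    fun_prop
  obtain ⟨x, hxI, he⟩ := intermediate_value_Ioo hx.1.le hcont.continuousOn ⟨h₁, h₂⟩
  have hreg : (⟨x, z.im⟩ : ℂ) ∈ q.1.region :=
    Square.mem_region.2 ⟨⟨hxI.1.le, (hxI.2.trans hx.2).le⟩, hy.1.le, hy.2.le⟩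
  exact ⟨⟨x, z.im⟩, ⟨hc.notMem_skeleton hreg hy.1 hy.2 hxI.2.ne, (q, true), rfl, hreg, hxI.2.le⟩,
    Complex.ext he (squash_im _)⟩

theorem EdgeFiniteFor.mem_right_cell (hc : EdgeFiniteFor c) {q : T.squares} {z : ℂ}
    (hy : q.1.y0 < z.im ∧ z.im < q.1.y1) (h₁ : z.re < (squash c ⟨q.1.x1, z.im⟩).re)
    (h₂ : curve c q z.im < z.re) : z ∈ squash c '' (rightFace c q).cell := by
  have hx := q.1.xc_mem
  have hcont : Continuous fun x : ℝ => (squash c ⟨x, z.im⟩).re := by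
    have : (fun x : ℝ => (⟨x, z.im⟩ : ℂ)) = fun x : ℝ => (x : ℂ) + z.im * I :=
      funext fun x => mk_eq_add_mul_I x z.im
    refine continuous_re.comp (hc.continuous_squash.comp ?_)
    rw [this]
    fun_prop
  obtain ⟨x, hxI, he⟩ := intermediate_value_Ioo hx.2.le hcont.continuousOn ⟨h₂, h₁⟩
  have hreg : (⟨x, z.im⟩ : ℂ) ∈ q.1.region :=
    Square.mem_region.2 ⟨⟨(hx.1.trans hxI.1).le, hxI.2.le⟩, hy.1.le, hy.2.le⟩
  exact ⟨⟨x, z.im⟩, ⟨hc.notMem_skeleton hreg hy.1 hy.2 hxI.1.ne', (q, false), rfl, hreg,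
    hxI.1.le⟩, Complex.ext he (squash_im _)⟩

theorem EdgeFiniteFor.notMem_core_of_im_mem (hc : EdgeFiniteFor c) {q : T.squares} {p : ℂ}
    (hp : p ∈ q.1.region) (hy : q.1.y0 < p.im ∧ p.im < q.1.y1) (h : HFace c) : p ∉ h.core := by
  intro hh
  rcases hc.face_of_mem_core hh hp with ⟨-, h1⟩ | ⟨-, h1⟩
  · exact hy.2.ne h1
  · exact hy.1.ne' h1

/-- The points of a straight piece: the slope of the curve. -/
theorem IsPiece.curve_eq {q : T.squares} {p p' : ℂ} (hp : IsPiece c q p p') {y : ℝ}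
    (h : p'.im ≤ y) (h' : y ≤ p.im) :
    curve c q y = p.re + (p.im - y) / (p.im - p'.im) * (p'.re - p.re) := by
  have h1 := (hp.mem_iff ⟨p.re + (p.im - y) / (p.im - p'.im) * (p'.re - p.re), y⟩).1
    ((mem_segment_iff_of_im_lt hp.lt).2 ⟨⟨h, h'⟩, rfl⟩)
  exact h1.2.symm

theorem IsPiece.im_mem {q : T.squares} {p p' x : ℂ} (hp : IsPiece c q p p')
    (hx : x ∈ openSegment ℝ p p') : p'.im < x.im ∧ x.im < p.im := by
  rw [openSegment_eq_image'] at hx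
  obtain ⟨θ, ⟨h0, h1⟩, rfl⟩ := hx
  have hlt := hp.lt
  simp only [add_im, real_smul, mul_im, ofReal_re, sub_im, ofReal_im, zero_mul, add_zero]
  constructor <;> nlinarith

/-- A piece is directed downwards, so its right side is west. A small normal step stays between the
images of the vertical edges of `q` and lands on the expected side of the arc. -/
theorem EdgeFiniteFor.eventually_side (hc : EdgeFiniteFor c) {q : T.squares} {p p' x : ℂ}
    (hp : IsPiece c q p p') (hx : x ∈ openSegment ℝ p p') :
    (∀ᶠ ε : ℝ in 𝓝[>] 0, x - ε * (I * (p' - p)) ∈ squash c '' (leftFace c q).cell) ∧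
    (∀ᶠ ε : ℝ in 𝓝[>] 0, x - ε * (I * (p - p')) ∈ squash c '' (rightFace c q).cell) := by
  have him := hp.im_mem hx
  have hxre : x.re = curve c q x.im := ((hp.mem_iff x).1 (openSegment_subset_segment ℝ _ _ hx)).2
  have hd : 0 < p.im - p'.im := sub_pos.2 hp.lt
  set d := p.im - p'.im with hd'
  set u := p'.re - p.re with hu
  have hxc := q.1.xc_mem
  have hlow := hp.low
  have hhigh := hp.high
  have hyx : q.1.y0 < x.im ∧ x.im < q.1.y1 := ⟨hp.low.trans_lt him.1, him.2.trans_le hp.high⟩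
  have hreg : ∀ a : ℝ, q.1.x0 ≤ a → a ≤ q.1.x1 → (⟨a, x.im⟩ : ℂ) ∈ q.1.region := fun a h1 h2 =>
    Square.mem_region.2 ⟨⟨h1, h2⟩, hyx.1.le, hyx.2.le⟩
  have hleft : (squash c ⟨q.1.x0, x.im⟩).re < x.re := by
    rw [hxre]
    refine hc.squash_lt rfl hxc.1 ?_
    rintro ⟨h, h1, -⟩
    exact hc.notMem_core_of_im_mem (hreg _ le_rfl q.1.x0_lt_x1.le) hyx h h1
  have hright : x.re < (squash c ⟨q.1.x1, x.im⟩).re := by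
    rw [hxre]
    refine hc.squash_lt rfl hxc.2 ?_
    rintro ⟨h, -, h1⟩
    exact hc.notMem_core_of_im_mem (hreg _ q.1.x0_lt_x1.le le_rfl) hyx h h1
  have hslope : ∀ y, p'.im ≤ y → y ≤ p.im → curve c q y = x.re + (x.im - y) / d * u := by
    intro y h1 h2
    rw [hxre, hp.curve_eq h1 h2, hp.curve_eq him.1.le him.2.le, ← hd', ← hu]
    field_simp
    ring
  have hcont : ∀ a : ℝ, Continuous fun z : ℂ => (squash c ⟨a, z.im⟩).re := by
    intro a
    have : (fun z : ℂ => (⟨a, z.im⟩ : ℂ)) = fun z : ℂ => (a : ℂ) + z.im * I :=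
      funext fun z => mk_eq_add_mul_I a z.im
    refine continuous_re.comp (hc.continuous_squash.comp ?_)
    rw [this]
    fun_prop
  have hnear : ∀ᶠ z : ℂ in 𝓝 x, (p'.im < z.im ∧ z.im < p.im) ∧
      (squash c ⟨q.1.x0, z.im⟩).re < z.re ∧ z.re < (squash c ⟨q.1.x1, z.im⟩).re := by
    have o1 : IsOpen {z : ℂ | p'.im < z.im} := isOpen_lt continuous_const continuous_im
    have o2 : IsOpen {z : ℂ | z.im < p.im} := isOpen_lt continuous_im continuous_const
    have o3 : IsOpen {z : ℂ | (squash c ⟨q.1.x0, z.im⟩).re < z.re} :=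
      isOpen_lt (hcont _) continuous_re
    have o4 : IsOpen {z : ℂ | z.re < (squash c ⟨q.1.x1, z.im⟩).re} :=
      isOpen_lt continuous_re (hcont _)
    filter_upwards [o1.mem_nhds him.1, o2.mem_nhds him.2, o3.mem_nhds hleft, o4.mem_nhds hright]
      with z h1 h2 h3 h4
    exact ⟨⟨h1, h2⟩, h3, h4⟩
  have htend : ∀ w : ℂ, Tendsto (fun ε : ℝ => x - ε * w) (𝓝[>] 0) (𝓝 x) := by
    intro w
    have : Tendsto (fun ε : ℝ => x - ε * w) (𝓝 0) (𝓝 (x - (0 : ℝ) * w)) :=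
      Continuous.tendsto (by fun_prop) 0
    rw [ofReal_zero, zero_mul, sub_zero] at this
    exact this.mono_left nhdsWithin_le_nhds
  constructor
  · filter_upwards [(htend (I * (p' - p))).eventually hnear, self_mem_nhdsWithin]
      with ε h0 h3
    obtain ⟨h1, h2, -⟩ := h0
    have hε : 0 < ε := h3
    set z := x - ε * (I * (p' - p)) with hz
    have hre : z.re = x.re - ε * d := by simp [hz, hd']
    have him' : z.im = x.im - ε * u := by simp [hz, hu]
    refine hc.mem_left_cell ⟨by linarith [h1.1], by linarith [h1.2]⟩ h2 ?_
    rw [hslope _ h1.1.le h1.2.le, hre, him', sub_sub_cancel]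
    -- At the new height the arc has moved east by `ε * u ^ 2 / d`, whereas the point has moved west
    -- by `ε * d`.
    have : 0 ≤ ε * u / d * u := by
      rw [show ε * u / d * u = ε * u ^ 2 / d by ring]; positivity
    nlinarith [mul_pos hε hd]
  · filter_upwards [(htend (I * (p - p'))).eventually hnear, self_mem_nhdsWithin]
      with ε h0 h3
    obtain ⟨h1, -, h2⟩ := h0
    have hε : 0 < ε := h3
    set z := x - ε * (I * (p - p')) with hz
    have hre : z.re = x.re + ε * d := by simp [hz, hd']; ring
    have him' : z.im = x.im + ε * u := by simp [hz, hu]; ring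
    refine hc.mem_right_cell ⟨by linarith [h1.1], by linarith [h1.2]⟩ h2 ?_
    rw [hslope _ h1.1.le h1.2.le, hre, him', sub_add_cancel_left]
    have : 0 ≤ ε * u / d * u := by
      rw [show ε * u / d * u = ε * u ^ 2 / d by ring]; positivity
    rw [show -(ε * u) / d * u = -(ε * u / d * u) by ring]
    nlinarith [mul_pos hε hd]

theorem EdgeFiniteFor.pathFrom_top (hc : EdgeFiniteFor c) (q : T.squares) :
    hc.drawing.pathFrom (topFace c q) q = drawPath c q :=
  hc.drawing.pathFrom_of_head (v := topFace c q) (e := q) rfl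

theorem EdgeFiniteFor.pathFrom_bottom (hc : EdgeFiniteFor c) (q : T.squares) :
    hc.drawing.pathFrom (bottomFace c q) q = (drawPath c q).reverse :=
  hc.drawing.pathFrom_of_getLast (v := bottomFace c q) (e := q) rfl

theorem EdgeFiniteFor.rightOf_top (hc : EdgeFiniteFor c) (q : T.squares) (F : hc.drawing.Face) :
    hc.drawing.RightOf (topFace c q) q F ↔ F = hc.faceOf (leftFace c q) := by
  constructor
  · rintro ⟨-, p, p', hpp, x, hx, hev⟩
    rw [hc.pathFrom_top, drawPath, pair_infix_four] at hpp
    have hpiece : IsPiece c q p p' := by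
      rcases hpp with ⟨rfl, rfl⟩ | ⟨rfl, rfl⟩ | ⟨rfl, rfl⟩
      · exact hc.isPiece_upper q
      · exact hc.isPiece_middle q
      · exact hc.isPiece_lower q
    obtain ⟨ε, h1, h2⟩ := (hev.and (hc.eventually_side hpiece hx).1).exists
    exact hc.eq_faceOf h1 h2
  · rintro rfl
    refine ⟨(hc.inc_drawing _ _).2 (Or.inl rfl), _, _, ?_, _, ?_,
      (hc.eventually_side (hc.isPiece_middle q) (midpoint_mem_openSegment _ _)).1⟩
    · rw [hc.pathFrom_top, drawPath, pair_infix_four]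
      exact Or.inr (Or.inl ⟨rfl, rfl⟩)
    · exact midpoint_mem_openSegment _ _

theorem EdgeFiniteFor.rightOf_bottom (hc : EdgeFiniteFor c) (q : T.squares)
    (F : hc.drawing.Face) :
    hc.drawing.RightOf (bottomFace c q) q F ↔ F = hc.faceOf (rightFace c q) := by
  have hrev : (drawPath c q).reverse = [(bottomFace c q).center,
      ⟨q.1.xc, q.1.y0 + (bottomFace c q).gap⟩, ⟨q.1.xc, q.1.y1 - (topFace c q).gap⟩,
      (topFace c q).center] := rfl
  constructor
  · rintro ⟨-, p, p', hpp, x, hx, hev⟩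
    rw [hc.pathFrom_bottom, hrev, pair_infix_four] at hpp
    have hpiece : IsPiece c q p' p := by
      rcases hpp with ⟨rfl, rfl⟩ | ⟨rfl, rfl⟩ | ⟨rfl, rfl⟩
      · exact hc.isPiece_lower q
      · exact hc.isPiece_middle q
      · exact hc.isPiece_upper q
    rw [openSegment_symm] at hx
    obtain ⟨ε, h1, h2⟩ := (hev.and (hc.eventually_side hpiece hx).2).exists
    exact hc.eq_faceOf h1 h2
  · rintro rfl
    refine ⟨(hc.inc_drawing _ _).2 (Or.inr rfl), _, _, ?_, _, ?_,
      (hc.eventually_side (hc.isPiece_middle q) (midpoint_mem_openSegment _ _)).2⟩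
    · rw [hc.pathFrom_bottom, hrev, pair_infix_four]
      exact Or.inr (Or.inl ⟨rfl, rfl⟩)
    · rw [openSegment_symm]
      exact midpoint_mem_openSegment _ _

end SquareTiling

namespace SquareTiling

variable {T : SquareTiling} {c : T.FaceChoice}

/-! ### The drawing is a plane map -/

theorem finite_squares (T : SquareTiling) {K : Set ℂ} (hK : IsCompact K) :
    {q : T.squares | (q.1.region ∩ K).Nonempty}.Finite :=
  Set.Finite.subset ((T.locallyFinite K hK).preimage Subtype.val_injective.injOn)
    fun q hq => ⟨q.2, hq⟩

/-- The edge of a square joins its top face to its bottom face. So squares at one horizontal face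
have connected top faces, and `rel_of_hFace_rel` extends this to all squares. -/
theorem EdgeFiniteFor.connected_drawing (hc : EdgeFiniteFor c) (u v : HFace c) :
    Relation.ReflTransGen (fun a b => ∃ e, hc.drawing.Inc a e ∧ hc.drawing.Inc b e) u v := by
  have hsymm : Std.Symm fun a b : HFace c => ∃ e, hc.drawing.Inc a e ∧ hc.drawing.Inc b e :=
    ⟨fun a b ⟨e, h1, h2⟩ => ⟨e, h2, h1⟩⟩
  set R : HFace c → HFace c → Prop :=
    Relation.ReflTransGen fun a b => ∃ e, hc.drawing.Inc a e ∧ hc.drawing.Inc b e with hR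
  have hstep : ∀ a : T.squares × Bool, R (topFace c a.1) (hFace c a) := by
    rintro ⟨q, b⟩
    refine Relation.ReflTransGen.single ⟨q, (hc.inc_drawing _ _).2 (Or.inl rfl),
      (hc.inc_drawing _ _).2 ?_⟩
    cases b
    · exact Or.inr rfl
    · exact Or.inl rfl
  have hRs : ∀ {a b}, R a b → R b a := fun h => Relation.ReflTransGen.stdSymm.symm _ _ h
  have hr : Equivalence fun q q' : T.squares => R (topFace c q) (topFace c q') :=
    ⟨fun q => Relation.ReflTransGen.refl, fun h => hRs h, fun h h' => h.trans h'⟩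
  have key := hc.rel_of_hFace_rel hr fun a b hab => by
    have h := hstep a
    rw [hab] at h
    exact h.trans (hRs (hstep b))
  obtain ⟨a, rfl⟩ := exists_hFace u
  obtain ⟨b, rfl⟩ := exists_hFace v
  exact (hRs (hstep a)).trans ((key a.1 b.1).trans (hstep b))

theorem EdgeFiniteFor.isPlaneMap_drawing (hc : EdgeFiniteFor c) : hc.drawing.IsPlaneMap where
  nonempty := ⟨topFace c (T.germ 0 true true)⟩
  connected := hc.connected_drawing
  bounded F := by
    obtain ⟨f, rfl⟩ := hc.faceOf_bijective.2 F
    -- A cell is contained in finitely many compact halves of squares, since its vertical face has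
    -- finitely many edges.
    have hfin : {a : T.squares × Bool | vFace c a = f}.Finite := hc.2 f
    have hK := (hfin.isCompact_biUnion fun a _ => isCompact_halfSquare a).image
      hc.continuous_squash
    refine hK.isBounded.subset (image_mono ?_)
    rintro p ⟨-, a, ha, hpa⟩
    exact mem_biUnion ha hpa
  finite_verts K hK := (hc.finite_box hK).subset fun h hh =>
    ⟨h.center, hc.core_subset_box h (hc.center_mem_core h), hh⟩
  finite_edges K hK := by
    refine (T.finite_squares (hc.isCompact_preimage_squash hK)).subset ?_
    rintro q ⟨z, hz, hzK⟩
    have hz : z ∈ polyLine (drawPath c q) := hz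
    rw [hc.polyLine_drawPath] at hz
    obtain ⟨p, hp, rfl⟩ := hz
    exact ⟨p, q.1.mid_subset_region hp, hzK⟩

/-! ### The harmonic vector -/

/-- The directed edge of the drawing that starts at the horizontal face of a horizontal edge. -/
def EdgeFiniteFor.dart (hc : EdgeFiniteFor c) (a : T.squares × Bool) : hc.drawing.Dart :=
  ⟨(hFace c a, a.1), (hc.inc_drawing _ _).2 (by
    obtain ⟨q, b⟩ := a
    cases b
    · exact Or.inr rfl
    · exact Or.inl rfl)⟩

theorem EdgeFiniteFor.dart_bijective (hc : EdgeFiniteFor c) : Function.Bijective hc.dart := by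
  constructor
  · rintro ⟨q, b⟩ ⟨q', b'⟩ h
    have h1 : hFace c (q, b) = hFace c (q', b') := congrArg (fun d => d.1.1) h
    have h2 : q = q' := congrArg (fun d => d.1.2) h
    subst h2
    have hne := topFace_ne_bottomFace (c := c) q
    cases b <;> cases b'
    · rfl
    · exact absurd h1.symm hne
    · exact absurd h1 hne
    · rfl
  · rintro ⟨⟨h, q⟩, hi⟩
    rcases (hc.inc_drawing h q).1 hi with rfl | rfl
    · exact ⟨(q, true), rfl⟩
    · exact ⟨(q, false), rfl⟩

open Classical in
/-- The size of the square, with a sign that depends on the direction. -/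
def EdgeFiniteFor.weight (hc : EdgeFiniteFor c) (d : hc.drawing.Dart) : ℝ :=
  if d.1.1 = topFace c d.1.2 then (d.1.2 : T.squares).1.side else -(d.1.2 : T.squares).1.side

theorem EdgeFiniteFor.weight_top (hc : EdgeFiniteFor c) {d : hc.drawing.Dart}
    (h : d.1.1 = topFace c d.1.2) : hc.weight d = (d.1.2 : T.squares).1.side := if_pos h

theorem EdgeFiniteFor.weight_bottom (hc : EdgeFiniteFor c) {d : hc.drawing.Dart}
    (h : d.1.1 = bottomFace c d.1.2) : hc.weight d = -(d.1.2 : T.squares).1.side :=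
  if_neg fun h' => topFace_ne_bottomFace (c := c) d.1.2 (h'.symm.trans h)

/-- The weight of a directed edge, in terms of the horizontal edge of the tiling. -/
def signedSide (a : T.squares × Bool) : ℝ := cond a.2 a.1.1.side (-a.1.1.side)

theorem EdgeFiniteFor.weight_dart (hc : EdgeFiniteFor c) (a : T.squares × Bool) :
    hc.weight (hc.dart a) = signedSide a := by
  obtain ⟨q, b⟩ := a
  cases b
  · exact hc.weight_bottom (d := hc.dart (q, false)) rfl
  · exact hc.weight_top (d := hc.dart (q, true)) rfl

/-- Finiteness is essential here, as `finsum` over an infinite support is zero by convention. -/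
theorem finsum_signedSide (P : T.squares × Bool → Prop) (hP : {a | P a}.Finite) :
    ∑ᶠ (a : T.squares × Bool) (_ : P a), signedSide a =
      ∑ᶠ (q : T.squares) (_ : P (q, true)), q.1.side -
        ∑ᶠ (q : T.squares) (_ : P (q, false)), q.1.side := by
  have hinj : ∀ b : Bool, Function.Injective fun q : T.squares => (q, b) :=
    fun b q q' h => congrArg Prod.fst h
  have hfin : ∀ b : Bool, {q : T.squares | P (q, b)}.Finite :=
    fun b => hP.preimage (hinj b).injOn
  have h1 : {a | P a} = (fun q : T.squares => (q, true)) '' {q | P (q, true)} ∪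
      (fun q : T.squares => (q, false)) '' {q | P (q, false)} := by
    ext ⟨q, b⟩
    cases b <;> simp
  have hdisj : Disjoint ((fun q : T.squares => (q, true)) '' {q | P (q, true)})
      ((fun q : T.squares => (q, false)) '' {q | P (q, false)}) := by
    refine Set.disjoint_left.2 ?_
    rintro _ ⟨q, -, rfl⟩ ⟨q', -, h⟩
    simp at h
  change ∑ᶠ a ∈ {a | P a}, signedSide a = ∑ᶠ q ∈ {q : T.squares | P (q, true)}, q.1.side -
    ∑ᶠ q ∈ {q : T.squares | P (q, false)}, q.1.side
  rw [h1, finsum_mem_union hdisj ((hfin true).image _) ((hfin false).image _),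
    finsum_mem_image (hinj true).injOn, finsum_mem_image (hinj false).injOn, sub_eq_add_neg,
    ← finsum_mem_neg_distrib _ (hfin false)]
  rfl

theorem EdgeFiniteFor.finsum_weight (hc : EdgeFiniteFor c) (P : hc.drawing.Dart → Prop) :
    ∑ᶠ (d : hc.drawing.Dart) (_ : P d), hc.weight d =
      ∑ᶠ (a : T.squares × Bool) (_ : P (hc.dart a)), signedSide a := by
  rw [← finsum_comp_equiv (Equiv.ofBijective _ hc.dart_bijective)]
  refine finsum_congr fun a => finsum_congr fun _ => ?_
  exact hc.weight_dart a

/-- One Boolean serves both directions: `(q, true)` is the top edge where the downward dart starts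
and also the left edge on its right, `(q, false)` the bottom and the right edge. So sums over darts
beside a face become sums over vertical edges. -/
theorem EdgeFiniteFor.rightOf_dart (hc : EdgeFiniteFor c) (a : T.squares × Bool) (f : VFace c) :
    hc.drawing.RightOf (hFace c a) a.1 (hc.faceOf f) ↔ vFace c a = f := by
  obtain ⟨q, b⟩ := a
  cases b
  · rw [hFace_false, hc.rightOf_bottom, hc.faceOf_bijective.1.eq_iff, eq_comm]
    rfl
  · rw [hFace_true, hc.rightOf_top, hc.faceOf_bijective.1.eq_iff, eq_comm]
    rfl

theorem EdgeFiniteFor.isHarmonic_weight (hc : EdgeFiniteFor c) :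
    hc.drawing.IsHarmonic hc.weight where
  vert h := by
    rw [hc.finsum_weight]
    have key (h : HFace c) : ∑ᶠ (a : T.squares × Bool) (_ : hFace c a = h), signedSide a = 0 := by
      rw [finsum_signedSide (fun a => hFace c a = h) (hc.1 h), hc.finsum_side h true,
        hc.finsum_side h false, sub_self]
    exact key h
  edge q := by
    rw [hc.finsum_weight]
    have key (q : T.squares) : ∑ᶠ (a : T.squares × Bool) (_ : a.1 = q), signedSide a = 0 := by
      rw [finsum_signedSide (fun a => a.1 = q), sub_self]
      refine ((Set.finite_singleton (q, false)).insert (q, true)).subset ?_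
      rintro ⟨q', b⟩ rfl
      cases b <;> simp
    exact key q
  face F := by
    obtain ⟨f, rfl⟩ := hc.faceOf_bijective.2 F
    rw [hc.finsum_weight]
    have h1 : ∑ᶠ (a : T.squares × Bool) (_ : hc.drawing.RightOf (hc.dart a).1.1 (hc.dart a).1.2
        (hc.faceOf f)), signedSide a =
        ∑ᶠ (a : T.squares × Bool) (_ : vFace c a = f), signedSide a := by
      refine finsum_congr fun a => ?_
      rw [← propext (hc.rightOf_dart a f)]
      rfl
    rw [h1, finsum_signedSide (fun a => vFace c a = f) (hc.2 f), hc.finsum_side_vFace f true,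
      hc.finsum_side_vFace f false, sub_self]

/-- The drawing corresponds to the tiling. -/
def EdgeFiniteFor.corresponds (hc : EdgeFiniteFor c) : Corresponds c hc.drawing hc.weight where
  vert := Equiv.refl _
  edge := Equiv.refl _
  face := hc.faceEquiv.symm
  inc := hc.inc_drawing
  right := by
    intro h q F
    obtain ⟨f, rfl⟩ := hc.faceEquiv.surjective F
    rw [Equiv.symm_apply_apply]
    change hc.drawing.RightOf h q (hc.faceOf f) ↔
      (h = topFace c q ∧ f = leftFace c q) ∨ (h = bottomFace c q ∧ f = rightFace c q)
    have hne := topFace_ne_bottomFace (c := c) q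
    constructor
    · intro hr
      rcases (hc.inc_drawing h q).1 hr.1 with rfl | rfl
      · exact Or.inl ⟨rfl, ((hc.rightOf_dart (q, true) f).1 hr).symm⟩
      · exact Or.inr ⟨rfl, ((hc.rightOf_dart (q, false) f).1 hr).symm⟩
    · rintro (⟨rfl, rfl⟩ | ⟨rfl, rfl⟩)
      · exact (hc.rightOf_dart (q, true) _).2 rfl
      · exact (hc.rightOf_dart (q, false) _).2 rfl
  weight_top _ h := hc.weight_top h
  weight_bottom _ h := hc.weight_bottom h

/-! ### Translations -/

section translate

variable {t : ℂ}

theorem translate_injective (t : ℂ) : Function.Injective (Square.translate t) := by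
  intro q q' h
  have h1 : q.corner + t = q'.corner + t := congrArg Square.corner h
  have h2 : (q.translate t).side = (q'.translate t).side := congrArg Square.side h
  exact Square.ext (add_right_cancel h1) h2

@[simp] theorem x0_translate (q : Square) : (q.translate t).x0 = q.x0 + t.re := rfl

@[simp] theorem y0_translate (q : Square) : (q.translate t).y0 = q.y0 + t.im := rfl

@[simp] theorem side_translate (q : Square) : (q.translate t).side = q.side := rfl

@[simp] theorem x1_translate (q : Square) : (q.translate t).x1 = q.x1 + t.re := by
  simp only [Square.x1_eq, x0_translate, side_translate]; ring

@[simp] theorem y1_translate (q : Square) : (q.translate t).y1 = q.y1 + t.im := by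
  simp only [Square.y1_eq, y0_translate, side_translate]; ring

/-- The action of a period on the squares. -/
def IsPeriod.squareEquiv (ht : IsPeriod c t) : T.squares ≃ T.squares :=
  (Equiv.Set.image _ T.squares (translate_injective t)).trans (Equiv.setCongr ht.1)

theorem IsPeriod.squareEquiv_val (ht : IsPeriod c t) (q : T.squares) :
    (ht.squareEquiv q).1 = q.1.translate t := rfl

theorem IsPeriod.mem_horiz (ht : IsPeriod c t) {p : ℂ} : p + t ∈ c.horiz ↔ p ∈ c.horiz := by
  conv_lhs => rw [← ht.2]
  exact (add_left_injective t).mem_set_image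

theorem mem_region_translate {q : Square} {p : ℂ} :
    p + t ∈ (q.translate t).region ↔ p ∈ q.region := by
  simp [Square.mem_region]

theorem IsPeriod.mem_singular (ht : IsPeriod c t) {p : ℂ} :
    p + t ∈ T.singular ↔ p ∈ T.singular := by
  have h : {q ∈ T.squares | p + t ∈ q.region} =
      Square.translate t '' {q ∈ T.squares | p ∈ q.region} := by
    ext q'
    constructor
    · rintro ⟨hq, hp⟩
      rw [← ht.1] at hq
      obtain ⟨q, hq, rfl⟩ := hq
      exact ⟨q, ⟨hq, mem_region_translate.1 hp⟩, rfl⟩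
    · rintro ⟨q, ⟨hq, hp⟩, rfl⟩
      exact ⟨ht.1 ▸ mem_image_of_mem _ hq, mem_region_translate.2 hp⟩
  rw [singular, mem_ofPred_eq, mem_ofPred_eq, h,
    Set.ncard_image_of_injective _ (translate_injective t)]

theorem IsPeriod.mem_hEdge (ht : IsPeriod c t) {q : T.squares} {b : Bool} {p : ℂ} :
    p + t ∈ T.hEdge (ht.squareEquiv q, b) ↔ p ∈ T.hEdge (q, b) := by
  rw [SquareTiling.mem_hEdge, SquareTiling.mem_hEdge]
  cases b <;> simp [hy, ht.squareEquiv_val]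

theorem IsPeriod.hLink (ht : IsPeriod c t) (a b : T.squares × Bool) :
    HLink c a b ↔ HLink c (ht.squareEquiv a.1, a.2) (ht.squareEquiv b.1, b.2) := by
  constructor
  · rintro ⟨p, ⟨h1, h2⟩, h3⟩
    refine ⟨p + t, ⟨ht.mem_hEdge.2 h1, ht.mem_hEdge.2 h2⟩, ?_⟩
    rw [Set.mem_sdiff, ht.mem_singular, ht.mem_horiz]
    exact h3
  · rintro ⟨p, ⟨h1, h2⟩, h3⟩
    obtain ⟨p, rfl⟩ : ∃ p', p' + t = p := ⟨p - t, sub_add_cancel _ _⟩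
    rw [Set.mem_sdiff, ht.mem_singular, ht.mem_horiz] at h3
    exact ⟨p, ⟨ht.mem_hEdge.1 h1, ht.mem_hEdge.1 h2⟩, h3⟩

/-- The action of a period on the horizontal faces. -/
def IsPeriod.faceEquiv (ht : IsPeriod c t) : HFace c ≃ HFace c :=
  Quot.congr (ht.squareEquiv.prodCongr (Equiv.refl Bool)) fun a b => ht.hLink a b

theorem IsPeriod.faceEquiv_hFace (ht : IsPeriod c t) (a : T.squares × Bool) :
    ht.faceEquiv (hFace c a) = hFace c (ht.squareEquiv a.1, a.2) := rfl

theorem IsPeriod.edges_faceEquiv (ht : IsPeriod c t) (h : HFace c) :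
    (ht.faceEquiv h).edges = (fun a => (ht.squareEquiv a.1, a.2)) '' h.edges := by
  ext ⟨q, b⟩
  obtain ⟨q, rfl⟩ := ht.squareEquiv.surjective q
  constructor
  · intro hq
    exact ⟨(q, b), ht.faceEquiv.injective hq, rfl⟩
  · rintro ⟨a, ha, he⟩
    rw [← he]
    exact congrArg ht.faceEquiv ha

theorem IsPeriod.gap_faceEquiv (ht : IsPeriod c t) (h : HFace c) :
    (ht.faceEquiv h).gap = h.gap := by
  rw [HFace.gap, HFace.gap, ht.edges_faceEquiv, image_image]
  rfl

/-- The extreme edges of a face and of its translate are compared with each other, which gives both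
inequalities for each end. -/
theorem IsPeriod.center_faceEquiv (ht : IsPeriod c t) (hc : EdgeFiniteFor c) (h : HFace c) :
    (ht.faceEquiv h).center = h.center + t := by
  have hlo : (ht.faceEquiv h).lo = h.lo + t.re := by
    obtain ⟨a, rfl, ha'⟩ := hc.exists_lo h
    obtain ⟨⟨q, b'⟩, hb, hb'⟩ := hc.exists_lo (ht.faceEquiv (hFace c a))
    obtain ⟨q, rfl⟩ := ht.squareEquiv.surjective q
    have h1 := hc.lo_le (ht.squareEquiv a.1, a.2)
    have h2 := hc.lo_le (q, b')
    rw [← ht.faceEquiv_hFace] at h1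
    have h3 : hFace c (q, b') = hFace c a := ht.faceEquiv.injective hb
    rw [h3] at h2
    simp only [ht.squareEquiv_val, x0_translate] at h1 hb'
    exact le_antisymm (by linarith) (by linarith)
  have hhi : (ht.faceEquiv h).hi = h.hi + t.re := by
    obtain ⟨a, rfl, ha'⟩ := hc.exists_hi h
    obtain ⟨⟨q, b'⟩, hb, hb'⟩ := hc.exists_hi (ht.faceEquiv (hFace c a))
    obtain ⟨q, rfl⟩ := ht.squareEquiv.surjective q
    have h1 := hc.le_hi (ht.squareEquiv a.1, a.2)
    have h2 := hc.le_hi (q, b')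
    rw [← ht.faceEquiv_hFace] at h1
    have h3 : hFace c (q, b') = hFace c a := ht.faceEquiv.injective hb
    rw [h3] at h2
    simp only [ht.squareEquiv_val, x1_translate] at h1 hb'
    exact le_antisymm (by linarith) (by linarith)
  have hyy : (ht.faceEquiv h).y = h.y + t.im := by
    obtain ⟨⟨q, b⟩, rfl⟩ := exists_hFace h
    rw [ht.faceEquiv_hFace, y_hFace, y_hFace]
    cases b <;> simp [hy, ht.squareEquiv_val]
  refine Complex.ext ?_ hyy
  simp only [HFace.center, add_re, hlo, hhi]
  ring

theorem _root_.polyLine_map_add (t : ℂ) :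
    ∀ l : List ℂ, polyLine (l.map (· + t)) = (fun z => z + t) '' polyLine l
  | [] => by simp [polyLine_nil]
  | [a] => by simp [polyLine_singleton]
  | a :: b :: l => by
    have h := polyLine_map_add t (b :: l)
    have h1 : segment ℝ (a + t) (b + t) = (fun z => z + t) '' segment ℝ a b := by
      have h2 := segment_translate_image ℝ t a b
      simp only [add_comm t] at h2
      exact h2.symm
    rw [List.map_cons, List.map_cons] at *
    rw [polyLine_cons_cons, polyLine_cons_cons, image_union, h, h1]

theorem IsPeriod.drawPath (ht : IsPeriod c t) (hc : EdgeFiniteFor c) (q : T.squares) :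
    drawPath c (ht.squareEquiv q) = (SquareTiling.drawPath c q).map (· + t) := by
  have htop : topFace c (ht.squareEquiv q) = ht.faceEquiv (topFace c q) := rfl
  have hbot : bottomFace c (ht.squareEquiv q) = ht.faceEquiv (bottomFace c q) := rfl
  have hxc : (ht.squareEquiv q).1.xc = q.1.xc + t.re := by
    simp only [Square.xc, ht.squareEquiv_val, x0_translate, side_translate]; ring
  simp only [SquareTiling.drawPath, List.map_cons, List.map_nil, htop, hbot,
    ht.center_faceEquiv hc, ht.gap_faceEquiv, hxc]
  congr 2
  · refine Complex.ext rfl ?_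
    simp only [ht.squareEquiv_val, y1_translate, add_im]; ring
  · congr 1
    refine Complex.ext rfl ?_
    simp only [ht.squareEquiv_val, y0_translate, add_im]; ring

/-- Midpoints and gaps of faces and centres of squares are defined by the tiling and the choice
alone, so the nodes of every arc move along with the translation. -/
theorem IsPeriod.drawing (ht : IsPeriod c t) (hc : EdgeFiniteFor c) :
    hc.drawing.IsPeriod hc.weight t := by
  refine ⟨ht.faceEquiv, ht.squareEquiv, ht.center_faceEquiv hc, fun q => ?_, fun d d' h => ?_⟩
  · have key (q : T.squares) : polyLine (SquareTiling.drawPath c (ht.squareEquiv q)) =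
        (fun z => z + t) '' polyLine (SquareTiling.drawPath c q) := by
      rw [ht.drawPath hc, polyLine_map_add]
    exact key q
  · obtain ⟨a, rfl⟩ := hc.dart_bijective.2 d
    have h1 : d' = hc.dart (ht.squareEquiv a.1, a.2) := Subtype.ext h
    rw [h1, hc.weight_dart, hc.weight_dart]
    rfl

end translate

end SquareTiling

end

theorem mainTheorem1 (T : SquareTiling) :
    -- every choice of faces for which the tiling is edge finite
    (∀ c : T.FaceChoice, SquareTiling.EdgeFiniteFor c →
      -- existence, correspondence of squares, horizontal and vertical faces, and periodicity
      (∃ (M : PlaneGraph) (w : M.Dart → ℝ),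
        M.IsPlaneMap ∧ M.IsHarmonic w ∧ Nonempty (Corresponds c M w) ∧
        (∀ t : ℂ, SquareTiling.IsPeriod c t → M.IsPeriod w t) ∧
        (TwoPeriods (SquareTiling.IsPeriod c) → TwoPeriods (M.IsPeriod w))) ∧
      -- uniqueness for the given choice
      (∀ (M M' : PlaneGraph) (w : M.Dart → ℝ) (w' : M'.Dart → ℝ),
        M.IsPlaneMap → M'.IsPlaneMap →
        ∀ (r : Corresponds c M w) (r' : Corresponds c M' w'),
          ∃ Φ : M.Iso M',
            (∀ v, r'.vert (Φ.vert v) = r.vert v) ∧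
            (∀ e, r'.edge (Φ.edge e) = r.edge e) ∧
            (∀ f, r'.face (Φ.face f) = r.face f) ∧
            (∀ (d : M.Dart) (d' : M'.Dart),
              d'.1 = (Φ.vert d.1.1, Φ.edge d.1.2) → w' d' = w d))) ∧
    -- regular tilings
    (T.Regular →
      (∀ (c c' : T.FaceChoice) (M M' : PlaneGraph) (w : M.Dart → ℝ) (w' : M'.Dart → ℝ),
        M.IsPlaneMap → M'.IsPlaneMap →
        ∀ (r : Corresponds c M w) (r' : Corresponds c' M' w'),
          ∃ Φ : M.Iso M',
            (∀ e, r'.edge (Φ.edge e) = r.edge e) ∧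
            (∀ (d : M.Dart) (d' : M'.Dart),
              d'.1 = (Φ.vert d.1.1, Φ.edge d.1.2) → w' d' = w d)) ∧
      T.rotate.Regular ∧
      (∀ (c : T.FaceChoice) (c' : T.rotate.FaceChoice) (M M' : PlaneGraph)
        (w : M.Dart → ℝ) (w' : M'.Dart → ℝ),
        M.IsPlaneMap → M'.IsPlaneMap →
        ∀ (r : Corresponds c M w) (r' : Corresponds c' M' w'),
          ∃ Δ : M.DualIso M', ∀ e, (r'.edge e).1 = (r.edge (Δ.edge e)).1.rotate)) := by
  refine ⟨fun c hc => ⟨⟨hc.drawing, hc.weight, hc.isPlaneMap_drawing, hc.isHarmonic_weight,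
    ⟨hc.corresponds⟩, fun t ht => ht.drawing hc, ?_⟩, ?_⟩, fun hT => ⟨?_, hT.rotate, ?_⟩⟩
  · rintro ⟨t₁, t₂, hli, h₁, h₂⟩
    exact ⟨t₁, t₂, hli, h₁.drawing hc, h₂.drawing hc⟩
  · intro M M' w w' hM hM' r r'
    exact ⟨r.iso r' hM hM', fun v => r'.vert.apply_symm_apply _,
      fun e => r'.edge.apply_symm_apply _, fun f => r'.face.apply_symm_apply _,
      r.weight_eq r' hM hM'⟩
  · intro c c' M M' w w' hM hM' r r'
    obtain rfl := SquareTiling.FaceChoice.eq_of_singular_eq_empty hT.2 c c'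
    exact ⟨r.iso r' hM hM', fun e => r'.edge.apply_symm_apply _, r.weight_eq r' hM hM'⟩
  · intro c c' M M' w w' hM hM' r r'
    -- The rotated tiling has only one choice of faces, so `c'` is the rotated choice to which
    -- `dualIso` applies.
    obtain rfl := SquareTiling.FaceChoice.eq_of_singular_eq_empty hT.rotate.2 c' c.rotate
    exact ⟨r.dualIso r' hM hM', r.edge_dualIso r' hM hM'⟩
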